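/- **Conventions.** All vector spaces, algebras and Hopf algebras are over $\mathbb C$. *Filtered formal Hopf algebras.* Let $O$ be a Hopf algebra with coproduct $\Delta$, let $\Delta^{(n+1)}:O\to O^{\otimes (n+1)}$ be the iterated coproduct ($\Delta^{(1)}=\mathrm{id}$) and $\mathrm{pr}:O\to O/\mathbb C1$ the projection. For $n\ge 0$ put $$F_n^\heartsuit O=\operatorname{Ker}\bigl(\mathrm{pr}^{\otimes (n+1)}\circ\Delta^{(n+1)}:O\to (O/\mathbb C1)^{\otimes (n+1)}\bigr),\qquad F_{-1}^\heartsuit O=0 .$$ This is an increasing Hopf algebra filtration of $O$, so that $\mathrm{gr}^\heartsuit O=\bigoplus_{n\ge 0}F_n^\heartsuit O/F_{n-1}^\heartsuit O$ is a graded Hopf algebra. The Hopf algebra $O$ is called *filtered formal* if there is an isomorphism of Hopf algebras $\Phi:O\to\mathrm{gr}^\heartsuit O$ that is compatible with the filtrations, i.e. for all $n$ an element $x\in O$ lies in $F_n^\heartsuit O$ if and only if $\Phi(x)\in\bigoplus_{i\le n}\mathrm{gr}^\heartsuit_iO$, and whose associated graded is the identity, i.e. for all $n$ and $x\in F_n^\heartsuit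 O$ the degree $n$ component of $\Phi(x)$ is the class of $x$ in $F_n^\heartsuit O/F_{n-1}^\heartsuit O$. *The Hopf algebra $(\mathbb C\Gamma)'$.* Let $\Gamma$ be a finitely generated group and let $J\subset\mathbb C\Gamma$ be the augmentation ideal. Then $(\mathbb C\Gamma)'=\bigcup_{n\ge0}(J^{n+1})^\perp\subset(\mathbb C\Gamma)^*$, where $(J^{n+1})^\perp$ is the space of linear forms vanishing on $J^{n+1}$. It is a commutative Hopf algebra, with product dual to the coproduct of $\mathbb C\Gamma$, coproduct determined by $\Delta(\alpha)(x\otimes y)=\alpha(xy)$, counit $\alpha\mapsto\alpha(1)$ and antipode the transpose of that of $\mathbb C\Gamma$. (It is the coordinate ring of the pro-unipotent completion of $\Gamma$.) *Filtered formal groups.* Let $(\mathbb C\Gamma)^\wedge=\varprojlim_n\mathbb C\Gamma/J^n$, with filtration $F^n(\mathbb C\Gamma)^\wedge=\operatorname{Ker}\bigl((\mathbb C\Gamma)^\wedge\to\mathbb C\Gamma/J^n\bigr)$ and with the coproduct $\Delta:(\mathbb C\Gamma)^\wedge\to\varprojlim_n(\mathbb C\Gamma/J^n)^{\otimes 2}$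 induced by that of $\mathbb C\Gamma$. Let $\mathrm{Lie}(\Gamma)=\{a\in(\mathbb C\Gamma)^\wedge:\Delta(a)=a\otimes1+1\otimes a\}$, a Lie algebra for the commutator (the Malcev Lie algebra of $\Gamma$), with the filtration $F^n\mathrm{Lie}(\Gamma)=\mathrm{Lie}(\Gamma)\cap F^n(\mathbb C\Gamma)^\wedge$, so that $\mathrm{Lie}(\Gamma)=F^1\supset F^2\supset\cdots$ and $[F^i,F^j]\subset F^{i+j}$. With $\mathrm{gr}^n=F^n\mathrm{Lie}(\Gamma)/F^{n+1}\mathrm{Lie}(\Gamma)$, let $\widehat{\mathrm{gr}}\,\mathrm{Lie}(\Gamma)=\prod_{n\ge1}\mathrm{gr}^n$ be the completed associated graded Lie algebra, with bracket $[x,y]_n=\sum_{i+j=n}[x_i,y_j]$ and with filtration $F^n=\prod_{i\ge n}\mathrm{gr}^i$. The group $\Gamma$ is called *filtered formal* (in the sense of Suciu–Wang) if there is an isomorphism of Lie algebras $\mathrm{Lie}(\Gamma)\to\widehat{\mathrm{gr}}\,\mathrm{Lie}(\Gamma)$ that maps $F^n$ onto $F^n$ for all $n$ and whose associated graded is the identity,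 i.e. the degree $n$ component of the image of $x\in F^n\mathrm{Lie}(\Gamma)$ is the class of $x$ in $\mathrm{gr}^n$. **Proposition.** Let $\Gamma$ be a finitely generated group. If $\Gamma$ is filtered formal, then the commutative Hopf algebra $(\mathbb C\Gamma)'$ is filtered formal. -/

import Mathlib

open scoped TensorProduct DirectSum

noncomputable section

namespace FilteredFormality

/-! ### Tensor products of filtrations -/

section TensorFiltration

variable {k : Type*} [Field k] {V : Type*} [AddCommGroup V] [Module k V]

/-- The subspace `A ⊗ B` of `V ⊗ V`. -/
def tensorSub (A B : Submodule k V) : Submodule k (V ⊗[k] V) :=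
  Submodule.map₂ (TensorProduct.mk k V V) A B

/-- The tensor square filtration: its `n`-th term is `∑_{p+q=n} F_p ⊗ F_q`. -/
def tensorFilt (F : ℕ → Submodule k V) (n : ℕ) : Submodule k (V ⊗[k] V) :=
  ⨆ p ∈ Finset.HasAntidiagonal.antidiagonal n, tensorSub (F p.1) (F p.2)

theorem tmul_mem_tensorFilt {F : ℕ → Submodule k V} {p q n : ℕ} (h : p + q = n) {x y : V}
    (hx : x ∈ F p) (hy : y ∈ F q) : x ⊗ₜ[k] y ∈ tensorFilt F n :=
  (le_iSup₂_of_le (f := fun (p : ℕ × ℕ) (_ : p ∈ Finset.HasAntidiagonal.antidiagonal n) =>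
    tensorSub (F p.1) (F p.2)) (p, q) (Finset.HasAntidiagonal.mem_antidiagonal.2 h) le_rfl)
    (Submodule.apply_mem_map₂ _ hx hy)

theorem tensorFilt_le {F : ℕ → Submodule k V} {n : ℕ} {S : Submodule k (V ⊗[k] V)}
    (h : ∀ p q, p + q = n → ∀ x ∈ F p, ∀ y ∈ F q, x ⊗ₜ[k] y ∈ S) : tensorFilt F n ≤ S :=
  iSup₂_le fun p hp => Submodule.map₂_le.2 fun x hx y hy =>
    h p.1 p.2 (Finset.HasAntidiagonal.mem_antidiagonal.1 hp) x hx y hy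

/-- Two linear maps which agree on the pure tensors of `F_p ⊗ F_q`, `p + q = n`, agree on the
`n`-th term of the tensor square filtration. -/
theorem eqOn_tensorFilt {F : ℕ → Submodule k V} {n : ℕ} {W : Type*} [AddCommGroup W] [Module k W]
    {f g : V ⊗[k] V →ₗ[k] W}
    (h : ∀ p q, p + q = n → ∀ x ∈ F p, ∀ y ∈ F q, f (x ⊗ₜ[k] y) = g (x ⊗ₜ[k] y))
    {u : V ⊗[k] V} (hu : u ∈ tensorFilt F n) : f u = g u :=
  tensorFilt_le (S := LinearMap.eqLocus f g) h hu

end TensorFiltration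

/-! ### Hopf algebra filtrations and their associated graded Hopf algebras -/

/-- An increasing Hopf algebra filtration of a Hopf algebra `O`. -/
structure HopfFiltration (k O : Type*) [Field k] [Ring O] [HopfAlgebra k O] where
  /-- the terms of the filtration -/
  F : ℕ → Submodule k O
  mono : Monotone F
  one_mem : (1 : O) ∈ F 0
  mul_mem : ∀ {m n : ℕ} {x y : O}, x ∈ F m → y ∈ F n → x * y ∈ F (m + n)
  comul_mem : ∀ {n : ℕ} {x : O}, x ∈ F n →
    (CoalgebraStruct.comul x : O ⊗[k] O) ∈ tensorFilt F n
  antipode_mem : ∀ {n : ℕ} {x : O}, x ∈ F n → HopfAlgebra.antipode k x ∈ F n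

namespace HopfFiltration

variable {k O : Type*} [Field k] [Ring O] [HopfAlgebra k O] (E : HopfFiltration k O)

/-- The previous term `F_{n-1}` of the filtration, with `F_{-1} = 0`. -/
def pred : ℕ → Submodule k O
  | 0 => ⊥
  | n + 1 => E.F n

theorem le_pred {m n : ℕ} (h : m < n) : E.F m ≤ E.pred n := by
  cases n with
  | zero => omega
  | succ n => exact E.mono (Nat.lt_succ_iff.1 h)

/-- To belong to `F_{n-1}` is to vanish or to belong to `F_m` for some `m < n`. -/
theorem mem_pred {n : ℕ} {x : O} (h : x ∈ E.pred n) : x = 0 ∨ ∃ m, m < n ∧ x ∈ E.F m := by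
  cases n with
  | zero => exact Or.inl ((Submodule.mem_bot k).1 h)
  | succ n => exact Or.inr ⟨n, n.lt_succ_self, h⟩

/-- The graded piece `F_n / F_{n-1}`. -/
def Piece (n : ℕ) : Type _ := E.F n ⧸ (E.pred n).submoduleOf (E.F n)

instance (n : ℕ) : AddCommGroup (E.Piece n) :=
  inferInstanceAs (AddCommGroup (E.F n ⧸ (E.pred n).submoduleOf (E.F n)))

instance (n : ℕ) : Module k (E.Piece n) :=
  inferInstanceAs (Module k (E.F n ⧸ (E.pred n).submoduleOf (E.F n)))

/-- The projection `F_n → F_n / F_{n-1}`. -/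
def toPiece (n : ℕ) : E.F n →ₗ[k] E.Piece n := ((E.pred n).submoduleOf (E.F n)).mkQ

theorem toPiece_surjective (n : ℕ) : Function.Surjective (E.toPiece n) :=
  Submodule.mkQ_surjective _

theorem toPiece_eq_zero {n : ℕ} {x : E.F n} : E.toPiece n x = 0 ↔ (x : O) ∈ E.pred n :=
  Submodule.Quotient.mk_eq_zero _

theorem toPiece_eq {n : ℕ} {x y : E.F n} :
    E.toPiece n x = E.toPiece n y ↔ (x : O) - y ∈ E.pred n := by
  rw [← sub_eq_zero, ← map_sub, toPiece_eq_zero]; rfl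

theorem mk_toPiece_eq {m n : ℕ} (h : m = n) {x : E.F m} {y : E.F n} (hxy : (x : O) = y) :
    GradedMonoid.mk (A := E.Piece) m (E.toPiece m x) = GradedMonoid.mk n (E.toPiece n y) := by
  subst h
  rw [Subtype.ext hxy]

theorem mul_mem_pred_left {m n : ℕ} {x y : O} (hx : x ∈ E.pred m) (hy : y ∈ E.F n) :
    x * y ∈ E.pred (m + n) := by
  rcases E.mem_pred hx with rfl | ⟨i, hi, hx⟩
  · rw [zero_mul]; exact Submodule.zero_mem _
  · exact E.le_pred (by omega) (E.mul_mem hx hy)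

theorem mul_mem_pred_right {m n : ℕ} {x y : O} (hx : x ∈ E.F m) (hy : y ∈ E.pred n) :
    x * y ∈ E.pred (m + n) := by
  rcases E.mem_pred hy with rfl | ⟨i, hi, hy⟩
  · rw [mul_zero]; exact Submodule.zero_mem _
  · exact E.le_pred (by omega) (E.mul_mem hx hy)

/-- The product `F_m × F_n → F_{m+n} / F_{m+n-1}`. -/
def mulAux (m n : ℕ) : E.F m →ₗ[k] E.F n →ₗ[k] E.Piece (m + n) :=
  LinearMap.mk₂ k (fun x y => E.toPiece (m + n) ⟨x * y, E.mul_mem x.2 y.2⟩)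
    (fun x x' y => by rw [← map_add]; congr 1; ext; simp [add_mul])
    (fun c x y => by rw [← map_smul]; congr 1; ext; simp)
    (fun x y y' => by rw [← map_add]; congr 1; ext; simp [mul_add])
    (fun c x y => by rw [← map_smul]; congr 1; ext; simp)

/-- The product of graded pieces, induced by the product of `O`. -/
def pieceMul (m n : ℕ) : E.Piece m →ₗ[k] E.Piece n →ₗ[k] E.Piece (m + n) :=
  Submodule.liftQ _
    (LinearMap.flip (Submodule.liftQ ((E.pred n).submoduleOf (E.F n)) (E.mulAux m n).flip (by
      intro y hy
      ext x
      exact E.toPiece_eq_zero.2 (E.mul_mem_pred_right x.2 hy)))) (by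
      intro x hx
      refine LinearMap.ext fun y => ?_
      obtain ⟨y, rfl⟩ := E.toPiece_surjective n y
      exact E.toPiece_eq_zero.2 (E.mul_mem_pred_left hx y.2))

theorem pieceMul_toPiece {m n : ℕ} (x : E.F m) (y : E.F n) :
    E.pieceMul m n (E.toPiece m x) (E.toPiece n y) =
      E.toPiece (m + n) ⟨x * y, E.mul_mem x.2 y.2⟩ := rfl

instance : GradedMonoid.GMul E.Piece where
  mul := fun {m n} x y => E.pieceMul m n x y

instance : GradedMonoid.GOne E.Piece where
  one := E.toPiece 0 ⟨1, E.one_mem⟩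

instance : DirectSum.GRing E.Piece where
  mul_zero := fun a => map_zero _
  zero_mul := fun b => LinearMap.map_zero₂ (E.pieceMul _ _) b
  mul_add := fun a b c => map_add _ _ _
  add_mul := fun a b c => LinearMap.map_add₂ (E.pieceMul _ _) a b c
  one_mul := by
    rintro ⟨n, x⟩
    obtain ⟨x, rfl⟩ := E.toPiece_surjective n x
    exact E.mk_toPiece_eq (zero_add n) (one_mul _)
  mul_one := by
    rintro ⟨n, x⟩
    obtain ⟨x, rfl⟩ := E.toPiece_surjective n x
    exact E.mk_toPiece_eq (add_zero n) (mul_one _)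
  mul_assoc := by
    rintro ⟨m, x⟩ ⟨n, y⟩ ⟨p, z⟩
    obtain ⟨x, rfl⟩ := E.toPiece_surjective m x
    obtain ⟨y, rfl⟩ := E.toPiece_surjective n y
    obtain ⟨z, rfl⟩ := E.toPiece_surjective p z
    exact E.mk_toPiece_eq (add_assoc m n p) (mul_assoc _ _ _)
  natCast := fun a => E.toPiece 0 ((a : k) • ⟨1, E.one_mem⟩)
  natCast_zero := by simp
  natCast_succ := fun a => by
    rw [Nat.cast_succ, add_smul, one_smul, map_add]; rfl
  intCast := fun a => E.toPiece 0 ((a : k) • ⟨1, E.one_mem⟩)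
  intCast_ofNat := fun a => by rw [Int.cast_natCast]
  intCast_negSucc_ofNat := fun a => by
    rw [Int.cast_negSucc, ← map_neg]
    congr 1
    exact Subtype.ext (neg_smul (((a + 1 : ℕ) : ℕ) : k) (1 : O))

instance : DirectSum.GAlgebra k E.Piece where
  toFun := (LinearMap.toSpanSingleton k (E.Piece 0) (E.toPiece 0 ⟨1, E.one_mem⟩)).toAddMonoidHom
  map_one := one_smul k (E.toPiece 0 ⟨1, E.one_mem⟩)
  map_mul := fun r s => by
    refine E.mk_toPiece_eq (x := (r * s) • ⟨1, E.one_mem⟩) (add_zero 0).symm ?_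
    simp [mul_smul, mul_comm r s]
  commutes := by
    rintro r ⟨n, x⟩
    obtain ⟨x, rfl⟩ := E.toPiece_surjective n x
    exact E.mk_toPiece_eq (add_comm 0 n) (by simp)
  smul_def := by
    rintro r ⟨n, x⟩
    obtain ⟨x, rfl⟩ := E.toPiece_surjective n x
    exact E.mk_toPiece_eq (x := r • x) (zero_add n).symm (by simp)

/-- The associated graded space `gr O = ⨁_n F_n / F_{n-1}`. -/
abbrev Gr : Type _ := ⨁ n, E.Piece n

/-- The class in `gr O` of an element of `F_n`. -/
def cls (n : ℕ) : E.F n →ₗ[k] E.Gr := DirectSum.lof k ℕ E.Piece n ∘ₗ E.toPiece n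

/-- The degree `n` component of an element of `gr O`. -/
def component (n : ℕ) : E.Gr →ₗ[k] E.Piece n := DirectSum.component k ℕ E.Piece n

/-- The subspace `gr_{≤ n} O` of `gr O`. -/
def grLE (n : ℕ) : Submodule k E.Gr := ⨅ m : {m : ℕ // n < m}, LinearMap.ker (E.component m)

variable {E}

theorem cls_eq_zero {n : ℕ} {x : E.F n} (h : (x : O) ∈ E.pred n) : E.cls n x = 0 := by
  rw [cls, LinearMap.comp_apply, E.toPiece_eq_zero.2 h, map_zero]

theorem cls_congr {m n : ℕ} (h : m = n) {x : E.F m} {y : E.F n} (hxy : (x : O) = y) :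
    E.cls m x = E.cls n y := by
  subst h
  rw [Subtype.ext hxy]

theorem gr_ext {W : Type*} [AddCommGroup W] [Module k W] {f g : E.Gr →ₗ[k] W}
    (h : ∀ n (x : E.F n), f (E.cls n x) = g (E.cls n x)) : f = g := by
  refine DirectSum.linearMap_ext k fun n => LinearMap.ext fun x => ?_
  obtain ⟨x, rfl⟩ := E.toPiece_surjective n x
  exact h n x

theorem cls_mul {m n : ℕ} (x : E.F m) (y : E.F n) :
    E.cls m x * E.cls n y = E.cls (m + n) ⟨x * y, E.mul_mem x.2 y.2⟩ :=
  DirectSum.of_mul_of (A := E.Piece) _ _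

theorem one_eq_cls : (1 : E.Gr) = E.cls 0 ⟨1, E.one_mem⟩ := rfl

variable (E)

/-- A linear map out of `gr O` is given by linear maps on the `F_n` which vanish on `F_{n-1}`. -/
def grLift {W : Type*} [AddCommGroup W] [Module k W] (f : ∀ n, E.F n →ₗ[k] W)
    (hf : ∀ n (x : E.F n), (x : O) ∈ E.pred n → f n x = 0) : E.Gr →ₗ[k] W :=
  DirectSum.toModule k ℕ W fun n =>
    Submodule.liftQ ((E.pred n).submoduleOf (E.F n)) (f n) fun x hx => hf n x hx

theorem grLift_cls {W : Type*} [AddCommGroup W] [Module k W] (f : ∀ n, E.F n →ₗ[k] W)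
    (hf : ∀ n (x : E.F n), (x : O) ∈ E.pred n → f n x = 0) (n : ℕ) (x : E.F n) :
    E.grLift f hf (E.cls n x) = f n x :=
  DirectSum.toModule_lof k n _

/-- A linear extension to `O` of the class map `F_n → gr O`; no construction below depends on its
values outside `F_n`. -/
def ext (n : ℕ) : O →ₗ[k] E.Gr := (LinearMap.exists_extend (E.cls n)).choose

theorem ext_apply {n : ℕ} {x : O} (hx : x ∈ E.F n) : E.ext n x = E.cls n ⟨x, hx⟩ :=
  LinearMap.congr_fun (LinearMap.exists_extend (E.cls n)).choose_spec ⟨x, hx⟩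

theorem ext_eq_zero {m n : ℕ} (h : m < n) {x : O} (hx : x ∈ E.F m) : E.ext n x = 0 := by
  rw [E.ext_apply (E.mono h.le hx)]
  exact cls_eq_zero (E.le_pred h hx)

/-- The symbol of degree `n` on `O ⊗ O`: on `∑_{p+q=n} F_p ⊗ F_q` it takes the sum of the classes
in `⨁_{p+q=n} gr_p O ⊗ gr_q O`. -/
def symb (n : ℕ) : O ⊗[k] O →ₗ[k] E.Gr ⊗[k] E.Gr :=
  ∑ p ∈ Finset.HasAntidiagonal.antidiagonal n, TensorProduct.map (E.ext p.1) (E.ext p.2)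

theorem symb_tmul {p q n : ℕ} (h : p + q = n) {x y : O} (hx : x ∈ E.F p) (hy : y ∈ E.F q) :
    E.symb n (x ⊗ₜ[k] y) = E.cls p ⟨x, hx⟩ ⊗ₜ[k] E.cls q ⟨y, hy⟩ := by
  rw [symb, LinearMap.sum_apply, Finset.sum_eq_single (p, q)]
  · rw [TensorProduct.map_tmul, E.ext_apply hx, E.ext_apply hy]
  · rintro ⟨a, b⟩ hab hne
    have hab' : a + b = n := Finset.HasAntidiagonal.mem_antidiagonal.1 hab
    rw [TensorProduct.map_tmul]
    rcases lt_trichotomy p a with hpa | rfl | hpa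
    · rw [E.ext_eq_zero hpa hx, TensorProduct.zero_tmul]
    · exact absurd (congrArg (Prod.mk p) (show b = q by omega)) hne
    · rw [E.ext_eq_zero (show q < b by omega) hy, TensorProduct.tmul_zero]
  · intro hn
    exact absurd (Finset.HasAntidiagonal.mem_antidiagonal.2 h) hn

theorem symb_eq_zero {m n : ℕ} (h : m < n) {u : O ⊗[k] O} (hu : u ∈ tensorFilt E.F m) :
    E.symb n u = 0 := by
  refine eqOn_tensorFilt (g := 0) ?_ hu
  intro p q hpq x hx y hy
  rw [E.symb_tmul (show p + (q + (n - m)) = n by omega) hx (E.mono (by omega) hy),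
    E.cls_eq_zero (n := q + (n - m)) (E.le_pred (by omega) hy), TensorProduct.tmul_zero,
    LinearMap.zero_apply]

/-- The coproduct of `gr O`, induced by the coproduct of `O`. -/
def grComul : E.Gr →ₗ[k] E.Gr ⊗[k] E.Gr :=
  E.grLift (fun n => E.symb n ∘ₗ CoalgebraStruct.comul ∘ₗ (E.F n).subtype) (by
    intro n x hx
    rcases E.mem_pred hx with h | ⟨m, hm, hx⟩
    · simp [h]
    · exact E.symb_eq_zero hm (E.comul_mem hx))

/-- The counit of `gr O`, induced by the counit of `O`; it vanishes in positive degrees. -/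
def grCounit : E.Gr →ₗ[k] k :=
  E.grLift (fun n => if n = 0 then CoalgebraStruct.counit ∘ₗ (E.F n).subtype else 0) (by
    rintro (_ | n) x hx
    · have h : (x : O) = 0 := (Submodule.mem_bot k).1 hx
      simp [h]
    · simp)

/-- The antipode of `gr O`, induced by the antipode of `O`. -/
def grAntipode : E.Gr →ₗ[k] E.Gr :=
  E.grLift (fun n => E.cls n ∘ₗ
      (HopfAlgebra.antipode k).restrict (p := E.F n) (q := E.F n) fun _ hx => E.antipode_mem hx) (by
    intro n x hx
    refine cls_eq_zero ?_
    rcases E.mem_pred hx with h | ⟨m, hm, hx⟩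
    · simp [LinearMap.restrict_apply, h]
    · exact E.le_pred hm (E.antipode_mem hx))

variable {E}

theorem grComul_cls {n : ℕ} (x : E.F n) :
    E.grComul (E.cls n x) = E.symb n (CoalgebraStruct.comul (x : O)) :=
  E.grLift_cls _ _ n x

theorem grCounit_cls_zero (x : E.F 0) :
    E.grCounit (E.cls 0 x) = CoalgebraStruct.counit (x : O) :=
  E.grLift_cls _ _ 0 x

theorem grCounit_cls_pos {n : ℕ} (hn : n ≠ 0) (x : E.F n) : E.grCounit (E.cls n x) = 0 := by
  refine (E.grLift_cls _ _ n x).trans ?_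
  rw [if_neg hn]; rfl

theorem grAntipode_cls {n : ℕ} (x : E.F n) :
    E.grAntipode (E.cls n x) =
      E.cls n ⟨HopfAlgebra.antipode k (x : O), E.antipode_mem x.2⟩ :=
  E.grLift_cls _ _ n x

/-- The degree `n` symbol on triple tensors. -/
def symb₃ (E : HopfFiltration k O) (n : ℕ) :
    O ⊗[k] (O ⊗[k] O) →ₗ[k] E.Gr ⊗[k] (E.Gr ⊗[k] E.Gr) :=
  ∑ p ∈ Finset.HasAntidiagonal.antidiagonal n, TensorProduct.map (E.ext p.1) (E.symb p.2)

theorem symb₃_tmul {p q n : ℕ} (h : p + q = n) {x : O} {v : O ⊗[k] O} (hx : x ∈ E.F p)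
    (hv : v ∈ tensorFilt E.F q) :
    E.symb₃ n (x ⊗ₜ[k] v) = E.cls p ⟨x, hx⟩ ⊗ₜ[k] E.symb q v := by
  rw [symb₃, LinearMap.sum_apply, Finset.sum_eq_single (p, q)]
  · rw [TensorProduct.map_tmul, E.ext_apply hx]
  · rintro ⟨a, b⟩ hab hne
    have hab' : a + b = n := Finset.HasAntidiagonal.mem_antidiagonal.1 hab
    rw [TensorProduct.map_tmul]
    rcases lt_trichotomy p a with hpa | rfl | hpa
    · rw [E.ext_eq_zero hpa hx, TensorProduct.zero_tmul]
    · exact absurd (congrArg (Prod.mk p) (show b = q by omega)) hne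
    · rw [E.symb_eq_zero (show q < b by omega) hv, TensorProduct.tmul_zero]
  · intro hn
    exact absurd (Finset.HasAntidiagonal.mem_antidiagonal.2 h) hn

theorem lTensor_symb {n : ℕ} {u : O ⊗[k] O} (hu : u ∈ tensorFilt E.F n) :
    E.grComul.lTensor E.Gr (E.symb n u) =
      E.symb₃ n (CoalgebraStruct.comul.lTensor O u) := by
  refine eqOn_tensorFilt (f := E.grComul.lTensor E.Gr ∘ₗ E.symb n)
    (g := E.symb₃ n ∘ₗ CoalgebraStruct.comul.lTensor O) ?_ hu
  intro p q hpq x hx y hy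
  simp only [LinearMap.comp_apply, LinearMap.lTensor_tmul]
  rw [E.symb_tmul hpq hx hy, LinearMap.lTensor_tmul, grComul_cls,
    symb₃_tmul hpq hx (E.comul_mem hy)]

theorem rTensor_symb {n : ℕ} {u : O ⊗[k] O} (hu : u ∈ tensorFilt E.F n) :
    TensorProduct.assoc k E.Gr E.Gr E.Gr (E.grComul.rTensor E.Gr (E.symb n u)) =
      E.symb₃ n (TensorProduct.assoc k O O O (CoalgebraStruct.comul.rTensor O u)) := by
  refine eqOn_tensorFilt
    (f := (TensorProduct.assoc k E.Gr E.Gr E.Gr).toLinearMap ∘ₗ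
      E.grComul.rTensor E.Gr ∘ₗ E.symb n)
    (g := E.symb₃ n ∘ₗ (TensorProduct.assoc k O O O).toLinearMap ∘ₗ
      CoalgebraStruct.comul.rTensor O) ?_ hu
  intro p q hpq x hx y hy
  simp only [LinearMap.comp_apply, LinearMap.rTensor_tmul, LinearEquiv.coe_coe]
  rw [E.symb_tmul hpq hx hy, LinearMap.rTensor_tmul, grComul_cls]
  refine eqOn_tensorFilt (n := p)
    (f := (TensorProduct.assoc k E.Gr E.Gr E.Gr).toLinearMap ∘ₗ
      (TensorProduct.mk k _ _).flip (E.cls q ⟨y, hy⟩) ∘ₗ E.symb p)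
    (g := E.symb₃ n ∘ₗ (TensorProduct.assoc k O O O).toLinearMap ∘ₗ
      (TensorProduct.mk k _ _).flip y) ?_ (E.comul_mem hx)
  intro a b hab z hz w hw
  simp only [LinearMap.comp_apply, LinearMap.flip_apply, TensorProduct.mk_apply,
    LinearEquiv.coe_coe, TensorProduct.assoc_tmul]
  rw [E.symb_tmul hab hz hw, TensorProduct.assoc_tmul,
    symb₃_tmul (q := b + q) (by omega) hz (tmul_mem_tensorFilt rfl hw hy),
    E.symb_tmul rfl hw hy]

theorem rTensor_grCounit_symb {n : ℕ} {u : O ⊗[k] O} (hu : u ∈ tensorFilt E.F n) :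
    TensorProduct.lid k E.Gr (E.grCounit.rTensor E.Gr (E.symb n u)) =
      E.ext n (TensorProduct.lid k O ((CoalgebraStruct.counit (R := k)).rTensor O u)) := by
  refine eqOn_tensorFilt
    (f := (TensorProduct.lid k E.Gr).toLinearMap ∘ₗ E.grCounit.rTensor E.Gr ∘ₗ E.symb n)
    (g := E.ext n ∘ₗ (TensorProduct.lid k O).toLinearMap ∘ₗ
      (CoalgebraStruct.counit (R := k)).rTensor O) ?_ hu
  intro p q hpq x hx y hy
  simp only [LinearMap.comp_apply, LinearMap.rTensor_tmul, LinearEquiv.coe_coe,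
    TensorProduct.lid_tmul, map_smul]
  rw [E.symb_tmul hpq hx hy, LinearMap.rTensor_tmul, TensorProduct.lid_tmul]
  rcases Nat.eq_zero_or_pos p with rfl | hp
  · obtain rfl : q = n := by omega
    rw [grCounit_cls_zero, E.ext_apply hy]
  · rw [grCounit_cls_pos hp.ne', E.ext_eq_zero (show q < n by omega) hy, zero_smul, smul_zero]

theorem lTensor_grCounit_symb {n : ℕ} {u : O ⊗[k] O} (hu : u ∈ tensorFilt E.F n) :
    TensorProduct.rid k E.Gr (E.grCounit.lTensor E.Gr (E.symb n u)) =
      E.ext n (TensorProduct.rid k O ((CoalgebraStruct.counit (R := k)).lTensor O u)) := by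
  refine eqOn_tensorFilt
    (f := (TensorProduct.rid k E.Gr).toLinearMap ∘ₗ E.grCounit.lTensor E.Gr ∘ₗ E.symb n)
    (g := E.ext n ∘ₗ (TensorProduct.rid k O).toLinearMap ∘ₗ
      (CoalgebraStruct.counit (R := k)).lTensor O) ?_ hu
  intro p q hpq x hx y hy
  simp only [LinearMap.comp_apply, LinearMap.lTensor_tmul, LinearEquiv.coe_coe,
    TensorProduct.rid_tmul, map_smul]
  rw [E.symb_tmul hpq hx hy, LinearMap.lTensor_tmul, TensorProduct.rid_tmul]
  rcases Nat.eq_zero_or_pos q with rfl | hq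
  · obtain rfl : p = n := by omega
    rw [grCounit_cls_zero, E.ext_apply hx]
  · rw [grCounit_cls_pos hq.ne', E.ext_eq_zero (show p < n by omega) hx, zero_smul, smul_zero]

instance : Coalgebra k E.Gr where
  comul := E.grComul
  counit := E.grCounit
  coassoc := gr_ext fun n x => by
    simp only [LinearMap.comp_apply, LinearEquiv.coe_coe]
    rw [grComul_cls, rTensor_symb (E.comul_mem x.2), lTensor_symb (E.comul_mem x.2),
      Coalgebra.coassoc_apply]
  rTensor_counit_comp_comul := gr_ext fun n x => by
    apply (TensorProduct.lid k E.Gr).injective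
    simp only [LinearMap.comp_apply]
    rw [grComul_cls, rTensor_grCounit_symb (E.comul_mem x.2), Coalgebra.rTensor_counit_comul,
      TensorProduct.lid_tmul, one_smul, E.ext_apply x.2, TensorProduct.mk_apply,
      TensorProduct.lid_tmul, one_smul]
  lTensor_counit_comp_comul := gr_ext fun n x => by
    apply (TensorProduct.rid k E.Gr).injective
    simp only [LinearMap.comp_apply]
    rw [grComul_cls, lTensor_grCounit_symb (E.comul_mem x.2), Coalgebra.lTensor_counit_comul,
      TensorProduct.rid_tmul, one_smul, E.ext_apply x.2, LinearMap.flip_apply,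
      TensorProduct.mk_apply, TensorProduct.rid_tmul, one_smul]

theorem symb_mul {m n : ℕ} {u v : O ⊗[k] O} (hu : u ∈ tensorFilt E.F m)
    (hv : v ∈ tensorFilt E.F n) : E.symb (m + n) (u * v) = E.symb m u * E.symb n v := by
  refine eqOn_tensorFilt (f := E.symb (m + n) ∘ₗ (LinearMap.mul k _).flip v)
    (g := (LinearMap.mul k _).flip (E.symb n v) ∘ₗ E.symb m) ?_ hu
  intro p q hpq x hx y hy
  simp only [LinearMap.comp_apply, LinearMap.flip_apply, LinearMap.mul_apply']
  refine eqOn_tensorFilt (f := E.symb (m + n) ∘ₗ LinearMap.mul k _ (x ⊗ₜ[k] y))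
    (g := LinearMap.mul k _ (E.symb m (x ⊗ₜ[k] y)) ∘ₗ E.symb n) ?_ hv
  intro p' q' hpq' x' hx' y' hy'
  simp only [LinearMap.comp_apply, LinearMap.mul_apply', Algebra.TensorProduct.tmul_mul_tmul]
  rw [E.symb_tmul hpq hx hy, E.symb_tmul hpq' hx' hy',
    E.symb_tmul (p := p + p') (q := q + q') (by omega) (E.mul_mem hx hx') (E.mul_mem hy hy'),
    Algebra.TensorProduct.tmul_mul_tmul, cls_mul, cls_mul]

instance : Bialgebra k E.Gr where
  counit_one := by
    rw [one_eq_cls]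
    exact (grCounit_cls_zero _).trans Bialgebra.counit_one
  mul_compr₂_counit := by
    refine gr_ext fun m x => gr_ext fun n y => ?_
    change E.grCounit (E.cls m x * E.cls n y) = E.grCounit (E.cls m x) * E.grCounit (E.cls n y)
    rw [cls_mul]
    rcases Nat.eq_zero_or_pos m with rfl | hm
    · rcases Nat.eq_zero_or_pos n with rfl | hn
      · exact (grCounit_cls_zero ⟨(x : O) * y, E.mul_mem x.2 y.2⟩).trans
          ((Bialgebra.counit_mul (x : O) (y : O)).trans
            (congrArg₂ (· * ·) (grCounit_cls_zero x).symm (grCounit_cls_zero y).symm))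
      · rw [grCounit_cls_pos hn.ne', grCounit_cls_pos (by omega), mul_zero]
    · rw [grCounit_cls_pos hm.ne', grCounit_cls_pos (by omega), zero_mul]
  comul_one := by
    rw [one_eq_cls]
    refine (grComul_cls _).trans ?_
    rw [Bialgebra.comul_one, Algebra.TensorProduct.one_def,
      E.symb_tmul (add_zero 0) E.one_mem E.one_mem]
    rfl
  mul_compr₂_comul := by
    refine gr_ext fun m x => gr_ext fun n y => ?_
    change E.grComul (E.cls m x * E.cls n y) = E.grComul (E.cls m x) * E.grComul (E.cls n y)
    rw [cls_mul, grComul_cls, grComul_cls, grComul_cls, Bialgebra.comul_mul,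
      symb_mul (E.comul_mem x.2) (E.comul_mem y.2)]

theorem mul_rTensor_symb {n : ℕ} {u : O ⊗[k] O} (hu : u ∈ tensorFilt E.F n) :
    LinearMap.mul' k E.Gr (E.grAntipode.rTensor E.Gr (E.symb n u)) =
      E.ext n (LinearMap.mul' k O ((HopfAlgebra.antipode k).rTensor O u)) := by
  refine eqOn_tensorFilt
    (f := LinearMap.mul' k E.Gr ∘ₗ E.grAntipode.rTensor E.Gr ∘ₗ E.symb n)
    (g := E.ext n ∘ₗ LinearMap.mul' k O ∘ₗ (HopfAlgebra.antipode k).rTensor O) ?_ hu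
  rintro p q rfl x hx y hy
  simp only [LinearMap.comp_apply, LinearMap.rTensor_tmul, LinearMap.mul'_apply]
  rw [E.symb_tmul rfl hx hy, LinearMap.rTensor_tmul, LinearMap.mul'_apply, grAntipode_cls,
    cls_mul, E.ext_apply (E.mul_mem (E.antipode_mem hx) hy)]

theorem mul_lTensor_symb {n : ℕ} {u : O ⊗[k] O} (hu : u ∈ tensorFilt E.F n) :
    LinearMap.mul' k E.Gr (E.grAntipode.lTensor E.Gr (E.symb n u)) =
      E.ext n (LinearMap.mul' k O ((HopfAlgebra.antipode k).lTensor O u)) := by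
  refine eqOn_tensorFilt
    (f := LinearMap.mul' k E.Gr ∘ₗ E.grAntipode.lTensor E.Gr ∘ₗ E.symb n)
    (g := E.ext n ∘ₗ LinearMap.mul' k O ∘ₗ (HopfAlgebra.antipode k).lTensor O) ?_ hu
  rintro p q rfl x hx y hy
  simp only [LinearMap.comp_apply, LinearMap.lTensor_tmul, LinearMap.mul'_apply]
  rw [E.symb_tmul rfl hx hy, LinearMap.lTensor_tmul, LinearMap.mul'_apply, grAntipode_cls,
    cls_mul, E.ext_apply (E.mul_mem hx (E.antipode_mem hy))]

theorem ext_algebraMap_counit {n : ℕ} (x : E.F n) :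
    E.ext n (algebraMap k O (CoalgebraStruct.counit (x : O))) =
      algebraMap k E.Gr (E.grCounit (E.cls n x)) := by
  rw [Algebra.algebraMap_eq_smul_one, Algebra.algebraMap_eq_smul_one, map_smul]
  rcases Nat.eq_zero_or_pos n with rfl | hn
  · rw [grCounit_cls_zero, E.ext_apply E.one_mem, one_eq_cls]
  · rw [grCounit_cls_pos hn.ne', E.ext_eq_zero hn E.one_mem, zero_smul, smul_zero]

/-- The associated graded of a Hopf algebra filtration is a Hopf algebra. -/
instance : HopfAlgebra k E.Gr where
  antipode := E.grAntipode
  mul_antipode_rTensor_comul := gr_ext fun n x => by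
    change LinearMap.mul' k E.Gr (E.grAntipode.rTensor E.Gr (E.grComul (E.cls n x))) =
      algebraMap k E.Gr (E.grCounit (E.cls n x))
    rw [grComul_cls, mul_rTensor_symb (E.comul_mem x.2),
      HopfAlgebra.mul_antipode_rTensor_comul_apply, ext_algebraMap_counit]
  mul_antipode_lTensor_comul := gr_ext fun n x => by
    change LinearMap.mul' k E.Gr (E.grAntipode.lTensor E.Gr (E.grComul (E.cls n x))) =
      algebraMap k E.Gr (E.grCounit (E.cls n x))
    rw [grComul_cls, mul_lTensor_symb (E.comul_mem x.2),
      HopfAlgebra.mul_antipode_lTensor_comul_apply, ext_algebraMap_counit]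

end HopfFiltration

/-! ### The filtration by iterated reduced coproducts -/

section Heart

section Linear

variable {k : Type*} [Field k] {V : Type*} [AddCommGroup V] [Module k V]

theorem tensorSub_mono {A A' B B' : Submodule k V} (hA : A ≤ A') (hB : B ≤ B') :
    tensorSub A B ≤ tensorSub A' B' :=
  Submodule.map₂_le_map₂ hA hB

theorem tmul_mem_tensorSub {A B : Submodule k V} {x y : V} (hx : x ∈ A) (hy : y ∈ B) :
    x ⊗ₜ[k] y ∈ tensorSub A B :=
  Submodule.apply_mem_map₂ _ hx hy

theorem tensorSub_le {A B : Submodule k V} {S : Submodule k (V ⊗[k] V)}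
    (h : ∀ x ∈ A, ∀ y ∈ B, x ⊗ₜ[k] y ∈ S) : tensorSub A B ≤ S :=
  Submodule.map₂_le.2 h

theorem ker_map_mkQ (A B : Submodule k V) :
    LinearMap.ker (TensorProduct.map A.mkQ B.mkQ) = tensorSub A ⊤ ⊔ tensorSub ⊤ B := by
  rw [TensorProduct.map_ker (LinearMap.exact_subtype_mkQ A) (Submodule.mkQ_surjective A)
    (LinearMap.exact_subtype_mkQ B) (Submodule.mkQ_surjective B), sup_comm]
  congr 1
  · refine le_antisymm ?_ (tensorSub_le fun x hx y _ => ⟨(⟨x, hx⟩ : A) ⊗ₜ y, rfl⟩)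
    rintro _ ⟨t, rfl⟩
    induction t with
    | zero => simp
    | add a b ha hb => rw [map_add]; exact Submodule.add_mem _ ha hb
    | tmul a b => exact tmul_mem_tensorSub a.2 trivial
  · refine le_antisymm ?_ (tensorSub_le fun x _ y hy => ⟨x ⊗ₜ (⟨y, hy⟩ : B), rfl⟩)
    rintro _ ⟨t, rfl⟩
    induction t with
    | zero => simp
    | add a b ha hb => rw [map_add]; exact Submodule.add_mem _ ha hb
    | tmul a b => exact tmul_mem_tensorSub trivial b.2

theorem ker_map_eq {V₁ V₂ : Type*} [AddCommMonoid V₁] [Module k V₁]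
    [AddCommMonoid V₂] [Module k V₂]
    (f : V →ₗ[k] V₁) (g : V →ₗ[k] V₂) :
    LinearMap.ker (TensorProduct.map f g) =
      LinearMap.ker (TensorProduct.map (LinearMap.ker f).mkQ (LinearMap.ker g).mkQ) := by
  let _ : AddCommGroup V₁ := Module.addCommMonoidToAddCommGroup k
  let _ : AddCommGroup V₂ := Module.addCommMonoidToAddCommGroup k
  have hf : f = (LinearMap.ker f).liftQ f le_rfl ∘ₗ (LinearMap.ker f).mkQ :=
    (Submodule.liftQ_mkQ _ _ _).symm
  have hg : g = (LinearMap.ker g).liftQ g le_rfl ∘ₗ (LinearMap.ker g).mkQ :=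
    (Submodule.liftQ_mkQ _ _ _).symm
  conv_lhs => rw [hf, hg, TensorProduct.map_comp]
  refine LinearMap.ker_comp_of_ker_eq_bot _ (LinearMap.ker_eq_bot.2 ?_)
  exact TensorProduct.map_injective_of_flat_flat _ _
    (LinearMap.ker_eq_bot.1 (Submodule.ker_liftQ_eq_bot _ _ _ le_rfl))
    (LinearMap.ker_eq_bot.1 (Submodule.ker_liftQ_eq_bot _ _ _ le_rfl))

theorem tensorSub_inter {A B B' : Submodule k V} (hB : B' ≤ B) {w : V ⊗[k] V}
    (h₁ : w ∈ tensorSub ⊤ B) (h₂ : w ∈ tensorSub A ⊤ ⊔ tensorSub ⊤ B') :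
    w ∈ tensorSub A B ⊔ tensorSub ⊤ B' := by
  obtain ⟨p, hp⟩ := LinearMap.exists_leftInverse_of_injective B.subtype B.ker_subtype
  have hp' : ∀ y (hy : y ∈ B), (p y : V) = y := fun y hy =>
    congrArg Subtype.val (LinearMap.congr_fun hp ⟨y, hy⟩)
  have hw : (B.subtype ∘ₗ p).lTensor V w = w :=
    tensorSub_le (S := LinearMap.eqLocus ((B.subtype ∘ₗ p).lTensor V) LinearMap.id)
      (fun x _ y hy => by simp [LinearMap.mem_eqLocus, hp' y hy]) h₁
  rw [← hw]
  have key : tensorSub A ⊤ ⊔ tensorSub ⊤ B' ≤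
      (tensorSub A B ⊔ tensorSub ⊤ B').comap ((B.subtype ∘ₗ p).lTensor V) := by
    refine sup_le (tensorSub_le fun x hx y _ => ?_) (tensorSub_le fun x _ y hy => ?_)
    · exact Submodule.mem_sup_left (tmul_mem_tensorSub hx (p y).2)
    · refine Submodule.mem_sup_right ?_
      simp only [LinearMap.lTensor_tmul, LinearMap.comp_apply, Submodule.subtype_apply,
        hp' y (hB hy)]
      exact tmul_mem_tensorSub trivial hy
  exact key h₂

theorem mem_tensorFilt_of_forall {F : ℕ → Submodule k V} (hF : Monotone F) {n : ℕ}
    {u : V ⊗[k] V} (h₀ : u ∈ tensorSub ⊤ (F n)) (hn : u ∈ tensorSub (F n) ⊤)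
    (h : ∀ a b, a + b + 1 = n → u ∈ tensorSub (F a) ⊤ ⊔ tensorSub ⊤ (F b)) :
    u ∈ tensorFilt F n := by
  have claim : ∀ m, m ≤ n → ∃ s w, u = s + w ∧ s ∈ tensorFilt F n ∧ s ∈ tensorSub (F m) ⊤ ∧
      w ∈ tensorSub ⊤ (F (n - m)) := by
    intro m
    induction m with
    | zero => exact fun _ => ⟨0, u, (zero_add u).symm, zero_mem _, zero_mem _, h₀⟩
    | succ m ih =>
      intro hm
      obtain ⟨s, w, hu, hs, hs', hw⟩ := ih (by omega)
      have hw' : w ∈ tensorSub (F m) ⊤ ⊔ tensorSub ⊤ (F (n - (m + 1))) := by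
        rw [show w = u - s by rw [hu]; abel]
        exact Submodule.sub_mem _ (h _ _ (by omega)) (Submodule.mem_sup_left hs')
      obtain ⟨w₁, hw₁, w₂, hw₂, rfl⟩ :=
        Submodule.mem_sup.1 (tensorSub_inter (hF (by omega)) hw hw')
      refine ⟨s + w₁, w₂, by rw [hu, add_assoc], Submodule.add_mem _ hs ?_, ?_, hw₂⟩
      · exact tensorSub_le (fun x hx y hy => tmul_mem_tensorFilt (by omega) hx hy) hw₁
      · refine tensorSub_mono (hF m.le_succ) le_rfl (Submodule.add_mem _ hs' ?_)
        exact tensorSub_mono le_rfl le_top hw₁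
  obtain ⟨s, w, hu, hs, hs', hw⟩ := claim n le_rfl
  have hw' : w ∈ tensorSub (F n) ⊤ ⊔ tensorSub ⊤ ⊥ := by
    rw [show w = u - s by rw [hu]; abel]
    exact Submodule.mem_sup_left (Submodule.sub_mem _ hn hs')
  rw [hu]
  refine Submodule.add_mem _ hs ?_
  refine (sup_le ?_ ?_ : tensorSub (F n) (F (n - n)) ⊔ tensorSub ⊤ ⊥ ≤ tensorFilt F n)
    (tensorSub_inter bot_le hw hw')
  · exact tensorSub_le fun x hx y hy => tmul_mem_tensorFilt (by omega) hx hy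
  · refine tensorSub_le fun x _ y hy => ?_
    rw [(Submodule.mem_bot k).1 hy, TensorProduct.tmul_zero]
    exact zero_mem _

end Linear

variable (k : Type*) (O : Type*) [Field k] [Ring O] [HopfAlgebra k O]

/-- The line `k 1` in `O`. -/
def unitLine : Submodule k O := Submodule.span k {1}

/-- The iterated coproduct `Δ^{(n+1)} : O → O^{⊗ (n+1)}`. -/
def iterComul : (n : ℕ) → O →ₗ[k] (⨂[k]^(n + 1)) O
  | 0 => (PiTensorProduct.subsingletonEquiv (R := k) (s := fun _ : Fin 1 => O) 0).symm.toLinearMap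
  | n + 1 => TensorPower.mulEquiv.toLinearMap ∘ₗ
      TensorProduct.map (iterComul n)
        (PiTensorProduct.subsingletonEquiv (R := k) (s := fun _ : Fin 1 => O) 0).symm.toLinearMap ∘ₗ
      CoalgebraStruct.comul

/-- The `n`-th tensor power of the projection `O → O / k 1`. -/
def projPow (n : ℕ) : (⨂[k]^n) O →ₗ[k] (⨂[k]^n) (O ⧸ unitLine k O) :=
  PiTensorProduct.map fun _ => (unitLine k O).mkQ

/-- `F_n^♡ O`, the kernel of `O → O^{⊗ (n+1)} → (O / k 1)^{⊗ (n+1)}`. -/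
def heartF (n : ℕ) : Submodule k O := LinearMap.ker (projPow k O (n + 1) ∘ₗ iterComul k O n)

variable {k O}

theorem projPow_mulEquiv (m n : ℕ) (t : (⨂[k]^m) O ⊗[k] (⨂[k]^n) O) :
    projPow k O (m + n) (TensorPower.mulEquiv t) =
      TensorPower.mulEquiv (TensorProduct.map (projPow k O m) (projPow k O n) t) := by
  have : projPow k O (m + n) ∘ₗ TensorPower.mulEquiv.toLinearMap =
      TensorPower.mulEquiv.toLinearMap ∘ₗ TensorProduct.map (projPow k O m) (projPow k O n) := by
    ext a b
    simp only [LinearMap.compMultilinearMap_apply, TensorProduct.AlgebraTensorModule.curry_apply,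
      LinearMap.restrictScalars_self, TensorProduct.curry_apply, LinearMap.comp_apply,
      LinearEquiv.coe_coe, TensorProduct.map_tmul, projPow, PiTensorProduct.map_tprod]
    rw [← TensorPower.gMul_def, ← TensorPower.gMul_def, TensorPower.tprod_mul_tprod,
      TensorPower.tprod_mul_tprod, PiTensorProduct.map_tprod]
    congr 1
    ext i
    refine Fin.addCases (fun i => ?_) (fun i => ?_) i <;> simp
  exact LinearMap.congr_fun this t

/-- The subspace of all `x` with `Δ x ∈ A ⊗ O + O ⊗ B`. -/
def wedge (A B : Submodule k O) : Submodule k O :=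
  LinearMap.ker (TensorProduct.map A.mkQ B.mkQ ∘ₗ CoalgebraStruct.comul)

theorem mem_wedge {A B : Submodule k O} {x : O} :
    x ∈ wedge A B ↔ (CoalgebraStruct.comul x : O ⊗[k] O) ∈ tensorSub A ⊤ ⊔ tensorSub ⊤ B := by
  rw [← ker_map_mkQ]; rfl

theorem ker_map_comul {V₁ V₂ : Type*} [AddCommMonoid V₁] [Module k V₁] [AddCommMonoid V₂]
    [Module k V₂] (f : O →ₗ[k] V₁) (g : O →ₗ[k] V₂) :
    LinearMap.ker (TensorProduct.map f g ∘ₗ CoalgebraStruct.comul) =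
      wedge (LinearMap.ker f) (LinearMap.ker g) := by
  rw [wedge, LinearMap.ker_comp, LinearMap.ker_comp, ker_map_eq]

theorem wedge_assoc (A B C : Submodule k O) :
    wedge (wedge A B) C = wedge A (wedge B C) := by
  have h₁ := ker_map_comul (TensorProduct.map A.mkQ B.mkQ ∘ₗ CoalgebraStruct.comul) C.mkQ
  have h₂ := ker_map_comul A.mkQ (TensorProduct.map B.mkQ C.mkQ ∘ₗ CoalgebraStruct.comul)
  rw [Submodule.ker_mkQ] at h₁ h₂
  change _ = wedge (wedge A B) C at h₁
  change _ = wedge A (wedge B C) at h₂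
  rw [← h₁, ← h₂]
  ext x
  rw [LinearMap.mem_ker, LinearMap.mem_ker,
    ← (TensorProduct.assoc k (O ⧸ A) (O ⧸ B) (O ⧸ C)).map_eq_zero_iff]
  refine Eq.congr ?_ rfl
  have e₁ : (TensorProduct.assoc k (O ⧸ A) (O ⧸ B) (O ⧸ C)).toLinearMap ∘ₗ
      TensorProduct.map (TensorProduct.map A.mkQ B.mkQ ∘ₗ CoalgebraStruct.comul) C.mkQ =
      TensorProduct.map A.mkQ (TensorProduct.map B.mkQ C.mkQ) ∘ₗ
        (TensorProduct.assoc k O O O).toLinearMap ∘ₗ CoalgebraStruct.comul.rTensor O := by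
    rw [← LinearMap.map_comp_rTensor, ← LinearMap.comp_assoc, ← LinearMap.comp_assoc,
      TensorProduct.map_map_comp_assoc_eq]
  have e₂ : TensorProduct.map A.mkQ (TensorProduct.map B.mkQ C.mkQ ∘ₗ CoalgebraStruct.comul) =
      TensorProduct.map A.mkQ (TensorProduct.map B.mkQ C.mkQ) ∘ₗ
        CoalgebraStruct.comul.lTensor O := by
    rw [LinearMap.map_comp_lTensor]
  have := LinearMap.congr_fun e₁ (CoalgebraStruct.comul x)
  simp only [LinearMap.comp_apply, LinearEquiv.coe_coe] at this
  rw [LinearMap.comp_apply, LinearMap.comp_apply, this, e₂, Coalgebra.coassoc_apply]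
  rfl

theorem heartF_zero : heartF k O 0 = unitLine k O := by
  have : projPow k O 1 ∘ₗ iterComul k O 0 =
      (PiTensorProduct.subsingletonEquiv (R := k)
        (s := fun _ : Fin 1 => O ⧸ unitLine k O) 0).symm.toLinearMap ∘ₗ (unitLine k O).mkQ := by
    ext x
    simp only [projPow, iterComul, LinearMap.comp_apply, LinearEquiv.coe_coe,
      PiTensorProduct.subsingletonEquiv_symm_apply]
    refine (PiTensorProduct.map_tprod _ _).trans (congrArg _ (funext fun i => ?_))
    obtain rfl : i = 0 := Subsingleton.elim i 0
    simp [Function.update]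
  rw [heartF, this, LinearEquiv.ker_comp, Submodule.ker_mkQ]

theorem heartF_succ (n : ℕ) : heartF k O (n + 1) = wedge (heartF k O n) (heartF k O 0) := by
  have h : projPow k O (n + 1 + 1) ∘ₗ iterComul k O (n + 1) =
      (TensorPower.mulEquiv (R := k) (M := O ⧸ unitLine k O) (n := n + 1) (m := 1)).toLinearMap ∘ₗ
        (TensorProduct.map (projPow k O (n + 1) ∘ₗ iterComul k O n)
          (projPow k O (0 + 1) ∘ₗ iterComul k O 0) ∘ₗ CoalgebraStruct.comul) := by
    refine LinearMap.ext fun x => ?_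
    refine (projPow_mulEquiv (n + 1) 1 _).trans (congrArg TensorPower.mulEquiv ?_)
    rw [TensorProduct.map_comp]
    rfl
  rw [heartF, h, LinearEquiv.ker_comp]
  exact ker_map_comul (projPow k O (n + 1) ∘ₗ iterComul k O n)
    (projPow k O (0 + 1) ∘ₗ iterComul k O 0)

theorem heartF_wedge (a b : ℕ) :
    heartF k O (a + b + 1) = wedge (heartF k O a) (heartF k O b) := by
  induction b with
  | zero => exact heartF_succ a
  | succ b ih => rw [← add_assoc, heartF_succ, ih, wedge_assoc, ← heartF_succ]

theorem mem_heartF_zero {x : O} : x ∈ heartF k O 0 ↔ ∃ c : k, c • (1 : O) = x := by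
  rw [heartF_zero, unitLine, Submodule.mem_span_singleton]

theorem one_mem_heartF : (1 : O) ∈ heartF k O 0 := mem_heartF_zero.2 ⟨1, one_smul k 1⟩

theorem heartF_le_succ (n : ℕ) : heartF k O n ≤ heartF k O (n + 1) := by
  induction n with
  | zero =>
    intro x hx
    obtain ⟨c, rfl⟩ := mem_heartF_zero.1 hx
    rw [heartF_succ, mem_wedge, map_smul, Bialgebra.comul_one, Algebra.TensorProduct.one_def]
    exact Submodule.smul_mem _ _
      (Submodule.mem_sup_left (tmul_mem_tensorSub one_mem_heartF trivial))
  | succ n ih =>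
    intro x hx
    rw [heartF_succ, mem_wedge] at hx ⊢
    exact sup_le_sup (tensorSub_mono ih le_rfl) le_rfl hx

theorem heartF_mono : Monotone (heartF k O) := monotone_nat_of_le_succ heartF_le_succ

theorem comul_mem_right {n : ℕ} {x : O} (hx : x ∈ heartF k O n) :
    (CoalgebraStruct.comul x : O ⊗[k] O) ∈ tensorSub ⊤ (heartF k O n) := by
  cases n with
  | zero =>
    obtain ⟨c, rfl⟩ := mem_heartF_zero.1 hx
    rw [map_smul, Bialgebra.comul_one, Algebra.TensorProduct.one_def]
    exact Submodule.smul_mem _ _ (tmul_mem_tensorSub trivial one_mem_heartF)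
  | succ n =>
    have h := mem_wedge.1 ((heartF_wedge 0 n).le (by rwa [zero_add]))
    obtain ⟨s, hs, w, hw, hsw⟩ := Submodule.mem_sup.1 h
    obtain ⟨a, rfl⟩ : s ∈ LinearMap.range (TensorProduct.mk k O O 1) := by
      refine tensorSub_le (fun y hy z _ => ?_) hs
      obtain ⟨c, rfl⟩ := mem_heartF_zero.1 hy
      exact ⟨c • z, by rw [TensorProduct.mk_apply, TensorProduct.tmul_smul,
        TensorProduct.smul_tmul']⟩
    have hb : TensorProduct.lid k O ((CoalgebraStruct.counit (R := k)).rTensor O w) ∈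
        heartF k O n := by
      refine tensorSub_le (S := (heartF k O n).comap ((TensorProduct.lid k O).toLinearMap ∘ₗ
        (CoalgebraStruct.counit (R := k)).rTensor O)) (fun y _ z hz => ?_) hw
      simpa using Submodule.smul_mem _ _ hz
    have hx' := congrArg (fun u => TensorProduct.lid k O
      ((CoalgebraStruct.counit (R := k)).rTensor O u)) hsw
    simp only [map_add, Coalgebra.rTensor_counit_comul, TensorProduct.mk_apply,
      LinearMap.rTensor_tmul, TensorProduct.lid_tmul, Bialgebra.counit_one, one_smul] at hx'
    have ha : a ∈ heartF k O (n + 1) := by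
      rw [eq_sub_of_add_eq hx']
      exact Submodule.sub_mem _ hx (heartF_le_succ n hb)
    rw [← hsw]
    exact Submodule.add_mem _ (tmul_mem_tensorSub trivial ha)
      (tensorSub_mono le_rfl (heartF_le_succ n) hw)

theorem comul_mem_left {n : ℕ} {x : O} (hx : x ∈ heartF k O n) :
    (CoalgebraStruct.comul x : O ⊗[k] O) ∈ tensorSub (heartF k O n) ⊤ := by
  cases n with
  | zero =>
    obtain ⟨c, rfl⟩ := mem_heartF_zero.1 hx
    rw [map_smul, Bialgebra.comul_one, Algebra.TensorProduct.one_def]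
    exact Submodule.smul_mem _ _ (tmul_mem_tensorSub one_mem_heartF trivial)
  | succ n =>
    have h := mem_wedge.1 ((heartF_wedge n 0).le hx)
    obtain ⟨w, hw, s, hs, hsw⟩ := Submodule.mem_sup.1 h
    obtain ⟨a, rfl⟩ : s ∈ LinearMap.range ((TensorProduct.mk k O O).flip 1) := by
      refine tensorSub_le (fun z _ y hy => ?_) hs
      obtain ⟨c, rfl⟩ := mem_heartF_zero.1 hy
      exact ⟨c • z, by rw [LinearMap.flip_apply, TensorProduct.mk_apply,
        TensorProduct.smul_tmul]⟩
    have hb : TensorProduct.rid k O ((CoalgebraStruct.counit (R := k)).lTensor O w) ∈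
        heartF k O n := by
      refine tensorSub_le (S := (heartF k O n).comap ((TensorProduct.rid k O).toLinearMap ∘ₗ
        (CoalgebraStruct.counit (R := k)).lTensor O)) (fun y hy z _ => ?_) hw
      simpa using Submodule.smul_mem _ _ hy
    have hx' := congrArg (fun u => TensorProduct.rid k O
      ((CoalgebraStruct.counit (R := k)).lTensor O u)) hsw
    simp only [map_add, Coalgebra.lTensor_counit_comul, TensorProduct.mk_apply,
      LinearMap.flip_apply,
      LinearMap.lTensor_tmul, TensorProduct.rid_tmul, Bialgebra.counit_one, one_smul] at hx'
    have ha : a ∈ heartF k O (n + 1) := by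
      rw [eq_sub_of_add_eq' hx']
      exact Submodule.sub_mem _ hx (heartF_le_succ n hb)
    rw [← hsw]
    exact Submodule.add_mem _ (tensorSub_mono (heartF_le_succ n) le_rfl hw)
      (tmul_mem_tensorSub ha trivial)

theorem comul_mem_heartF {n : ℕ} {x : O} (hx : x ∈ heartF k O n) :
    (CoalgebraStruct.comul x : O ⊗[k] O) ∈ tensorFilt (heartF k O) n := by
  refine mem_tensorFilt_of_forall heartF_mono (comul_mem_right hx) (comul_mem_left hx) ?_
  rintro a b rfl
  exact mem_wedge.1 ((heartF_wedge a b).le hx)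

theorem mul_mem_heartF {m n : ℕ} {x y : O} (hx : x ∈ heartF k O m) (hy : y ∈ heartF k O n) :
    x * y ∈ heartF k O (m + n) := by
  induction h : m + n using Nat.strong_induction_on generalizing m n x y with
  | _ N ih =>
    cases N with
    | zero =>
      obtain rfl : m = 0 := by omega
      obtain rfl : n = 0 := by omega
      obtain ⟨c, rfl⟩ := mem_heartF_zero.1 hx
      obtain ⟨d, rfl⟩ := mem_heartF_zero.1 hy
      exact mem_heartF_zero.2 ⟨c * d, by rw [smul_mul_smul_comm, mul_one]⟩
    | succ N =>
      rw [heartF_succ, mem_wedge, Bialgebra.comul_mul]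
      refine tensorFilt_le (S := (tensorSub (heartF k O N) ⊤ ⊔
        tensorSub ⊤ (heartF k O 0)).comap
          ((LinearMap.mul k (O ⊗[k] O)).flip (CoalgebraStruct.comul y)))
        (fun p q hpq a ha b hb => ?_) (comul_mem_heartF hx)
      refine tensorFilt_le (S := (tensorSub (heartF k O N) ⊤ ⊔
        tensorSub ⊤ (heartF k O 0)).comap (LinearMap.mul k (O ⊗[k] O) (a ⊗ₜ b)))
        (fun p' q' hpq' a' ha' b' hb' => ?_) (comul_mem_heartF hy)
      rw [Submodule.mem_comap, LinearMap.mul_apply', Algebra.TensorProduct.tmul_mul_tmul]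
      by_cases hlt : p + p' < N + 1
      · exact Submodule.mem_sup_left (tmul_mem_tensorSub
          (heartF_mono (by omega) (ih _ hlt ha ha' rfl)) trivial)
      · obtain rfl : q = 0 := by omega
        obtain rfl : q' = 0 := by omega
        exact Submodule.mem_sup_right (tmul_mem_tensorSub trivial (ih 0 (by omega) hb hb' rfl))

theorem antipode_mem_heartF {n : ℕ} {x : O} (hx : x ∈ heartF k O n) :
    HopfAlgebra.antipode k x ∈ heartF k O n := by
  induction n using Nat.strong_induction_on generalizing x with
  | _ n ih =>
    have key := eqOn_tensorFilt
      (f := (heartF k O n).mkQ ∘ₗ LinearMap.mul' k O ∘ₗ (HopfAlgebra.antipode k).rTensor O)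
      (g := (heartF k O n).mkQ ∘ₗ HopfAlgebra.antipode k ∘ₗ (TensorProduct.rid k O).toLinearMap ∘ₗ
        (CoalgebraStruct.counit (R := k)).lTensor O) (F := heartF k O) (n := n) (by
          intro p q hpq y hy z hz
          simp only [LinearMap.comp_apply, LinearMap.rTensor_tmul, LinearMap.mul'_apply,
            LinearMap.lTensor_tmul, LinearEquiv.coe_coe, TensorProduct.rid_tmul, map_smul]
          by_cases hp : p < n
          · have hy' := ih p hp hy
            have h₁ := mul_mem_heartF hy' hz
            rw [hpq] at h₁
            have h₂ := heartF_mono hp.le hy'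
            rw [Submodule.mkQ_apply, Submodule.mkQ_apply, (Submodule.Quotient.mk_eq_zero _).2 h₁,
              (Submodule.Quotient.mk_eq_zero _).2 h₂, smul_zero]
          · obtain rfl : q = 0 := by omega
            obtain ⟨c, rfl⟩ := mem_heartF_zero.1 hz
            rw [mul_smul_comm, mul_one, map_smul, map_smul, Bialgebra.counit_one, smul_eq_mul,
              mul_one])
      (comul_mem_heartF hx)
    simp only [LinearMap.comp_apply, HopfAlgebra.mul_antipode_rTensor_comul_apply,
      Coalgebra.lTensor_counit_comul, LinearEquiv.coe_coe, TensorProduct.rid_tmul, one_smul] at key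
    rw [Submodule.mkQ_apply, Submodule.mkQ_apply, (Submodule.Quotient.mk_eq_zero _).2] at key
    · exact (Submodule.Quotient.mk_eq_zero _).1 key.symm
    · exact heartF_mono n.zero_le (mem_heartF_zero.2 ⟨_, (Algebra.algebraMap_eq_smul_one _).symm⟩)

variable (k O)

/-- The filtration `F_•^♡ O` is a Hopf algebra filtration. -/
def heart : HopfFiltration k O where
  F := heartF k O
  mono := heartF_mono
  one_mem := one_mem_heartF
  mul_mem := mul_mem_heartF
  comul_mem := comul_mem_heartF
  antipode_mem := antipode_mem_heartF

/-- The graded Hopf algebra `gr^♡ O`. -/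
abbrev GrHeart : Type _ := (heart k O).Gr

/-- A Hopf algebra `O` is filtered formal if there is an isomorphism of Hopf algebras
`Φ : O → gr^♡ O` (a bialgebra isomorphism automatically commutes with antipodes), matching
`F_n^♡ O` with `gr^♡_{≤ n} O` for all `n`, whose associated graded is the identity: for all `n` and
`x ∈ F_n^♡ O`, the degree `n` component of `Φ x` is the class of `x` in `gr^♡_n O`. -/
def IsFilteredFormalHopf : Prop :=
  ∃ Φ : O ≃ₐc[k] GrHeart k O,
    (∀ (n : ℕ) (x : O), x ∈ heartF k O n ↔ Φ x ∈ (heart k O).grLE n) ∧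
    ∀ (n : ℕ) (x : heartF k O n), (heart k O).component n (Φ x) = (heart k O).toPiece n x

end Heart

/-! ### The dual Hopf algebra `H'` -/

section Dual

open WithConv

theorem tensorFilt_mul {k H : Type*} [Field k] [Ring H] [Algebra k H] {F : ℕ → Submodule k H}
    (hF : ∀ {m n : ℕ} {x y : H}, x ∈ F m → y ∈ F n → x * y ∈ F (m + n)) {m n : ℕ}
    {u v : H ⊗[k] H} (hu : u ∈ tensorFilt F m) (hv : v ∈ tensorFilt F n) :
    u * v ∈ tensorFilt F (m + n) := by
  refine tensorFilt_le
    (S := (tensorFilt F (m + n)).comap ((LinearMap.mul k (H ⊗[k] H)).flip v))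
    (fun p q hpq a ha b hb => ?_) hu
  refine tensorFilt_le
    (S := (tensorFilt F (m + n)).comap (LinearMap.mul k (H ⊗[k] H) (a ⊗ₜ b)))
    (fun p' q' hpq' a' ha' b' hb' => ?_) hv
  rw [Submodule.mem_comap, LinearMap.mul_apply', Algebra.TensorProduct.tmul_mul_tmul]
  exact tmul_mem_tensorFilt (p := p + p') (q := q + q') (by omega) (hF ha ha') (hF hb hb')

variable (k H : Type*) [Field k] [Ring H] [HopfAlgebra k H]

/-- The augmentation ideal `J` of `H`. -/
def augIdeal : Ideal H := RingHom.ker (Bialgebra.counitAlgHom k H)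

instance : (augIdeal k H).IsTwoSided :=
  inferInstanceAs (RingHom.ker (Bialgebra.counitAlgHom k H)).IsTwoSided

/-- The decreasing filtration `F^n H = J^n` (with `F^0 H = H`). -/
def augFilt (n : ℕ) : Submodule k H := (augIdeal k H ^ n).restrictScalars k

variable {k H}

theorem mem_augFilt {n : ℕ} {x : H} : x ∈ augFilt k H n ↔ x ∈ augIdeal k H ^ n := Iff.rfl

theorem mem_augIdeal {x : H} : x ∈ augIdeal k H ↔ CoalgebraStruct.counit (R := k) x = 0 := Iff.rfl

theorem mem_augFilt_zero (x : H) : x ∈ augFilt k H 0 := by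
  rw [mem_augFilt, Submodule.pow_zero, Ideal.one_eq_top]; trivial

theorem augFilt_anti : Antitone (augFilt k H) := fun _ _ h => Ideal.pow_le_pow_right h

theorem mem_augFilt_one {x : H} :
    x ∈ augFilt k H 1 ↔ CoalgebraStruct.counit (R := k) x = 0 := by
  rw [mem_augFilt, Submodule.pow_one, mem_augIdeal]

theorem mul_mem_augFilt {m n : ℕ} {x y : H} (hx : x ∈ augFilt k H m) (hy : y ∈ augFilt k H n) :
    x * y ∈ augFilt k H (m + n) := by
  rw [mem_augFilt, Ideal.IsTwoSided.pow_add]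
  exact Ideal.mul_mem_mul hx hy

theorem augFilt_succ_induction {n : ℕ} {S : Submodule k H}
    (h : ∀ x ∈ augFilt k H 1, ∀ y ∈ augFilt k H n, x * y ∈ S) : augFilt k H (n + 1) ≤ S := by
  intro z hz
  rw [mem_augFilt, Ideal.IsTwoSided.pow_succ] at hz
  refine Submodule.mul_induction_on hz (fun x hx y hy => h x ?_ y hy) fun x y hx hy =>
    Submodule.add_mem _ hx hy
  rwa [mem_augFilt, Submodule.pow_one]

theorem sub_counit_mem (x : H) :
    x - CoalgebraStruct.counit (R := k) x • (1 : H) ∈ augFilt k H 1 := by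
  rw [mem_augFilt_one, map_sub, map_smul, Bialgebra.counit_one, smul_eq_mul, mul_one, sub_self]

theorem comul_mem_augFilt {n : ℕ} {x : H} (hx : x ∈ augFilt k H n) :
    (CoalgebraStruct.comul x : H ⊗[k] H) ∈ tensorFilt (augFilt k H) n := by
  induction n generalizing x with
  | zero =>
    generalize (CoalgebraStruct.comul x : H ⊗[k] H) = u
    induction u with
    | zero => exact zero_mem _
    | add a b ha hb => exact Submodule.add_mem _ ha hb
    | tmul a b =>
      exact tmul_mem_tensorFilt (add_zero 0) (mem_augFilt_zero a) (mem_augFilt_zero b)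
  | succ n ih =>
    refine augFilt_succ_induction (S := (tensorFilt (augFilt k H) (n + 1)).comap
      CoalgebraStruct.comul) (fun x hx y hy => ?_) hx
    rw [Submodule.mem_comap, Bialgebra.comul_mul, add_comm n 1]
    refine tensorFilt_mul mul_mem_augFilt ?_ (ih hy)
    have h : ∀ u : H ⊗[k] H, u - 1 ⊗ₜ TensorProduct.lid k H
        ((CoalgebraStruct.counit (R := k)).rTensor H u) ∈ tensorFilt (augFilt k H) 1 := by
      intro u
      induction u with
      | zero => simp
      | add a b ha hb =>
        have := Submodule.add_mem _ ha hb
        rw [map_add, map_add, TensorProduct.tmul_add]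
        convert this using 1
        abel
      | tmul a b =>
        rw [LinearMap.rTensor_tmul, TensorProduct.lid_tmul, TensorProduct.tmul_smul,
          TensorProduct.smul_tmul', ← TensorProduct.sub_tmul]
        exact tmul_mem_tensorFilt (add_zero 1) (sub_counit_mem a) (mem_augFilt_zero b)
    have h' := h (CoalgebraStruct.comul x)
    rw [Coalgebra.rTensor_counit_comul, TensorProduct.lid_tmul, one_smul] at h'
    have h'' := Submodule.add_mem _ h'
      (tmul_mem_tensorFilt (zero_add 1) (mem_augFilt_zero (1 : H)) hx)
    rwa [sub_add_cancel] at h''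

theorem antipode_mem_augFilt {n : ℕ} {x : H} (hx : x ∈ augFilt k H n) :
    HopfAlgebra.antipode k x ∈ augFilt k H n := by
  induction n generalizing x with
  | zero => exact mem_augFilt_zero _
  | succ n ih =>
    refine augFilt_succ_induction (S := (augFilt k H (n + 1)).comap
      (HopfAlgebra.antipode k)) (fun x hx y hy => ?_) hx
    rw [Submodule.mem_comap, HopfAlgebra.antipode_mul_antidistrib]
    refine mul_mem_augFilt (ih hy) ?_
    rw [mem_augFilt_one, HopfAlgebra.counit_antipode]
    exact mem_augFilt_one.1 hx

variable (k H)

/-- `F_n H^* = (F^{n+1} H)^⊥`, inside the dual of `H` with its convolution product. -/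
def dualFilt (n : ℕ) : Submodule k (WithConv (H →ₗ[k] k)) where
  carrier := {α | ∀ h ∈ augFilt k H (n + 1), α.ofConv h = 0}
  zero_mem' := fun h _ => rfl
  add_mem' := fun {α β} hα hβ h hh => by
    rw [ofConv_add, LinearMap.add_apply, hα h hh, hβ h hh, add_zero]
  smul_mem' := fun c α hα h hh => by
    rw [ofConv_smul, LinearMap.smul_apply, hα h hh, smul_zero]

variable {k H}

theorem dualFilt_mono : Monotone (dualFilt k H) := fun _ _ h _ hα x hx =>
  hα x (augFilt_anti (Nat.succ_le_succ h) hx)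

theorem one_mem_dualFilt : (1 : WithConv (H →ₗ[k] k)) ∈ dualFilt k H 0 := fun h hh => by
  rw [LinearMap.convOne_apply, mem_augFilt_one.1 hh, map_zero]

theorem mul_mem_dualFilt {m n : ℕ} {α β : WithConv (H →ₗ[k] k)} (hα : α ∈ dualFilt k H m)
    (hβ : β ∈ dualFilt k H n) : α * β ∈ dualFilt k H (m + n) := by
  intro h hh
  rw [LinearMap.convMul_apply]
  refine eqOn_tensorFilt (f := LinearMap.mul' k k ∘ₗ TensorProduct.map α.ofConv β.ofConv) (g := 0)
    ?_ (comul_mem_augFilt hh)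
  intro p q hpq x hx y hy
  rw [LinearMap.comp_apply, TensorProduct.map_tmul, LinearMap.mul'_apply, LinearMap.zero_apply]
  by_cases hp : m + 1 ≤ p
  · rw [hα x (augFilt_anti hp hx), zero_mul]
  · rw [hβ y (augFilt_anti (by omega) hy), mul_zero]

variable (k H)

/-- The algebra `H' = ⋃_n F_n H^*`, a subalgebra of the dual algebra `H^*` (whose product is
dual to the coproduct of `H`). -/
def hopfDual : Subalgebra k (WithConv (H →ₗ[k] k)) where
  carrier := {α | ∃ n, α ∈ dualFilt k H n}
  mul_mem' := fun ⟨_, hα⟩ ⟨_, hβ⟩ => ⟨_, mul_mem_dualFilt hα hβ⟩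
  add_mem' := fun ⟨_, hα⟩ ⟨_, hβ⟩ => ⟨_, Submodule.add_mem _
    (dualFilt_mono (le_max_left _ _) hα) (dualFilt_mono (le_max_right _ _) hβ)⟩
  algebraMap_mem' := fun c => ⟨0, by
    rw [Algebra.algebraMap_eq_smul_one]
    exact Submodule.smul_mem _ _ one_mem_dualFilt⟩

/-- The type of elements of `H'`. -/
def HopfDual : Type _ := hopfDual k H

instance : Ring (HopfDual k H) := inferInstanceAs (Ring (hopfDual k H))

instance : Algebra k (HopfDual k H) := inferInstanceAs (Algebra k (hopfDual k H))

/-- The Hopf algebras `H` for which `gr^1 H = J / J^2` is finite dimensional. -/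
class FiniteCotangent : Prop where
  finite : FiniteDimensional k (augFilt k H 1 ⧸ (augFilt k H 2).submoduleOf (augFilt k H 1))

/-- The value of an element of `H'` at an element of `H`. -/
def ev : HopfDual k H →ₗ[k] (H → k) where
  toFun α h := α.1.ofConv h
  map_add' _ _ := rfl
  map_smul' _ _ := rfl

variable {k H}

theorem ev_injective : Function.Injective (ev k H) := fun _ _ h =>
  Subtype.ext (WithConv.ext (LinearMap.ext fun x => congrFun h x))

theorem ev_map_add (α : HopfDual k H) (x y : H) : ev k H α (x + y) = ev k H α x + ev k H α y :=
  map_add α.1.ofConv x y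

theorem ev_map_smul (α : HopfDual k H) (c : k) (x : H) : ev k H α (c • x) = c * ev k H α x :=
  map_smul α.1.ofConv c x

theorem ev_one (h : H) : ev k H 1 h = CoalgebraStruct.counit h := rfl

theorem ev_mul (α β : HopfDual k H) {ι : Type*} {h : H} (r : Coalgebra.Repr k h ι) :
    ev k H (α * β) h = ∑ i ∈ r.index, ev k H α (r.left i) * ev k H β (r.right i) :=
  r.convMul_apply _ _

section EvTensor

variable {A B X Y : Type*} [AddCommMonoid A] [Module k A] [AddCommMonoid B] [Module k B]

/-- The evaluation of tensors, from evaluations of the factors. -/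
def evTensor (e : A →ₗ[k] (X → k)) (f : B →ₗ[k] (Y → k)) : A ⊗[k] B →ₗ[k] (X × Y → k) :=
  TensorProduct.lift (LinearMap.mk₂ k (fun a b p => e a p.1 * f b p.2)
    (fun a a' b => by ext p; simp [add_mul])
    (fun c a b => by ext p; simp [mul_assoc])
    (fun a b b' => by ext p; simp [mul_add])
    (fun c a b => by ext p; simp [mul_left_comm]))

theorem evTensor_tmul (e : A →ₗ[k] (X → k)) (f : B →ₗ[k] (Y → k)) (a : A) (b : B) (x : X) (y : Y) :
    evTensor e f (a ⊗ₜ b) (x, y) = e a x * f b y := rfl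

theorem evTensor_injective {e : A →ₗ[k] (X → k)} {f : B →ₗ[k] (Y → k)}
    (he : Function.Injective e) (hf : Function.Injective f) :
    Function.Injective (evTensor e f) := by
  classical
  let _ : AddCommGroup A := Module.addCommMonoidToAddCommGroup k
  let _ : AddCommGroup B := Module.addCommMonoidToAddCommGroup k
  rw [injective_iff_map_eq_zero]
  intro u hu
  let b := Module.Basis.ofVectorSpace k B
  obtain ⟨t, rfl⟩ := (TensorProduct.equivFinsuppOfBasisRight (M := A) b).symm.surjective u
  rw [TensorProduct.equivFinsuppOfBasisRight_symm_apply] at hu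
  have h : ∀ x : X, ∑ i ∈ t.support, e (t i) x • b i = 0 := by
    intro x
    apply hf
    ext y
    have := congrFun hu (x, y)
    rw [Finsupp.sum, map_sum, Finset.sum_apply] at this
    rw [map_sum, map_zero, Finset.sum_apply]
    refine Eq.trans (Finset.sum_congr rfl fun i _ => ?_) this
    rw [map_smul, Pi.smul_apply, smul_eq_mul, evTensor_tmul]
  have ht : t = 0 := by
    ext i
    by_cases hi : i ∈ t.support
    · apply he
      ext x
      rw [linearIndependent_iff'.1 b.linearIndependent t.support (fun i => e (t i) x) (h x) i hi]
      simp
    · simpa using hi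
  rw [ht, map_zero]

end EvTensor

variable (k H)

/-- The evaluation `H' ⊗ H' → k^{H × H}`. -/
def ev₂ : HopfDual k H ⊗[k] HopfDual k H →ₗ[k] (H × H → k) := evTensor (ev k H) (ev k H)

/-- The evaluation `H' ⊗ (H' ⊗ H') → k^{H × (H × H)}`. -/
def ev₃ : HopfDual k H ⊗[k] (HopfDual k H ⊗[k] HopfDual k H) →ₗ[k] (H × (H × H) → k) :=
  evTensor (ev k H) (ev₂ k H)

variable {k H}

theorem ev₂_injective : Function.Injective (ev₂ k H) :=
  evTensor_injective ev_injective ev_injective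

theorem ev₃_injective : Function.Injective (ev₃ k H) :=
  evTensor_injective ev_injective ev₂_injective

theorem ev₂_tmul (α β : HopfDual k H) (x y : H) :
    ev₂ k H (α ⊗ₜ β) (x, y) = ev k H α x * ev k H β y := rfl

theorem ev₃_tmul (α : HopfDual k H) (u : HopfDual k H ⊗[k] HopfDual k H) (x : H) (p : H × H) :
    ev₃ k H (α ⊗ₜ u) (x, p) = ev k H α x * ev₂ k H u p := rfl

section Finite

set_option linter.unusedSectionVars false

variable [FiniteCotangent k H]

theorem exists_fg_cotangent :
    ∃ V : Submodule k H, V.FG ∧ V ≤ augFilt k H 1 ∧ augFilt k H 1 ≤ V ⊔ augFilt k H 2 := by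
  have := FiniteCotangent.finite (k := k) (H := H)
  set N := (augFilt k H 2).submoduleOf (augFilt k H 1)
  obtain ⟨s, hs⟩ := (Module.Finite.fg_top : (⊤ : Submodule k (augFilt k H 1 ⧸ N)).FG)
  let lift := Function.surjInv N.mkQ_surjective
  let V₀ : Submodule k (augFilt k H 1) := Submodule.span k (lift '' s)
  have hV₀ : V₀.map N.mkQ = ⊤ := by
    rw [Submodule.map_span, ← hs, ← Set.image_comp]
    congr 1
    convert Set.image_id (s : Set (augFilt k H 1 ⧸ N)) using 1
    exact Set.image_congr fun x _ => Function.surjInv_eq N.mkQ_surjective x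
  refine ⟨V₀.map (augFilt k H 1).subtype, ?_, Submodule.map_subtype_le _ _, ?_⟩
  · exact (Submodule.fg_span (s.finite_toSet.image _)).map _
  · intro x hx
    obtain ⟨v, hv, hvx⟩ : N.mkQ ⟨x, hx⟩ ∈ V₀.map N.mkQ := by rw [hV₀]; trivial
    have h : ((⟨x, hx⟩ : augFilt k H 1) - v : augFilt k H 1) ∈ N :=
      (Submodule.Quotient.eq N).1 hvx.symm
    refine Submodule.mem_sup.2 ⟨v, ⟨v, hv, rfl⟩, x - v, h, by abel⟩

theorem finite_quotient_augFilt (n : ℕ) : Module.Finite k (H ⧸ augFilt k H n) := by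
  obtain ⟨V, hV, hV₁, hV₂⟩ := exists_fg_cotangent (k := k) (H := H)
  have step : ∀ n, augFilt k H n ≤ V ^ n ⊔ augFilt k H (n + 1) := by
    intro n
    induction n with
    | zero =>
      intro x _
      refine Submodule.mem_sup.2 ⟨CoalgebraStruct.counit (R := k) x • (1 : H), ?_, _,
        sub_counit_mem (k := k) x, by abel⟩
      rw [pow_zero]
      exact Submodule.smul_mem _ _ (Submodule.one_le.1 le_rfl)
    | succ n ih =>
      refine augFilt_succ_induction fun x hx y hy => ?_
      obtain ⟨v, hv, x', hx', rfl⟩ := Submodule.mem_sup.1 (hV₂ hx)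
      obtain ⟨w, hw, y', hy', rfl⟩ := Submodule.mem_sup.1 (ih hy)
      refine Submodule.mem_sup.2 ⟨v * w, ?_, v * y' + x' * (w + y'), ?_, by noncomm_ring⟩
      · rw [pow_succ']
        exact Submodule.mul_mem_mul hv hw
      · refine Submodule.add_mem _ ?_ ?_
        · have := mul_mem_augFilt (hV₁ hv) hy'
          rwa [show 1 + (n + 1) = n + 1 + 1 by omega] at this
        · have := mul_mem_augFilt hx' hy
          rwa [show 2 + n = n + 1 + 1 by omega] at this
  have key : ∀ n, ∃ W : Submodule k H, W.FG ∧ ⊤ ≤ W ⊔ augFilt k H n := by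
    intro n
    induction n with
    | zero => exact ⟨⊥, Submodule.fg_bot, fun x _ => Submodule.mem_sup_right (mem_augFilt_zero x)⟩
    | succ n ih =>
      obtain ⟨W, hW, h⟩ := ih
      refine ⟨W ⊔ V ^ n, hW.sup (hV.pow n), h.trans (sup_le ?_ ?_)⟩
      · exact le_sup_left.trans le_sup_left
      · refine (step n).trans (sup_le_sup le_sup_right le_rfl)
  obtain ⟨W, hW, h⟩ := key n
  have : Module.Finite k W := Module.Finite.iff_fg.2 hW
  refine Module.Finite.of_surjective ((augFilt k H n).mkQ ∘ₗ W.subtype) fun q => ?_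
  obtain ⟨x, rfl⟩ := (augFilt k H n).mkQ_surjective q
  obtain ⟨w, hw, y, hy, rfl⟩ := Submodule.mem_sup.1 (h (Submodule.mem_top : x ∈ ⊤))
  refine ⟨⟨w, hw⟩, (Submodule.Quotient.eq _).2 ?_⟩
  rw [Submodule.subtype_apply, sub_add_cancel_left]
  exact Submodule.neg_mem _ hy

theorem exists_comul (α : HopfDual k H) :
    ∃ u : HopfDual k H ⊗[k] HopfDual k H, ∀ x y, ev₂ k H u (x, y) = ev k H α (x * y) := by
  obtain ⟨n, hn⟩ := α.2
  have := finite_quotient_augFilt (k := k) (H := H) (n + 1)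
  let b := Module.finBasis k (H ⧸ augFilt k H (n + 1))
  choose l hl using fun i => (augFilt k H (n + 1)).mkQ_surjective (b i)
  let c : ∀ i, HopfDual k H := fun i =>
    ⟨toConv (b.coord i ∘ₗ (augFilt k H (n + 1)).mkQ), n, fun h hh => by
      rw [LinearMap.comp_apply, Submodule.mkQ_apply, (Submodule.Quotient.mk_eq_zero _).2 hh,
        map_zero]⟩
  let β : ∀ i, HopfDual k H := fun i =>
    ⟨toConv (α.1.ofConv ∘ₗ (LinearMap.mul k H).flip (l i)), n, fun h hh =>
      hn _ (mul_mem_augFilt (m := n + 1) (n := 0) hh (mem_augFilt_zero (l i)))⟩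
  refine ⟨∑ i, β i ⊗ₜ c i, fun x y => ?_⟩
  have hy : y - ∑ i, ev k H (c i) y • l i ∈ augFilt k H (n + 1) := by
    refine (Submodule.Quotient.mk_eq_zero _).1 ?_
    rw [← Submodule.mkQ_apply, map_sub, map_sum, sub_eq_zero]
    refine (b.sum_repr _).symm.trans (Finset.sum_congr rfl fun i _ => ?_)
    rw [map_smul, hl]
    rfl
  have hxy := hn _ (mul_mem_augFilt (mem_augFilt_zero x) hy |> fun h => by rwa [zero_add] at h)
  rw [mul_sub, map_sub, sub_eq_zero, Finset.mul_sum, map_sum] at hxy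
  refine Eq.trans ?_ hxy.symm
  rw [map_sum, Finset.sum_apply]
  refine Finset.sum_congr rfl fun i _ => ?_
  rw [ev₂_tmul, mul_smul_comm, map_smul, smul_eq_mul, mul_comm]
  rfl

variable (k H)

/-- The coproduct of `H'`, determined by `Δ(α)(x ⊗ y) = α(x y)`. -/
def dualComul : HopfDual k H →ₗ[k] HopfDual k H ⊗[k] HopfDual k H where
  toFun α := (exists_comul α).choose
  map_add' α β := ev₂_injective (by
    ext ⟨x, y⟩
    refine ((exists_comul (α + β)).choose_spec x y).trans ?_
    rw [map_add (ev₂ k H), Pi.add_apply]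
    exact congrArg₂ (· + ·) ((exists_comul α).choose_spec x y).symm
      ((exists_comul β).choose_spec x y).symm)
  map_smul' c α := ev₂_injective (by
    ext ⟨x, y⟩
    refine ((exists_comul (c • α)).choose_spec x y).trans ?_
    rw [RingHom.id_apply, map_smul (ev₂ k H), Pi.smul_apply]
    exact congrArg (c • ·) ((exists_comul α).choose_spec x y).symm)

variable {k H}

theorem ev₂_dualComul (α : HopfDual k H) (x y : H) :
    ev₂ k H (dualComul k H α) (x, y) = ev k H α (x * y) :=
  (exists_comul α).choose_spec x y

theorem ev₃_lTensor (u : HopfDual k H ⊗[k] HopfDual k H) (x y z : H) :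
    ev₃ k H ((dualComul k H).lTensor _ u) (x, y, z) = ev₂ k H u (x, y * z) := by
  induction u with
  | zero => simp
  | add a b ha hb => simp only [map_add, Pi.add_apply, ha, hb]
  | tmul a b => rw [LinearMap.lTensor_tmul, ev₃_tmul, ev₂_dualComul, ev₂_tmul]

theorem ev₃_rTensor (u : HopfDual k H ⊗[k] HopfDual k H) (x y z : H) :
    ev₃ k H (TensorProduct.assoc k _ _ _ ((dualComul k H).rTensor _ u)) (x, y, z) =
      ev₂ k H u (x * y, z) := by
  induction u with
  | zero => simp
  | add a b ha hb => simp only [map_add, Pi.add_apply, ha, hb]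
  | tmul a b =>
    rw [LinearMap.rTensor_tmul, ev₂_tmul, ← ev₂_dualComul]
    generalize dualComul k H a = t
    induction t with
    | zero => simp
    | add c d hc hd =>
      rw [TensorProduct.add_tmul, map_add, map_add, Pi.add_apply, hc, hd, map_add, Pi.add_apply,
        add_mul]
    | tmul c d =>
      rw [TensorProduct.assoc_tmul, ev₃_tmul, ev₂_tmul, ev₂_tmul, mul_assoc]

variable (k H)

/-- The counit of `H'`: evaluation at `1`. -/
def dualCounit : HopfDual k H →ₗ[k] k := LinearMap.proj (1 : H) ∘ₗ ev k H

/-- The antipode of `H'`: the transpose of the antipode of `H`. -/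
def dualAntipode : HopfDual k H →ₗ[k] HopfDual k H where
  toFun α := ⟨toConv (α.1.ofConv ∘ₗ HopfAlgebra.antipode k), by
    obtain ⟨n, hn⟩ := α.2
    exact ⟨n, fun h hh => hn _ (antipode_mem_augFilt hh)⟩⟩
  map_add' _ _ := rfl
  map_smul' _ _ := rfl

variable {k H}

theorem ev_dualAntipode (α : HopfDual k H) (x : H) :
    ev k H (dualAntipode k H α) x = ev k H α (HopfAlgebra.antipode k x) := rfl

theorem dualCounit_apply (α : HopfDual k H) : dualCounit k H α = ev k H α 1 := rfl

instance : Coalgebra k (HopfDual k H) where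
  comul := dualComul k H
  counit := dualCounit k H
  coassoc := LinearMap.ext fun α => ev₃_injective (by
    ext ⟨x, y, z⟩
    simp only [LinearMap.comp_apply, LinearEquiv.coe_coe]
    rw [ev₃_rTensor, ev₃_lTensor, ev₂_dualComul, ev₂_dualComul, mul_assoc])
  rTensor_counit_comp_comul := LinearMap.ext fun α => by
    apply (TensorProduct.lid k (HopfDual k H)).injective
    apply ev_injective
    ext x
    rw [LinearMap.comp_apply, TensorProduct.mk_apply, TensorProduct.lid_tmul, one_smul]
    refine Eq.trans ?_ ((ev₂_dualComul α 1 x).trans (congrArg _ (one_mul x)))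
    change ev k H (TensorProduct.lid k _ ((dualCounit k H).rTensor _ (dualComul k H α))) x = _
    generalize dualComul k H α = t
    induction t with
    | zero => simp
    | add c d hc hd => simp only [map_add, Pi.add_apply, hc, hd]
    | tmul c d =>
      rw [LinearMap.rTensor_tmul, TensorProduct.lid_tmul, map_smul, ev₂_tmul, dualCounit_apply]
      rfl
  lTensor_counit_comp_comul := LinearMap.ext fun α => by
    apply (TensorProduct.rid k (HopfDual k H)).injective
    apply ev_injective
    ext x
    rw [LinearMap.comp_apply, LinearMap.flip_apply, TensorProduct.mk_apply, TensorProduct.rid_tmul,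
      one_smul]
    refine Eq.trans ?_ ((ev₂_dualComul α x 1).trans (congrArg _ (mul_one x)))
    change ev k H (TensorProduct.rid k _ ((dualCounit k H).lTensor _ (dualComul k H α))) x = _
    generalize dualComul k H α = t
    induction t with
    | zero => simp
    | add c d hc hd => simp only [map_add, Pi.add_apply, hc, hd]
    | tmul c d =>
      rw [LinearMap.lTensor_tmul, TensorProduct.rid_tmul, map_smul, ev₂_tmul, dualCounit_apply,
        mul_comm]
      rfl

theorem ev₂_mul (u v : HopfDual k H ⊗[k] HopfDual k H) {ι κ : Type*} {x y : H}
    (r : Coalgebra.Repr k x ι) (s : Coalgebra.Repr k y κ) :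
    ev₂ k H (u * v) (x, y) = ∑ i ∈ r.index, ∑ j ∈ s.index,
      ev₂ k H u (r.left i, s.left j) * ev₂ k H v (r.right i, s.right j) := by
  induction u with
  | zero => simp
  | add a b ha hb =>
    simp only [add_mul, map_add, Pi.add_apply, ha, hb, Finset.sum_add_distrib]
  | tmul a b =>
    induction v with
    | zero => simp
    | add c d hc hd =>
      simp only [mul_add, map_add, Pi.add_apply, hc, hd, Finset.sum_add_distrib]
    | tmul c d =>
      rw [Algebra.TensorProduct.tmul_mul_tmul, ev₂_tmul, ev_mul a c r, ev_mul b d s,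
        Finset.sum_mul_sum]
      refine Finset.sum_congr rfl fun i _ => Finset.sum_congr rfl fun j _ => ?_
      rw [ev₂_tmul, ev₂_tmul, mul_mul_mul_comm]

instance : Bialgebra k (HopfDual k H) where
  counit_one := (ev_one (1 : H)).trans Bialgebra.counit_one
  mul_compr₂_counit := by
    refine LinearMap.ext fun α => LinearMap.ext fun β => ?_
    change ev k H (α * β) 1 = ev k H α 1 * ev k H β 1
    let r : Coalgebra.Repr k (1 : H) Unit :=
      ⟨{()}, fun _ => 1, fun _ => 1, by
        rw [Finset.sum_singleton, Bialgebra.comul_one, Algebra.TensorProduct.one_def]⟩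
    rw [ev_mul α β r]
    exact Finset.sum_singleton _ _
  comul_one := ev₂_injective (by
    ext ⟨x, y⟩
    refine (ev₂_dualComul 1 x y).trans ?_
    rw [ev_one, Bialgebra.counit_mul, Algebra.TensorProduct.one_def, ev₂_tmul, ev_one, ev_one])
  mul_compr₂_comul := by
    refine LinearMap.ext fun α => LinearMap.ext fun β => ev₂_injective ?_
    ext ⟨x, y⟩
    change ev₂ k H (dualComul k H (α * β)) (x, y) =
      ev₂ k H (dualComul k H α * dualComul k H β) (x, y)
    let r := Coalgebra.Repr.arbitrary k x
    let s := Coalgebra.Repr.arbitrary k y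
    rw [ev₂_mul _ _ r s, ev₂_dualComul, ev_mul α β (r.mul s)]
    refine (Finset.sum_product _ _ _).trans
      (Finset.sum_congr rfl fun i _ => Finset.sum_congr rfl fun j _ => ?_)
    rw [ev₂_dualComul, ev₂_dualComul]
    rfl

theorem ev_mul_rTensor (u : HopfDual k H ⊗[k] HopfDual k H) {ι : Type*} {x : H}
    (r : Coalgebra.Repr k x ι) :
    ev k H (LinearMap.mul' k _ ((dualAntipode k H).rTensor _ u)) x =
      ∑ i ∈ r.index, ev₂ k H u (HopfAlgebra.antipode k (r.left i), r.right i) := by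
  induction u with
  | zero => simp
  | add a b ha hb => simp only [map_add, Pi.add_apply, ha, hb, Finset.sum_add_distrib]
  | tmul a b =>
    rw [LinearMap.rTensor_tmul, LinearMap.mul'_apply, ev_mul _ _ r]
    rfl

theorem ev_mul_lTensor (u : HopfDual k H ⊗[k] HopfDual k H) {ι : Type*} {x : H}
    (r : Coalgebra.Repr k x ι) :
    ev k H (LinearMap.mul' k _ ((dualAntipode k H).lTensor _ u)) x =
      ∑ i ∈ r.index, ev₂ k H u (r.left i, HopfAlgebra.antipode k (r.right i)) := by
  induction u with
  | zero => simp
  | add a b ha hb => simp only [map_add, Pi.add_apply, ha, hb, Finset.sum_add_distrib]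
  | tmul a b =>
    rw [LinearMap.lTensor_tmul, LinearMap.mul'_apply, ev_mul _ _ r]
    rfl

theorem ev_algebraMap (c : k) (x : H) :
    ev k H (algebraMap k (HopfDual k H) c) x = c * CoalgebraStruct.counit x := by
  rw [Algebra.algebraMap_eq_smul_one, map_smul, Pi.smul_apply, ev_one, smul_eq_mul]

/-- If `J / J^2` is finite dimensional, then `H'` is a Hopf algebra. -/
instance : HopfAlgebra k (HopfDual k H) where
  antipode := dualAntipode k H
  mul_antipode_rTensor_comul := LinearMap.ext fun α => ev_injective (by
    ext x
    change ev k H (LinearMap.mul' k _ ((dualAntipode k H).rTensor _ (dualComul k H α))) x =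
      ev k H (algebraMap k _ (ev k H α 1)) x
    let r := Coalgebra.Repr.arbitrary k x
    rw [ev_mul_rTensor _ r, ev_algebraMap, mul_comm, ← ev_map_smul,
      ← HopfAlgebra.sum_antipode_mul_eq_smul r]
    refine Eq.trans (Finset.sum_congr rfl fun i _ => ev₂_dualComul _ _ _) ?_
    exact (map_sum α.1.ofConv _ _).symm)
  mul_antipode_lTensor_comul := LinearMap.ext fun α => ev_injective (by
    ext x
    change ev k H (LinearMap.mul' k _ ((dualAntipode k H).lTensor _ (dualComul k H α))) x =
      ev k H (algebraMap k _ (ev k H α 1)) x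
    let r := Coalgebra.Repr.arbitrary k x
    rw [ev_mul_lTensor _ r, ev_algebraMap, mul_comm, ← ev_map_smul,
      ← HopfAlgebra.sum_mul_antipode_eq_smul r]
    refine Eq.trans (Finset.sum_congr rfl fun i _ => ev₂_dualComul _ _ _) ?_
    exact (map_sum α.1.ofConv _ _).symm)

end Finite

/-- If `H` is cocommutative, then `H'` is commutative. -/
theorem hopfDual_mul_comm [Coalgebra.IsCocomm k H] (α β : HopfDual k H) : α * β = β * α :=
  Subtype.ext (mul_comm α.1 β.1)

end Dual

/-! ### Group algebras -/

section Group

variable (k Γ : Type*) [Field k] [Group Γ]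

theorem single_sub_one_mem (g : Γ) :
    (MonoidAlgebra.single g 1 - 1 : MonoidAlgebra k Γ) ∈ augFilt k (MonoidAlgebra k Γ) 1 := by
  rw [mem_augFilt_one, map_sub, MonoidAlgebra.counit_single, Bialgebra.counit_one]
  simp

/-- For a finitely generated group, `J / J^2` is finite dimensional. -/
instance [Group.FG Γ] : FiniteCotangent k (MonoidAlgebra k Γ) where
  finite := by
    obtain ⟨S, hS, hfin⟩ := Group.fg_iff.1 (inferInstance : Group.FG Γ)
    set A := MonoidAlgebra k Γ
    let d : Γ → A := fun g => MonoidAlgebra.single g 1 - 1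
    let V : Submodule k A := Submodule.span k (d '' S)
    have hd : ∀ g, d g ∈ V ⊔ augFilt k A 2 := by
      intro g
      have hg : g ∈ Subgroup.closure S := by rw [hS]; trivial
      have hmul : ∀ x y : Γ, d (x * y) = d x + d y + d x * d y := by
        intro x y
        simp only [d]
        rw [show (MonoidAlgebra.single (x * y) 1 : A) =
          MonoidAlgebra.single x 1 * MonoidAlgebra.single y 1 by
            rw [MonoidAlgebra.single_mul_single, mul_one], sub_mul, mul_sub, mul_sub, mul_one,
          one_mul, mul_one]
        abel
      have hmem : ∀ x y : Γ, d x * d y ∈ V ⊔ augFilt k A 2 := fun x y =>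
        Submodule.mem_sup_right
          (mul_mem_augFilt (single_sub_one_mem k Γ x) (single_sub_one_mem k Γ y))
      induction hg using Subgroup.closure_induction with
      | mem x hx => exact Submodule.mem_sup_left (Submodule.subset_span ⟨x, hx, rfl⟩)
      | one =>
        rw [show d 1 = 0 from sub_self _]
        exact zero_mem _
      | mul x y _ _ hx hy =>
        rw [hmul]
        exact Submodule.add_mem _ (Submodule.add_mem _ hx hy) (hmem x y)
      | inv x _ hx =>
        have h := hmul x x⁻¹
        rw [mul_inv_cancel, show d 1 = 0 from sub_self _] at h
        rw [show d x⁻¹ = -(d x) - d x * d x⁻¹ by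
          rw [eq_sub_iff_add_eq, eq_neg_iff_add_eq_zero, h]; abel]
        exact Submodule.sub_mem _ (Submodule.neg_mem _ hx) (hmem x x⁻¹)
    have hJ : augFilt k A 1 ≤ V ⊔ augFilt k A 2 := by
      have h : ∀ x : A, x - CoalgebraStruct.counit (R := k) x • (1 : A) ∈ V ⊔ augFilt k A 2 := by
        intro x
        induction x using MonoidAlgebra.induction_linear with
        | zero => simp
        | add x y hx hy =>
          rw [map_add, add_smul, add_sub_add_comm]
          exact Submodule.add_mem _ hx hy
        | single g c =>
          rw [MonoidAlgebra.counit_single]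
          have : (MonoidAlgebra.single g c : A) - c • (1 : A) = c • d g := by
            simp only [d]
            rw [smul_sub, MonoidAlgebra.smul_single, smul_eq_mul, mul_one]
          exact this ▸ Submodule.smul_mem _ _ (hd g)
      intro x hx
      have := h x
      rwa [mem_augFilt_one.1 hx, zero_smul, sub_zero] at this
    have hV : V ≤ augFilt k A 1 := Submodule.span_le.2 (by
      rintro _ ⟨g, _, rfl⟩
      exact single_sub_one_mem k Γ g)
    have : Module.Finite k V := Module.Finite.iff_fg.2 (Submodule.fg_span (hfin.image d))
    refine Module.Finite.of_surjective
      (((augFilt k A 2).submoduleOf (augFilt k A 1)).mkQ ∘ₗ Submodule.inclusion hV) fun q => ?_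
    obtain ⟨⟨x, hx⟩, rfl⟩ := Submodule.mkQ_surjective _ q
    obtain ⟨v, hv, y, hy, rfl⟩ := Submodule.mem_sup.1 (hJ hx)
    refine ⟨⟨v, hv⟩, (Submodule.Quotient.eq _).2 ?_⟩
    change v - (v + y) ∈ augFilt k A 2
    rw [sub_add_cancel_left]
    exact Submodule.neg_mem _ hy

end Group

/-! ### Filtered Lie algebras and their completed associated graded Lie algebras -/

section Lie

/-- A decreasing Lie algebra filtration `L = F^1 ⊇ F^2 ⊇ ⋯` of a Lie algebra `L` (with the
convention `F^0 = L`, which is forced). -/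
structure LieFiltration (k L : Type*) [Field k] [LieRing L] [LieAlgebra k L] where
  /-- the terms of the filtration -/
  F : ℕ → Submodule k L
  anti : Antitone F
  one_eq_top : F 1 = ⊤
  lie_mem : ∀ {i j : ℕ} {x y : L}, x ∈ F i → y ∈ F j → ⁅x, y⁆ ∈ F (i + j)

theorem sum_triple_left {M : Type*} [AddCommMonoid M] (n : ℕ) (G : ℕ → ℕ → ℕ → M) :
    ∑ p ∈ Finset.HasAntidiagonal.antidiagonal n,
      ∑ q ∈ Finset.HasAntidiagonal.antidiagonal p.1, G q.1 q.2 p.2 =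
    ∑ p ∈ Finset.HasAntidiagonal.antidiagonal n,
      ∑ q ∈ Finset.HasAntidiagonal.antidiagonal p.2, G p.1 q.1 q.2 := by
  rw [Finset.sum_sigma', Finset.sum_sigma']
  refine Finset.sum_nbij' (fun s => ⟨(s.2.1, s.2.2 + s.1.2), (s.2.2, s.1.2)⟩)
    (fun s => ⟨(s.1.1 + s.2.1, s.2.2), (s.1.1, s.2.1)⟩) ?_ ?_ ?_ ?_ ?_
  all_goals
    rintro ⟨⟨a, b⟩, ⟨c, d⟩⟩ h
    simp only [Finset.mem_sigma, Finset.HasAntidiagonal.mem_antidiagonal] at h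
    obtain ⟨h, rfl⟩ := h
    try simp only [Finset.mem_sigma, Finset.HasAntidiagonal.mem_antidiagonal]
    first
    | done
    | rfl
    | exact ⟨by omega, trivial⟩

theorem sum_triple_swap {M : Type*} [AddCommMonoid M] (n : ℕ) (G : ℕ → ℕ → ℕ → M) :
    ∑ p ∈ Finset.HasAntidiagonal.antidiagonal n,
      ∑ q ∈ Finset.HasAntidiagonal.antidiagonal p.2, G q.1 p.1 q.2 =
    ∑ p ∈ Finset.HasAntidiagonal.antidiagonal n,
      ∑ q ∈ Finset.HasAntidiagonal.antidiagonal p.2, G p.1 q.1 q.2 := by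
  rw [Finset.sum_sigma', Finset.sum_sigma']
  refine Finset.sum_nbij' (fun s => ⟨(s.2.1, s.1.1 + s.2.2), (s.1.1, s.2.2)⟩)
    (fun s => ⟨(s.2.1, s.1.1 + s.2.2), (s.1.1, s.2.2)⟩) ?_ ?_ ?_ ?_ ?_
  all_goals
    rintro ⟨⟨a, b⟩, ⟨c, d⟩⟩ h
    simp only [Finset.mem_sigma, Finset.HasAntidiagonal.mem_antidiagonal] at h
    obtain ⟨h, rfl⟩ := h
    try simp only [Finset.mem_sigma, Finset.HasAntidiagonal.mem_antidiagonal]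
    first
    | done
    | rfl
    | exact ⟨by omega, trivial⟩

namespace LieFiltration

variable {k L : Type*} [Field k] [LieRing L] [LieAlgebra k L] (E : LieFiltration k L)

/-- The graded piece `gr^n L = F^n / F^{n+1}`; note that `gr^0 L = 0`. -/
def Piece (n : ℕ) : Type _ := E.F n ⧸ (E.F (n + 1)).submoduleOf (E.F n)

instance (n : ℕ) : AddCommGroup (E.Piece n) :=
  inferInstanceAs (AddCommGroup (E.F n ⧸ (E.F (n + 1)).submoduleOf (E.F n)))

instance (n : ℕ) : Module k (E.Piece n) :=
  inferInstanceAs (Module k (E.F n ⧸ (E.F (n + 1)).submoduleOf (E.F n)))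

/-- The projection `F^n → F^n / F^{n+1}`. -/
def toPiece (n : ℕ) : E.F n →ₗ[k] E.Piece n := ((E.F (n + 1)).submoduleOf (E.F n)).mkQ

theorem toPiece_surjective (n : ℕ) : Function.Surjective (E.toPiece n) :=
  Submodule.mkQ_surjective _

theorem toPiece_eq_zero {n : ℕ} {x : E.F n} : E.toPiece n x = 0 ↔ (x : L) ∈ E.F (n + 1) :=
  Submodule.Quotient.mk_eq_zero _

theorem piece_zero (x : E.Piece 0) : x = 0 := by
  obtain ⟨x, rfl⟩ := E.toPiece_surjective 0 x
  rw [toPiece_eq_zero, zero_add, E.one_eq_top]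
  trivial

theorem lie_mem' {i j n : ℕ} (h : i + j = n) {x y : L} (hx : x ∈ E.F i) (hy : y ∈ E.F j) :
    ⁅x, y⁆ ∈ E.F n := h ▸ E.lie_mem hx hy

/-- The bracket `F^i × F^j → gr^n L`, for `i + j = n`. -/
def lieAux {i j n : ℕ} (h : i + j = n) : E.F i →ₗ[k] E.F j →ₗ[k] E.Piece n :=
  LinearMap.mk₂ k (fun x y => E.toPiece n ⟨⁅(x : L), (y : L)⁆, E.lie_mem' h x.2 y.2⟩)
    (fun x x' y => by rw [← map_add]; congr 1; ext; simp)
    (fun c x y => by rw [← map_smul]; congr 1; ext; simp)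
    (fun x y y' => by rw [← map_add]; congr 1; ext; simp)
    (fun c x y => by rw [← map_smul]; congr 1; ext; simp)

/-- The bracket `gr^i L × gr^j L → gr^n L`, for `i + j = n`, induced by the bracket of `L`. -/
def pieceLie {i j n : ℕ} (h : i + j = n) : E.Piece i →ₗ[k] E.Piece j →ₗ[k] E.Piece n :=
  Submodule.liftQ _
    (LinearMap.flip (Submodule.liftQ ((E.F (j + 1)).submoduleOf (E.F j)) (E.lieAux h).flip (by
      intro y hy
      ext x
      exact E.toPiece_eq_zero.2 (E.lie_mem' (by omega) x.2 hy)))) (by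
      intro x hx
      refine LinearMap.ext fun y => ?_
      obtain ⟨y, rfl⟩ := E.toPiece_surjective j y
      exact E.toPiece_eq_zero.2 (E.lie_mem' (by omega) hx y.2))

theorem pieceLie_toPiece {i j n : ℕ} (h : i + j = n) (x : E.F i) (y : E.F j) :
    E.pieceLie h (E.toPiece i x) (E.toPiece j y) =
      E.toPiece n ⟨⁅(x : L), (y : L)⁆, E.lie_mem' h x.2 y.2⟩ := rfl

/-- The completed associated graded Lie algebra: the product of the graded pieces
`gr^n L`, `n ≥ 1` (the factor `n = 0` is zero). -/
def GrHat : Type _ := ∀ n, E.Piece n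

instance : AddCommGroup E.GrHat := inferInstanceAs (AddCommGroup (∀ n, E.Piece n))

instance : Module k E.GrHat := inferInstanceAs (Module k (∀ n, E.Piece n))

/-- The degree `n` component. -/
def component (n : ℕ) : E.GrHat →ₗ[k] E.Piece n := LinearMap.proj n

variable {E}

theorem grHat_ext {x y : E.GrHat} (h : ∀ n, E.component n x = E.component n y) : x = y :=
  funext h

/-- The bracket: its degree `n` component is `[x, y]_n = ∑_{i+j=n} [x_i, y_j]`. -/
instance : Bracket E.GrHat E.GrHat where
  bracket x y := fun n => ∑ p ∈ (Finset.HasAntidiagonal.antidiagonal n).attach,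
    E.pieceLie (Finset.HasAntidiagonal.mem_antidiagonal.1 p.2)
      (E.component p.1.1 x) (E.component p.1.2 y)

theorem component_lie (x y : E.GrHat) (n : ℕ) :
    E.component n ⁅x, y⁆ = ∑ p ∈ (Finset.HasAntidiagonal.antidiagonal n).attach,
      E.pieceLie (Finset.HasAntidiagonal.mem_antidiagonal.1 p.2)
        (E.component p.1.1 x) (E.component p.1.2 y) := rfl

/-- The element of the completed associated graded with components the classes of `f n ∈ F^n`. -/
def ofSeq (f : ∀ n, E.F n) : E.GrHat := fun n => E.toPiece n (f n)

theorem ofSeq_surjective (x : E.GrHat) : ∃ f : ∀ n, E.F n, ofSeq f = x := by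
  choose f hf using fun n => E.toPiece_surjective n (x n)
  exact ⟨f, funext hf⟩

/-- The Cauchy product of sequences, for the bracket. -/
def seqLie (f g : ∀ n, E.F n) (n : ℕ) : E.F n :=
  ⟨∑ p ∈ Finset.HasAntidiagonal.antidiagonal n, ⁅(f p.1 : L), (g p.2 : L)⁆,
    Submodule.sum_mem _ fun p hp =>
      E.lie_mem' (Finset.HasAntidiagonal.mem_antidiagonal.1 hp) (f p.1).2 (g p.2).2⟩

theorem ofSeq_lie (f g : ∀ n, E.F n) : ⁅ofSeq f, ofSeq g⁆ = ofSeq (seqLie f g) := by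
  refine grHat_ext fun n => ?_
  rw [component_lie]
  refine Eq.trans (Finset.sum_congr rfl fun p _ => E.pieceLie_toPiece
    (Finset.HasAntidiagonal.mem_antidiagonal.1 p.2) (f p.1.1) (g p.1.2)) ?_
  rw [← map_sum]
  refine congrArg (E.toPiece n) (Subtype.ext ?_)
  rw [Submodule.coe_sum]
  exact Finset.sum_attach (Finset.HasAntidiagonal.antidiagonal n)
    (fun p => ⁅(f p.1 : L), (g p.2 : L)⁆)

theorem ofSeq_congr {f g : ∀ n, E.F n} (h : ∀ n, (f n : L) = g n) : ofSeq f = ofSeq g :=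
  congrArg ofSeq (funext fun n => Subtype.ext (h n))

instance : LieRing E.GrHat where
  add_lie x y z := grHat_ext fun n => by
    simp only [component_lie, map_add, LinearMap.add_apply, Finset.sum_add_distrib]
  lie_add x y z := grHat_ext fun n => by
    simp only [component_lie, map_add, Finset.sum_add_distrib]
  lie_self x := by
    obtain ⟨f, rfl⟩ := ofSeq_surjective x
    rw [ofSeq_lie]
    refine grHat_ext fun n => E.toPiece_eq_zero.2 ?_
    have : (∑ p ∈ Finset.HasAntidiagonal.antidiagonal n, ⁅(f p.1 : L), (f p.2 : L)⁆) = 0 := by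
      refine Finset.sum_involution (fun p _ => p.swap) ?_ ?_ ?_ ?_
      · intro p _
        rw [Prod.fst_swap, Prod.snd_swap, ← lie_skew (f p.1 : L), neg_add_cancel]
      · rintro ⟨a, b⟩ _ hne h
        obtain rfl : b = a := congrArg Prod.fst h
        exact hne (lie_self _)
      · intro p hp
        rw [Finset.HasAntidiagonal.mem_antidiagonal] at hp ⊢
        rw [Prod.fst_swap, Prod.snd_swap, add_comm, hp]
      · intro p _
        rfl
    change (∑ p ∈ Finset.HasAntidiagonal.antidiagonal n, ⁅(f p.1 : L), (f p.2 : L)⁆) ∈ _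
    rw [this]
    exact zero_mem _
  leibniz_lie x y z := by
    obtain ⟨f, rfl⟩ := ofSeq_surjective x
    obtain ⟨g, rfl⟩ := ofSeq_surjective y
    obtain ⟨h, rfl⟩ := ofSeq_surjective z
    rw [ofSeq_lie g h, ofSeq_lie f, ofSeq_lie f g, ofSeq_lie _ h, ofSeq_lie f h, ofSeq_lie g]
    refine Eq.trans (ofSeq_congr (g := fun n => seqLie (seqLie f g) h n + seqLie g (seqLie f h) n)
      fun n => ?_) (funext fun n => map_add (E.toPiece n) _ _)
    simp only [seqLie, Submodule.coe_add, lie_sum, sum_lie]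
    rw [sum_triple_left n fun a b c => ⁅⁅(f a : L), (g b : L)⁆, (h c : L)⁆,
      sum_triple_swap n fun a b c => ⁅(g b : L), ⁅(f a : L), (h c : L)⁆⁆,
      ← Finset.sum_add_distrib]
    refine Finset.sum_congr rfl fun p _ => ?_
    rw [← Finset.sum_add_distrib]
    exact Finset.sum_congr rfl fun q _ => leibniz_lie _ _ _

instance : LieAlgebra k E.GrHat where
  lie_smul c x y := grHat_ext fun n => by
    simp only [component_lie, map_smul, Finset.smul_sum]

variable (E)

/-- The filtration of the completed associated graded by `F^n = ∏_{i ≥ n} gr^i L`. -/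
def grHatFilt (n : ℕ) : Submodule k E.GrHat :=
  ⨅ i : {i : ℕ // i < n}, LinearMap.ker (E.component i)

end LieFiltration

end Lie

/-! ### The Lie algebra of primitive elements of the completed Hopf algebra -/

section Primitive

variable (k H : Type*) [Field k] [Ring H] [HopfAlgebra k H]

/-- The projection `H / J^n → H / J^m`, for `m ≤ n`. -/
def transMap {m n : ℕ} (h : m ≤ n) : H ⧸ augIdeal k H ^ n →ₐ[k] H ⧸ augIdeal k H ^ m :=
  Ideal.Quotient.factorₐ k (Ideal.pow_le_pow_right h)

/-- The completion `lim_n H / J^n`, as an algebra of compatible families. -/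
def completion : Subalgebra k (∀ n : ℕ, H ⧸ augIdeal k H ^ n) where
  carrier := {a | ∀ (m n : ℕ) (h : m ≤ n), transMap k H h (a n) = a m}
  mul_mem' := fun {a b} ha hb m n h => by
    rw [Pi.mul_apply, map_mul, ha m n h, hb m n h, Pi.mul_apply]
  add_mem' := fun {a b} ha hb m n h => by
    rw [Pi.add_apply, map_add, ha m n h, hb m n h, Pi.add_apply]
  algebraMap_mem' := fun c m n h => by
    rw [Pi.algebraMap_apply, AlgHom.commutes, Pi.algebraMap_apply]

/-- The type of elements of the completion of `H`. -/
def Completion : Type _ := completion k H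

instance : Ring (Completion k H) := inferInstanceAs (Ring (completion k H))

instance : Algebra k (Completion k H) := inferInstanceAs (Algebra k (completion k H))

instance : LieRing (Completion k H) := LieRing.ofAssociativeRing

instance : LieAlgebra k (Completion k H) := LieAlgebra.ofAssociativeAlgebra

/-- The completed tensor square `lim_n (H / J^n) ⊗ (H / J^n)`, as an algebra of compatible
families. -/
def completedSquare :
    Subalgebra k (∀ n : ℕ, (H ⧸ augIdeal k H ^ n) ⊗[k] (H ⧸ augIdeal k H ^ n)) where
  carrier := {u | ∀ (m n : ℕ) (h : m ≤ n),
    Algebra.TensorProduct.map (transMap k H h) (transMap k H h) (u n) = u m}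
  mul_mem' := fun {a b} ha hb m n h => by
    rw [Pi.mul_apply, map_mul, ha m n h, hb m n h, Pi.mul_apply]
  add_mem' := fun {a b} ha hb m n h => by
    rw [Pi.add_apply, map_add, ha m n h, hb m n h, Pi.add_apply]
  algebraMap_mem' := fun c m n h => by
    rw [Pi.algebraMap_apply, AlgHom.commutes, Pi.algebraMap_apply]

/-- The type of elements of the completed tensor square of `H`. -/
def CompletedSquare : Type _ := completedSquare k H

instance : Ring (CompletedSquare k H) := inferInstanceAs (Ring (completedSquare k H))

instance : Algebra k (CompletedSquare k H) := inferInstanceAs (Algebra k (completedSquare k H))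

/-- The map `H → (H / J^n) ⊗ (H / J^n)` given by the coproduct. -/
def comulMod (n : ℕ) : H →ₐ[k] (H ⧸ augIdeal k H ^ n) ⊗[k] (H ⧸ augIdeal k H ^ n) :=
  (Algebra.TensorProduct.map (Ideal.Quotient.mkₐ k (augIdeal k H ^ n))
    (Ideal.Quotient.mkₐ k (augIdeal k H ^ n))).comp (Bialgebra.comulAlgHom k H)

theorem comulMod_eq_zero {n : ℕ} (x : H) (hx : x ∈ augIdeal k H ^ (n + n)) :
    comulMod k H n x = 0 := by
  refine eqOn_tensorFilt (F := augFilt k H)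
    (f := (Algebra.TensorProduct.map (Ideal.Quotient.mkₐ k (augIdeal k H ^ n))
      (Ideal.Quotient.mkₐ k (augIdeal k H ^ n))).toLinearMap) (g := 0) ?_ (comul_mem_augFilt hx)
  intro p q hpq x hx y hy
  rw [AlgHom.toLinearMap_apply, Algebra.TensorProduct.map_tmul, LinearMap.zero_apply]
  by_cases hp : n ≤ p
  · rw [Ideal.Quotient.mkₐ_eq_mk, Ideal.Quotient.eq_zero_iff_mem.2 (augFilt_anti hp hx),
      TensorProduct.zero_tmul]
  · rw [Ideal.Quotient.mkₐ_eq_mk,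
      Ideal.Quotient.eq_zero_iff_mem.2 (augFilt_anti (show n ≤ q by omega) hy),
      TensorProduct.tmul_zero]

/-- The map `H / J^{2n} → (H / J^n) ⊗ (H / J^n)` induced by the coproduct. -/
def comulQuot (n : ℕ) :
    H ⧸ augIdeal k H ^ (n + n) →ₐ[k] (H ⧸ augIdeal k H ^ n) ⊗[k] (H ⧸ augIdeal k H ^ n) :=
  Ideal.Quotient.liftₐ _ (comulMod k H n) (comulMod_eq_zero k H)

theorem comulQuot_mk (n : ℕ) (x : H) :
    comulQuot k H n (Ideal.Quotient.mk _ x) = comulMod k H n x := rfl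

theorem map_transMap_comulMod {m n : ℕ} (h : m ≤ n) (x : H) :
    Algebra.TensorProduct.map (transMap k H h) (transMap k H h) (comulMod k H n x) =
      comulMod k H m x := by
  change Algebra.TensorProduct.map (transMap k H h) (transMap k H h)
    (Algebra.TensorProduct.map _ _ (CoalgebraStruct.comul x)) =
      Algebra.TensorProduct.map _ _ (CoalgebraStruct.comul x)
  generalize (CoalgebraStruct.comul x : H ⊗[k] H) = u
  induction u with
  | zero => simp only [map_zero]
  | add a b ha hb => simp only [map_add, ha, hb]
  | tmul a b => rfl

/-- The coproduct `Δ : lim_n H / J^n → lim_n (H / J^n) ⊗ (H / J^n)` of the completion. -/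
def comulHat : Completion k H →ₐ[k] CompletedSquare k H :=
  AlgHom.codRestrict
    (AlgHom.pi fun n => ((comulQuot k H n).comp (Pi.evalAlgHom k _ (n + n))).comp
      (completion k H).val) (completedSquare k H) (by
    intro a m n h
    change Algebra.TensorProduct.map (transMap k H h) (transMap k H h) (comulQuot k H n (a.1 (n + n))) =
      comulQuot k H m (a.1 (m + m))
    rw [← a.2 (m + m) (n + n) (by omega)]
    obtain ⟨x, hx⟩ := Ideal.Quotient.mk_surjective (a.1 (n + n))
    rw [← hx]
    exact map_transMap_comulMod k H h x)

/-- The map `a ↦ a ⊗ 1` from the completion of `H` to the completed tensor square. -/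
def inclLeft : Completion k H →ₐ[k] CompletedSquare k H :=
  AlgHom.codRestrict
    (AlgHom.pi fun n => ((Algebra.TensorProduct.includeLeft (R := k) (S := k)).comp
      (Pi.evalAlgHom k _ n)).comp (completion k H).val) (completedSquare k H) (by
    intro a m n h
    refine (Algebra.TensorProduct.map_tmul _ _ _ _).trans ?_
    rw [map_one]
    exact congrArg (· ⊗ₜ[k] 1) (a.2 m n h))

/-- The map `a ↦ 1 ⊗ a` from the completion of `H` to the completed tensor square. -/
def inclRight : Completion k H →ₐ[k] CompletedSquare k H :=
  AlgHom.codRestrict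
    (AlgHom.pi fun n => ((Algebra.TensorProduct.includeRight (R := k)).comp
      (Pi.evalAlgHom k _ n)).comp (completion k H).val) (completedSquare k H) (by
    intro a m n h
    refine (Algebra.TensorProduct.map_tmul _ _ _ _).trans ?_
    rw [map_one]
    exact congrArg (1 ⊗ₜ[k] ·) (a.2 m n h))

theorem inclLeft_mul_inclRight (a b : Completion k H) :
    inclLeft k H a * inclRight k H b = inclRight k H b * inclLeft k H a := by
  refine Subtype.ext (funext fun n => ?_)
  change (a.1 n ⊗ₜ[k] 1) * (1 ⊗ₜ[k] b.1 n) = (1 ⊗ₜ[k] b.1 n) * (a.1 n ⊗ₜ[k] 1)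
  rw [Algebra.TensorProduct.tmul_mul_tmul, Algebra.TensorProduct.tmul_mul_tmul, one_mul, mul_one,
    one_mul, mul_one]

/-- The Lie algebra of primitive elements of the completion of `H`, i.e. of the elements `a` with
`Δ a = a ⊗ 1 + 1 ⊗ a`, with bracket the commutator. -/
def primitives : LieSubalgebra k (Completion k H) where
  carrier := {a | comulHat k H a = inclLeft k H a + inclRight k H a}
  zero_mem' := by simp
  add_mem' := fun {a b} ha hb => by
    change comulHat k H a = inclLeft k H a + inclRight k H a at ha
    change comulHat k H b = inclLeft k H b + inclRight k H b at hb
    change comulHat k H (a + b) = inclLeft k H (a + b) + inclRight k H (a + b)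
    rw [map_add, map_add, map_add, ha, hb]
    abel
  smul_mem' := fun c a ha => by
    change comulHat k H a = inclLeft k H a + inclRight k H a at ha
    change comulHat k H (c • a) = inclLeft k H (c • a) + inclRight k H (c • a)
    rw [map_smul, map_smul, map_smul, ha, smul_add]
  lie_mem' := fun {a b} ha hb => by
    have ha' : comulHat k H a = inclLeft k H a + inclRight k H a := ha
    have hb' : comulHat k H b = inclLeft k H b + inclRight k H b := hb
    change comulHat k H (a * b - b * a) = inclLeft k H (a * b - b * a) +
      inclRight k H (a * b - b * a)
    simp only [map_sub, map_mul, ha', hb', add_mul, mul_add]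
    rw [inclLeft_mul_inclRight k H a b, inclLeft_mul_inclRight k H b a]
    abel

/-- The filtration of the completion by `F^n = ker (lim_m H / J^m → H / J^n)`. -/
def completionFilt (n : ℕ) : Submodule k (Completion k H) :=
  LinearMap.ker ((Pi.evalAlgHom k (fun n : ℕ => H ⧸ augIdeal k H ^ n) n).comp
    (completion k H).val).toLinearMap

variable {k H}

theorem mem_completionFilt {n : ℕ} {a : Completion k H} :
    a ∈ completionFilt k H n ↔ a.1 n = 0 := Iff.rfl

theorem completionFilt_anti : Antitone (completionFilt k H) := fun m n h a ha => by
  rw [mem_completionFilt] at ha ⊢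
  rw [← a.2 m n h, ha, map_zero]

theorem mul_mem_completionFilt {i j : ℕ} {a b : Completion k H} (ha : a ∈ completionFilt k H i)
    (hb : b ∈ completionFilt k H j) : a * b ∈ completionFilt k H (i + j) := by
  rw [mem_completionFilt] at ha hb ⊢
  change a.1 (i + j) * b.1 (i + j) = 0
  obtain ⟨x, hx⟩ := Ideal.Quotient.mk_surjective (a.1 (i + j))
  obtain ⟨y, hy⟩ := Ideal.Quotient.mk_surjective (b.1 (i + j))
  rw [← a.2 i (i + j) (by omega), ← hx] at ha
  rw [← b.2 j (i + j) (by omega), ← hy] at hb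
  rw [← hx, ← hy, ← map_mul, Ideal.Quotient.eq_zero_iff_mem]
  exact mul_mem_augFilt (k := k) (Ideal.Quotient.eq_zero_iff_mem.1 ha)
    (Ideal.Quotient.eq_zero_iff_mem.1 hb)

theorem counit_eq_zero_of_comulMod_one {x : H} {q : H ⧸ augIdeal k H ^ 1}
    (hq : Ideal.Quotient.mk _ x = q) (h : comulMod k H 1 x = q ⊗ₜ[k] 1 + 1 ⊗ₜ[k] q) :
    CoalgebraStruct.counit (R := k) x = 0 := by
  let ε : H ⧸ augIdeal k H ^ 1 →ₐ[k] k := Ideal.Quotient.liftₐ _ (Bialgebra.counitAlgHom k H)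
    fun y hy => mem_augFilt_one.1 hy
  have hε : ε q = CoalgebraStruct.counit (R := k) x := by rw [← hq]; rfl
  have e : ∀ u : H ⊗[k] H, LinearMap.mul' k k (TensorProduct.map ε.toLinearMap ε.toLinearMap
      (Algebra.TensorProduct.map (Ideal.Quotient.mkₐ k (augIdeal k H ^ 1))
        (Ideal.Quotient.mkₐ k (augIdeal k H ^ 1)) u)) =
      CoalgebraStruct.counit (R := k) (TensorProduct.lid k H
        ((CoalgebraStruct.counit (R := k)).rTensor H u)) := by
    intro u
    induction u with
    | zero => simp only [map_zero]
    | add a b ha hb => simp only [map_add, ha, hb]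
    | tmul a b =>
      rw [LinearMap.rTensor_tmul, TensorProduct.lid_tmul, map_smul]
      rfl
  have e' := e (CoalgebraStruct.comul x)
  rw [Coalgebra.rTensor_counit_comul, TensorProduct.lid_tmul, one_smul] at e'
  have h' := congrArg (fun v => LinearMap.mul' k k
    (TensorProduct.map ε.toLinearMap ε.toLinearMap v)) h
  simp only [map_add, TensorProduct.map_tmul, LinearMap.mul'_apply, AlgHom.toLinearMap_apply,
    map_one, mul_one, one_mul, hε] at h'
  exact left_eq_add.1 (e'.symm.trans h')

theorem mem_primitives {a : Completion k H} (ha : a ∈ primitives k H) (n : ℕ) :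
    comulQuot k H n (a.1 (n + n)) = a.1 n ⊗ₜ[k] 1 + 1 ⊗ₜ[k] a.1 n :=
  congrFun (congrArg Subtype.val (ha : comulHat k H a = _)) n

theorem primitive_mem_completionFilt_one {a : Completion k H} (ha : a ∈ primitives k H) :
    a ∈ completionFilt k H 1 := by
  rw [mem_completionFilt]
  obtain ⟨x, hx⟩ := Ideal.Quotient.mk_surjective (a.1 (1 + 1))
  have h₁ : Ideal.Quotient.mk _ x = a.1 1 := by
    rw [← a.2 1 (1 + 1) (by omega), ← hx]
    rfl
  have h := mem_primitives ha 1
  rw [← hx, comulQuot_mk] at h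
  rw [← h₁, Ideal.Quotient.eq_zero_iff_mem]
  exact (mem_augFilt_one (k := k)).2 (counit_eq_zero_of_comulMod_one h₁ h)

variable (k H)

/-- The filtration of the Lie algebra of primitive elements induced by that of the completion. -/
def primitiveFilt : LieFiltration k (primitives k H) where
  F n := (completionFilt k H n).comap (primitives k H).toSubmodule.subtype
  anti := fun _ _ h _ ha => completionFilt_anti h ha
  one_eq_top := eq_top_iff.2 fun a _ => primitive_mem_completionFilt_one a.2
  lie_mem := fun {i j x y} hx hy => by
    change (x : Completion k H) * y - y * x ∈ completionFilt k H (i + j)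
    refine Submodule.sub_mem _ (mul_mem_completionFilt hx hy) ?_
    rw [add_comm]
    exact mul_mem_completionFilt hy hx

end Primitive

/-! ### Filtered formality of groups -/

/-- The Malcev Lie algebra of a group `Γ`: the primitive elements of the completed group algebra. -/
abbrev MalcevLie (k Γ : Type*) [Field k] [Group Γ] : Type _ := primitives k (MonoidAlgebra k Γ)

/-- The filtration of the Malcev Lie algebra of `Γ`. -/
def malcevFilt (k Γ : Type*) [Field k] [Group Γ] : LieFiltration k (MalcevLie k Γ) :=
  primitiveFilt k (MonoidAlgebra k Γ)

/-- A group `Γ` is filtered formal if there is an isomorphism of filtered Lie algebras `Φ` from its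
Malcev Lie algebra to the completed associated graded of the latter, whose associated graded is the
identity: for all `n` and `x ∈ F^n`, the degree `n` component of `Φ x` is the class of `x` in
`gr^n`. -/
def IsFilteredFormalGroup (k Γ : Type*) [Field k] [Group Γ] : Prop :=
  ∃ Φ : MalcevLie k Γ ≃ₗ⁅k⁆ (malcevFilt k Γ).GrHat,
    (∀ (n : ℕ) (x : MalcevLie k Γ), x ∈ (malcevFilt k Γ).F n ↔ Φ x ∈ (malcevFilt k Γ).grHatFilt n) ∧
    ∀ (n : ℕ) (x : (malcevFilt k Γ).F n),
      (malcevFilt k Γ).component n (Φ x) = (malcevFilt k Γ).toPiece n x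

end FilteredFormality

end

open scoped TensorProduct DirectSum

noncomputable section

namespace FilteredFormality

/-! ### Exponentials of nilpotent elements -/

section NilpotentExp

open Polynomial

variable {A : Type*} [Ring A] [Algebra ℚ A]

/-! Filtered formality is detected by a single endomorphism. The completed associated graded of the
Malcev Lie algebra has the automorphism multiplying degree $n$ by $2^n$. A filtered isomorphism
transports it to a filtered Lie endomorphism $\varphi$ of $\mathrm{Lie}(\Gamma)$ that is
multiplication by $2$ modulo $F^2$ (`LieFiltration.exists_scaling`).

Each $g\in\Gamma$ is group-like in $(k\Gamma)^\wedge$, hence $g=\exp(\log g)$ with $\log g$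
primitive. The map $g\mapsto\exp(\varphi(\log g))$ is multiplicative (`expPrim_map_mul`) and extends
to an algebra map $\theta:k\Gamma\to(k\Gamma)^\wedge$, which acts by $2^n$ on $J^n/J^{n+1}$
(`expEndo_sub_mem`). Its transpose $\psi$ is a bialgebra endomorphism of $(k\Gamma)'$. Since
$F_n^\heartsuit(k\Gamma)'=(J^{n+1})^\perp$ (`heartF_eq_ker`), $\psi$ acts by $2^n$ on
$F_n^\heartsuit/F_{n-1}^\heartsuit$. The powers of $2$ are distinct in characteristic zero, so every
class in $F_n^\heartsuit/F_{n-1}^\heartsuit$ has exactly one representative in the $2^n$-eigenspace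
of $\psi$. Choosing it defines $\mathrm{gr}^\heartsuit\to(k\Gamma)'$. This map respects products and
coproducts because $\psi$ does and eigenvector representatives are unique; its inverse is the
required isomorphism (`HopfFiltration.exists_bialgEquiv_gr`).

Multiplicativity of $\exp\circ\varphi\circ\log$ is proved without the Baker–Campbell–Hausdorff
formula. Modulo $J^n$, the graph of $\varphi$ is a Lie subalgebra $M$ of $(H/J^n)^2$, and the span
of all powers of elements of $M$ is closed under multiplication, a form of Poincaré–Birkhoff–Witt
(`mul_mem_iSup_powSpan`). An $m$-th power of a primitive element has eigenvalue $2^m$ for the Adams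
operator (product after coproduct), so a pair of primitive elements lying in that span already lies
in $M$. This is applied to the pair formed by the logarithm of $\exp x\exp y$ and that of
$\exp\varphi(x)\exp\varphi(y)$. -/

theorem exists_exp_eq_aeval {a : A} (ha : IsNilpotent a) :
    ∃ q : ℚ[X], IsNilpotent.exp a = aeval a (1 + X + X ^ 2 * q) := by
  obtain ⟨n, hn⟩ := ha
  refine ⟨∑ i ∈ Finset.range n, C ((i + 2).factorial : ℚ)⁻¹ * X ^ i, ?_⟩
  -- The series is cut at $n+2$, not $n$, so that the terms of degree $0$ and $1$ can be split off
  -- whatever $n$ is.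
  rw [IsNilpotent.exp_eq_sum (k := n + 2) (by rw [pow_add, hn, zero_mul]),
    Finset.sum_range_succ', Finset.sum_range_succ', Finset.mul_sum]
  simp only [map_add, map_one, aeval_X, map_sum, map_mul, map_pow, aeval_C]
  rw [add_comm, ← add_assoc, add_right_comm, add_comm (1 : A)]
  simp only [zero_add, Nat.factorial_one, Nat.cast_one, inv_one, pow_one, one_smul,
    Nat.factorial_zero, pow_zero, add_assoc]
  rw [add_comm (1 : A), add_assoc, add_comm _ (1 : A)]
  refine congrArg (a + ·) (congrArg (1 + ·) (Finset.sum_congr rfl fun i _ => ?_))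
  rw [Algebra.smul_def, ← mul_assoc, ← Algebra.commutes, mul_assoc, ← pow_add, add_comm 2 i]

/-- The equation reads $a(1+a\,q(a))=0$, and the second factor is a unit because $a\,q(a)$ is
nilpotent. -/
theorem eq_zero_of_exp_eq_one {a : A} (ha : IsNilpotent a) (h : IsNilpotent.exp a = 1) :
    a = 0 := by
  obtain ⟨q, hq⟩ := exists_exp_eq_aeval ha
  rw [h] at hq
  have hc : Commute a (aeval a q) := by
    simpa using Commute.map (Commute.all X q) (aeval a)
  have hu : IsUnit (1 + a * aeval a q) := (hc.isNilpotent_mul_right ha).isUnit_one_add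
  refine (hu.mul_left_eq_zero).1 ?_
  simp only [map_add, map_mul, map_one, map_pow, aeval_X] at hq
  rw [add_assoc, left_eq_add] at hq
  rw [mul_add, mul_one, ← mul_assoc, ← pow_two, hq]

theorem exp_injective_of_commute {a b : A} (hab : Commute a b) (ha : IsNilpotent a)
    (hb : IsNilpotent b) (h : IsNilpotent.exp a = IsNilpotent.exp b) : a = b := by
  refine sub_eq_zero.1 (eq_zero_of_exp_eq_one (hab.isNilpotent_sub ha hb) ?_)
  rw [sub_eq_add_neg, IsNilpotent.exp_add_of_commute hab.neg_right ha hb.neg, h,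
    IsNilpotent.exp_mul_exp_neg_self hb]

theorem isNilpotent_aeval_mul {a : A} (ha : IsNilpotent a) (p : ℚ[X]) :
    IsNilpotent (aeval a (X * p)) := by
  rw [map_mul, aeval_X]
  refine Commute.isNilpotent_mul_right ?_ ha
  simpa using Commute.map (Commute.all X p) (aeval a)

/-- Successive approximation of the logarithm: multiplying by $\exp(-a^{m+1}r(a))$ removes the
leading error term and leaves one of order at least $m+2$. -/
theorem exists_exp_aeval_eq {a : A} (ha : IsNilpotent a) (m : ℕ) :
    ∃ p r : ℚ[X], IsNilpotent.exp (aeval a (X * p)) = aeval a (1 + X + X ^ (m + 1) * r) := by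
  induction m with
  | zero => exact ⟨0, -1, by simp⟩
  | succ m ih =>
    obtain ⟨p, r, h⟩ := ih
    have hw : X ^ (m + 1) * r = X * (X ^ m * r) := by ring
    obtain ⟨q, hq⟩ := exists_exp_eq_aeval (isNilpotent_aeval_mul ha (-(X ^ m * r)))
    -- With $w=X^{m+1}r$ and $\exp(-w)=1-w+w^2q(-w)$, the product $(1+X+w)\exp(-w)$ equals
    -- $1+X-Xw+w^2(-1+(1+X+w)q(-w))$; the new remainder is what follows $1+X$, divided by $X^{m+2}$.
    refine ⟨p - X ^ m * r, -r + X ^ m * r ^ 2 *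
      (-1 + (1 + X + X ^ (m + 1) * r) * q.comp (X * -(X ^ m * r))), ?_⟩
    rw [sub_eq_add_neg p, mul_add, map_add, IsNilpotent.exp_add_of_commute
      ((Commute.all (X * p) (X * -(X ^ m * r))).map (aeval a : ℚ[X] →ₐ[ℚ] A))
      (isNilpotent_aeval_mul ha _)
      (isNilpotent_aeval_mul ha _), h, hq, ← aeval_comp, ← map_mul]
    congr 1
    simp only [add_comp, mul_comp, one_comp, X_comp, pow_comp]
    ring

/-- A unipotent element is the exponential of a polynomial in its nilpotent part. -/
theorem exists_log {a : A} (ha : IsNilpotent a) :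
    ∃ p : ℚ[X], IsNilpotent.exp (aeval a (X * p)) = 1 + a := by
  obtain ⟨n, hn⟩ := id ha
  obtain ⟨p, r, h⟩ := exists_exp_aeval_eq ha n
  exact ⟨p, by rw [h]; simp [pow_succ, hn]⟩

theorem commute_exp {a : A} (ha : IsNilpotent a) : Commute a (IsNilpotent.exp a) := by
  obtain ⟨q, hq⟩ := exists_exp_eq_aeval ha
  rw [hq]
  have := (Commute.all X (1 + X + X ^ 2 * q)).map (aeval a : ℚ[X] →ₐ[ℚ] A)
  rwa [aeval_X] at this

/-- One polynomial serves every nilpotent logarithm of $u$: such an $a$ commutes with $u=\exp a$,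
hence with any polynomial in $u-1$, and the commuting case of injectivity applies. This yields
uniqueness of logarithms without a commutation hypothesis and places the logarithm in any algebra
containing $u$. -/
theorem exists_eq_aeval_exp {u : A} (hu : IsNilpotent (u - 1)) :
    ∃ p : ℚ[X], ∀ a, IsNilpotent a → IsNilpotent.exp a = u → a = aeval (u - 1) (X * p) := by
  obtain ⟨p, hp⟩ := exists_log hu
  refine ⟨p, fun a ha h => exp_injective_of_commute ?_ ha (isNilpotent_aeval_mul hu p) ?_⟩
  · have hc : Commute a (u - 1) := (h ▸ commute_exp ha).sub_right (Commute.one_right a)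
    induction X * p using Polynomial.induction_on' with
    | add p q hp hq => rw [map_add]; exact hp.add_right hq
    | monomial n c =>
      rw [aeval_monomial]
      exact (show Commute a _ from (Algebra.commutes c a).symm).mul_right (hc.pow_right n)
  · rw [h, hp, add_sub_cancel]

theorem exp_injective {a b : A} (ha : IsNilpotent a) (hb : IsNilpotent b)
    (h : IsNilpotent.exp a = IsNilpotent.exp b) : a = b := by
  obtain ⟨p, hp⟩ := exists_eq_aeval_exp (IsNilpotent.isNilpotent_exp_sub_one hb)
  rw [hp a ha h, ← hp b hb rfl]

end NilpotentExp

/-! ### Spans of powers -/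

section PowerSpan

variable {k : Type*} [Field k]

/-- After applying a linear form on $V/W$, one has a polynomial over an infinite field that vanishes
at every point, so its coefficients are zero; linear forms separate the points of $V/W$. -/
theorem coeff_mem_of_forall_sum_mem [Infinite k] {V : Type*} [AddCommGroup V] [Module k V]
    (W : Submodule k V) {n : ℕ} {a : ℕ → V}
    (h : ∀ t : k, ∑ i ∈ Finset.range n, t ^ i • a i ∈ W) {i : ℕ} (hi : i < n) : a i ∈ W := by
  rw [← Submodule.Quotient.mk_eq_zero, ← Module.forall_dual_apply_eq_zero_iff k]
  intro f
  let p : Polynomial k := ∑ i ∈ Finset.range n, Polynomial.monomial i (f (W.mkQ (a i)))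
  have hp : p = 0 := by
    refine Polynomial.funext fun t => ?_
    have := congrArg f ((Submodule.Quotient.mk_eq_zero W).2 (h t))
    rw [← Submodule.mkQ_apply, map_sum, map_sum, map_zero] at this
    rw [Polynomial.eval_finsetSum, Polynomial.eval_zero, ← this]
    refine Finset.sum_congr rfl fun j _ => ?_
    rw [Polynomial.eval_monomial, map_smul, map_smul, smul_eq_mul, mul_comm]
  have := congrArg (fun q => Polynomial.coeff q i) hp
  simpa [p, Polynomial.finsetSum_coeff, Polynomial.coeff_monomial, hi] using this

variable {Q : Type*} [Ring Q] [Algebra k Q]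

/-- The span of the `n`-th powers of the elements of `M`. -/
def powSpan (M : Submodule k Q) (n : ℕ) : Submodule k Q := Submodule.span k ((· ^ n) '' (M : Set Q))

theorem pow_mem_powSpan {M : Submodule k Q} {a : Q} (ha : a ∈ M) (n : ℕ) :
    a ^ n ∈ powSpan M n := Submodule.subset_span ⟨a, ha, rfl⟩

theorem powSpan_one (M : Submodule k Q) : powSpan M 1 = M := by
  rw [powSpan]
  simp

variable [CharZero k] {M : Submodule k Q}

-- Polarization: the sum is the coefficient of $t$ in $(a+tb)^n$. It is extracted in $Q[X]$, where
-- $X$ is central although $a$ and $b$ need not commute.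
omit [CharZero k] in
theorem sum_pow_mul_mul_pow_mem [Infinite k] (W : Submodule k Q) {n : ℕ} {a b : Q}
    (h : ∀ t : k, (a + t • b) ^ n ∈ W) :
    ∑ i ∈ Finset.range n, a ^ i * b * a ^ (n - 1 - i) ∈ W := by
  open Polynomial in
  let p : ℕ → Q[X] := fun n => (C a + C b * X) ^ n
  have h₀ : ∀ n, (p n).coeff 0 = a ^ n := by
    intro n
    induction n with
    | zero => simp [p]
    | succ n ih => rw [pow_succ, ← ih]; simp [p, pow_succ, Polynomial.mul_coeff_zero]
  have h₁ : ∀ n, (p n).coeff 1 = ∑ i ∈ Finset.range n, a ^ i * b * a ^ (n - 1 - i) := by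
    intro n
    induction n with
    | zero => simp [p, Polynomial.coeff_one]
    | succ n ih =>
      have : p (n + 1) = p n * Polynomial.C a + p n * Polynomial.C b * Polynomial.X := by
        simp only [p, pow_succ, mul_add, mul_assoc]
      rw [this, Polynomial.coeff_add, Polynomial.coeff_mul_C, Polynomial.coeff_mul_X,
        Polynomial.coeff_mul_C, h₀, ih, Finset.sum_range_succ, Finset.sum_mul]
      refine congrArg₂ (· + ·) (Finset.sum_congr rfl fun i hi => ?_) (by simp)
      rw [mul_assoc, ← pow_succ]
      congr 2
      have := Finset.mem_range.1 hi
      omega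
  -- Evaluation at $t$ is a ring map because scalars are central. The range is padded to `natDegree
  -- + 2` so that index $1$ always occurs in it.
  have h₂ : ∀ t : k, ∑ i ∈ Finset.range ((p n).natDegree + 2), t ^ i • (p n).coeff i =
      (a + t • b) ^ n := by
    intro t
    let e : Polynomial Q →+* Q := Polynomial.eval₂RingHom' (RingHom.id Q) (algebraMap k Q t)
      fun x => (Algebra.commutes t x).symm
    have he : e (p n) = (a + t • b) ^ n := by
      have : e (Polynomial.C a + Polynomial.C b * Polynomial.X) = a + t • b := by
        simp [e, Polynomial.eval₂RingHom', Polynomial.eval₂_add, Algebra.smul_def,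
          Algebra.commutes]
      rw [map_pow, this]
    rw [← he]
    refine Eq.trans ?_ (Polynomial.eval₂_eq_sum_range' (RingHom.id Q)
      (show (p n).natDegree < (p n).natDegree + 2 by omega) (algebraMap k Q t)).symm
    refine Finset.sum_congr rfl fun i _ => ?_
    rw [← map_pow, Algebra.smul_def, Algebra.commutes, RingHom.id_apply]
  rw [← h₁]
  exact coeff_mem_of_forall_sum_mem W (fun t => by rw [h₂]; exact h t)
    (show 1 < (p n).natDegree + 2 by omega)

/-- The Poincaré–Birkhoff–Witt step. Moving $b$ past one $a$ costs $a^i[a,b]a^{n-i}$, which is of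
the same shape with one factor fewer and so is covered by induction. Hence all positions of $b$ are
congruent modulo $S$, and their sum lies in $S$ by polarization. -/
theorem pow_mul_mul_pow_mem (hM : ∀ a ∈ M, ∀ b ∈ M, a * b - b * a ∈ M) (n : ℕ) :
    ∀ a ∈ M, ∀ b ∈ M, ∀ i ≤ n, a ^ i * b * a ^ (n - i) ∈ ⨆ m, powSpan M m := by
  set S := ⨆ m, powSpan M m
  have hS : ∀ a ∈ M, ∀ n, a ^ n ∈ S := fun a ha n =>
    Submodule.mem_iSup_of_mem n (pow_mem_powSpan ha n)
  induction n with
  | zero =>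
    intro a _ b hb i hi
    obtain rfl : i = 0 := by omega
    simpa using hS b hb 1
  | succ n ih =>
    intro a ha b hb
    have step : ∀ i ≤ n,
        a ^ (i + 1) * b * a ^ (n + 1 - (i + 1)) - a ^ i * b * a ^ (n + 1 - i) ∈ S := by
      intro i hi
      have := ih a ha (a * b - b * a) (hM a ha b hb) i hi
      rw [show n + 1 - i = n - i + 1 by omega, show n + 1 - (i + 1) = n - i by omega, pow_succ,
        pow_succ' a (n - i)]
      convert this using 1
      noncomm_ring
    have h₀ : ∀ i ≤ n + 1, a ^ i * b * a ^ (n + 1 - i) - b * a ^ (n + 1) ∈ S := by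
      intro i
      induction i with
      | zero => simp
      | succ i ih' =>
        intro hi
        have := Submodule.add_mem _ (step i (by omega)) (ih' (by omega))
        rwa [sub_add_sub_cancel] at this
    have hsum : ∑ i ∈ Finset.range (n + 2), a ^ i * b * a ^ (n + 1 - i) ∈ S :=
      sum_pow_mul_mul_pow_mem S (n := n + 2) fun t =>
        hS _ (M.add_mem ha (M.smul_mem t hb)) _
    -- The $n+2$ positions of $b$ add up to $(n+2)\,ba^{n+1}$ modulo $S$; characteristic zero allows
    -- division by $n+2$.
    have hb' : b * a ^ (n + 1) ∈ S := by
      have h := S.sub_mem hsum (S.sum_mem fun i (hi : i ∈ Finset.range (n + 2)) =>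
        h₀ i (by have := Finset.mem_range.1 hi; omega))
      rw [← Finset.sum_sub_distrib] at h
      simp only [sub_sub_cancel, Finset.sum_const, Finset.card_range] at h
      rw [← Nat.cast_smul_eq_nsmul k] at h
      exact (S.smul_mem_iff (Nat.cast_ne_zero.2 (by omega))).1 h
    intro i hi
    have := S.add_mem (h₀ i hi) hb'
    rwa [sub_add_cancel] at this

/-- The span of the powers of the elements of a Lie subalgebra is closed under products. -/
theorem mul_mem_iSup_powSpan (hM : ∀ a ∈ M, ∀ b ∈ M, a * b - b * a ∈ M) {u v : Q}
    (hu : u ∈ ⨆ m, powSpan M m) (hv : v ∈ ⨆ m, powSpan M m) : u * v ∈ ⨆ m, powSpan M m := by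
  set S := ⨆ m, powSpan M m
  -- Right multiplication by one element of $M$ suffices, since a power $a^m$ can be multiplied in
  -- one factor at a time. It is the case of the preceding lemma where $b$ stands last.
  have h₁ : ∀ u ∈ S, ∀ b ∈ M, u * b ∈ S := by
    intro u hu b hb
    refine (iSup_le fun m => Submodule.span_le.2 ?_ : S ≤ S.comap (LinearMap.mulRight k b)) hu
    rintro _ ⟨a, ha, rfl⟩
    have := pow_mul_mul_pow_mem hM m a ha b hb m le_rfl
    rwa [Nat.sub_self, pow_zero, mul_one] at this
  refine (iSup_le fun m => Submodule.span_le.2 ?_ : S ≤ S.comap (LinearMap.mulLeft k u)) hv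
  rintro _ ⟨a, ha, rfl⟩
  change u * a ^ m ∈ S
  induction m with
  | zero => simpa using hu
  | succ m ih =>
    rw [pow_succ, ← mul_assoc]
    exact h₁ _ ih a ha

end PowerSpan

/-! ### The Adams operator and group-like elements of the completion -/

section Completion

variable (k H : Type*) [Field k] [Ring H] [HopfAlgebra k H]

/-- The projection of the completion of `H` to `H / J^n`. -/
def proj (n : ℕ) : Completion k H →ₐ[k] H ⧸ augIdeal k H ^ n :=
  (Pi.evalAlgHom k (fun n : ℕ => H ⧸ augIdeal k H ^ n) n).comp (completion k H).val

variable {k H}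

theorem completion_ext {a b : Completion k H} (h : ∀ n, proj k H n a = proj k H n b) : a = b :=
  Subtype.ext (funext h)

theorem transMap_proj {m n : ℕ} (h : m ≤ n) (a : Completion k H) :
    transMap k H h (proj k H n a) = proj k H m a := a.2 m n h

theorem exists_completion {a : ∀ n, H ⧸ augIdeal k H ^ n}
    (h : ∀ m n (h : m ≤ n), transMap k H h (a n) = a m) :
    ∃ b : Completion k H, ∀ n, proj k H n b = a n := ⟨⟨a, h⟩, fun _ => rfl⟩

theorem mem_completionFilt_iff {n : ℕ} {a : Completion k H} :
    a ∈ completionFilt k H n ↔ proj k H n a = 0 := Iff.rfl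

theorem pow_mem_completionFilt {a : Completion k H} (ha : a ∈ completionFilt k H 1) (n : ℕ) :
    a ^ n ∈ completionFilt k H n := by
  induction n with
  | zero =>
    obtain ⟨x, hx⟩ := Ideal.Quotient.mk_surjective (proj k H 0 (a ^ 0))
    rw [mem_completionFilt_iff, ← hx, Ideal.Quotient.eq_zero_iff_mem]
    exact mem_augFilt_zero (k := k) x
  | succ n ih =>
    rw [pow_succ]
    exact mul_mem_completionFilt ih ha

theorem proj_pow_eq_zero {a : Completion k H} (ha : a ∈ completionFilt k H 1) (n : ℕ) :
    proj k H n a ^ n = 0 := by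
  rw [← map_pow]; exact pow_mem_completionFilt ha n

theorem isNilpotent_proj {a : Completion k H} (ha : a ∈ completionFilt k H 1) (n : ℕ) :
    IsNilpotent (proj k H n a) := ⟨n, proj_pow_eq_zero ha n⟩

theorem mem_primitives_iff {a : Completion k H} : a ∈ primitives k H ↔
    ∀ n, comulQuot k H n (proj k H (n + n) a) = proj k H n a ⊗ₜ[k] 1 + 1 ⊗ₜ[k] proj k H n a :=
  ⟨fun h => mem_primitives h, fun h => Subtype.ext (funext h)⟩

variable (k H)

/-- The coproduct sends $J^n$ into $\sum_{p+q=n}J^p\otimes J^q$, which multiplies back into $J^n$;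
this makes the Adams operator well defined on $H/J^n$. -/
theorem mul_comul_mem {n : ℕ} {x : H} (hx : x ∈ augFilt k H n) :
    LinearMap.mul' k H (CoalgebraStruct.comul x) ∈ augFilt k H n := by
  have key : tensorFilt (augFilt k H) n ≤ (augFilt k H n).comap (LinearMap.mul' k H) :=
    tensorFilt_le fun p q h x hx y hy => by
      rw [Submodule.mem_comap, LinearMap.mul'_apply, ← h]
      exact mul_mem_augFilt hx hy
  exact key (comul_mem_augFilt hx)

/-- The Adams operator of `H / J^n`, the composition of the coproduct and the product. -/
def adams (n : ℕ) : Module.End k (H ⧸ augIdeal k H ^ n) :=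
  (augFilt k H n).liftQ ((Ideal.Quotient.mkₐ k (augIdeal k H ^ n)).toLinearMap ∘ₗ
      LinearMap.mul' k H ∘ₗ CoalgebraStruct.comul)
    (fun _ hx => Ideal.Quotient.eq_zero_iff_mem.2 (mul_comul_mem k H hx)) ∘ₗ
  (Submodule.Quotient.restrictScalarsEquiv k (augIdeal k H ^ n)).symm.toLinearMap

variable {k H}

theorem adams_mk (n : ℕ) (x : H) : adams k H n (Ideal.Quotient.mk _ x) =
    Ideal.Quotient.mk _ (LinearMap.mul' k H (CoalgebraStruct.comul x)) := rfl

/-- Links the Adams operator with the completed coproduct, in terms of which primitivity is stated;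
that coproduct goes from level $2n$ to level $n$. -/
theorem adams_proj (n : ℕ) (a : Completion k H) : adams k H n (proj k H n a) =
    LinearMap.mul' k _ (comulQuot k H n (proj k H (n + n) a)) := by
  obtain ⟨x, hx⟩ := Ideal.Quotient.mk_surjective (proj k H (n + n) a)
  rw [← transMap_proj (show n ≤ n + n by omega), ← hx, comulQuot_mk]
  refine (adams_mk n x).trans ?_
  change _ = LinearMap.mul' k (H ⧸ augIdeal k H ^ n) (Algebra.TensorProduct.map
    (Ideal.Quotient.mkₐ k (augIdeal k H ^ n)) (Ideal.Quotient.mkₐ k (augIdeal k H ^ n))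
    (CoalgebraStruct.comul x))
  generalize (CoalgebraStruct.comul x : H ⊗[k] H) = u
  induction u with
  | zero => simp only [map_zero]
  | add a b ha hb => simp only [map_add, ha, hb]
  | tmul a b => rfl

/-- Multiplying out $(y\otimes1+1\otimes y)^m$ gives $\sum_i\binom mi y^m=2^my^m$. The eigenvalue
thus records the degree of a power of a primitive element. -/
theorem adams_primitive_pow (n : ℕ) {a : Completion k H} (ha : a ∈ primitives k H) (m : ℕ) :
    adams k H n (proj k H n a ^ m) = (2 : k) ^ m • proj k H n a ^ m := by
  rw [← map_pow, adams_proj, map_pow, map_pow, mem_primitives_iff.1 ha, map_pow (proj k H n)]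
  generalize proj k H n a = y
  rw [Commute.add_pow (by simp [commute_iff_eq]), map_sum]
  have h : ∀ i ∈ Finset.range (m + 1), LinearMap.mul' k _ ((y ⊗ₜ[k] 1) ^ i * (1 ⊗ₜ[k] y) ^ (m - i) *
      ((m.choose i : ℕ) : (H ⧸ augIdeal k H ^ n) ⊗[k] (H ⧸ augIdeal k H ^ n))) =
      (m.choose i : k) • y ^ m := by
    intro i hi
    rw [← nsmul_eq_mul', map_nsmul, Algebra.TensorProduct.tmul_pow, Algebra.TensorProduct.tmul_pow,
      Algebra.TensorProduct.tmul_mul_tmul, LinearMap.mul'_apply, one_pow, one_pow, one_mul,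
      mul_one, ← pow_add, Nat.cast_smul_eq_nsmul]
    rw [Nat.add_sub_cancel' (by have := Finset.mem_range.1 hi; omega)]
  rw [Finset.sum_congr rfl h, ← Finset.sum_smul, ← Nat.cast_sum, Nat.sum_range_choose]
  simp

theorem isNilpotent_proj_primitive (n : ℕ) (x : primitives k H) :
    IsNilpotent (proj k H n x) := isNilpotent_proj (primitive_mem_completionFilt_one x.2) n

/-- Group-like elements of the completion of `H`. -/
structure IsGroupLikeHat (u : Completion k H) : Prop where
  proj_one : proj k H 1 u = 1
  comul : ∀ n, comulQuot k H n (proj k H (n + n) u) = proj k H n u ⊗ₜ[k] proj k H n u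

theorem IsGroupLikeHat.mul {u v : Completion k H} (hu : IsGroupLikeHat u) (hv : IsGroupLikeHat v) :
    IsGroupLikeHat (u * v) where
  proj_one := by rw [map_mul, hu.proj_one, hv.proj_one, one_mul]
  comul n := by
    rw [map_mul, map_mul, hu.comul, hv.comul, Algebra.TensorProduct.tmul_mul_tmul, map_mul]

theorem IsGroupLikeHat.sub_one_mem {u : Completion k H} (hu : IsGroupLikeHat u) :
    u - 1 ∈ completionFilt k H 1 := by
  rw [mem_completionFilt_iff, map_sub, hu.proj_one, map_one, sub_self]

variable [Algebra ℚ H]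

/-- Exponentials are taken in each $H/J^n$, where $a$ is nilpotent; they are compatible because
algebra maps commute with exponentials. -/
theorem exists_exp {a : Completion k H} (ha : a ∈ completionFilt k H 1) :
    ∃ u : Completion k H, ∀ n, proj k H n u = IsNilpotent.exp (proj k H n a) :=
  exists_completion fun m n h => by
    rw [IsNilpotent.map_exp (isNilpotent_proj ha n), transMap_proj]

/-- The exponential of a primitive element of the completion. -/
def expPrim (x : primitives k H) : Completion k H :=
  (exists_exp (primitive_mem_completionFilt_one x.2)).choose

theorem proj_expPrim (n : ℕ) (x : primitives k H) :
    proj k H n (expPrim x) = IsNilpotent.exp (proj k H n x) :=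
  (exists_exp (primitive_mem_completionFilt_one x.2)).choose_spec n

theorem expPrim_injective : Function.Injective (expPrim (k := k) (H := H)) := fun x y h =>
  Subtype.ext (completion_ext fun n => exp_injective (isNilpotent_proj_primitive n x)
    (isNilpotent_proj_primitive n y) (by rw [← proj_expPrim, ← proj_expPrim, h]))

theorem exp_tmul_add {n : ℕ} {a : H ⧸ augIdeal k H ^ n} (ha : IsNilpotent a) :
    IsNilpotent.exp (a ⊗ₜ[k] 1 + 1 ⊗ₜ[k] a) = IsNilpotent.exp a ⊗ₜ[k] IsNilpotent.exp a := by
  have h₁ := IsNilpotent.map_exp ha (Algebra.TensorProduct.includeLeft (R := k) (S := k)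
    (A := H ⧸ augIdeal k H ^ n) (B := H ⧸ augIdeal k H ^ n))
  have h₂ := IsNilpotent.map_exp ha (Algebra.TensorProduct.includeRight (R := k)
    (A := H ⧸ augIdeal k H ^ n) (B := H ⧸ augIdeal k H ^ n))
  have n₁ := ha.map (Algebra.TensorProduct.includeLeft (R := k) (S := k)
    (A := H ⧸ augIdeal k H ^ n) (B := H ⧸ augIdeal k H ^ n))
  have n₂ := ha.map (Algebra.TensorProduct.includeRight (R := k)
    (A := H ⧸ augIdeal k H ^ n) (B := H ⧸ augIdeal k H ^ n))
  simp only [Algebra.TensorProduct.includeLeft_apply,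
    Algebra.TensorProduct.includeRight_apply] at h₁ h₂ n₁ n₂
  rw [IsNilpotent.exp_add_of_commute (by simp [commute_iff_eq]) n₁ n₂, ← h₁, ← h₂,
    Algebra.TensorProduct.tmul_mul_tmul, one_mul, mul_one]

theorem isGroupLikeHat_expPrim (x : primitives k H) : IsGroupLikeHat (expPrim x) where
  proj_one := by
    rw [proj_expPrim, mem_completionFilt_iff.1 (primitive_mem_completionFilt_one x.2),
      IsNilpotent.exp_zero]
  comul n := by
    rw [proj_expPrim, proj_expPrim, IsNilpotent.map_exp (isNilpotent_proj_primitive _ x),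
      mem_primitives_iff.1 x.2, exp_tmul_add (isNilpotent_proj_primitive n x)]

/-- Logarithms exist in each $H/J^n$. Their uniqueness does the rest: it makes them compatible, and
it turns $\exp(\Delta x)=\exp x\otimes\exp x=\exp(x\otimes1+1\otimes x)$ into primitivity of $x$. -/
theorem exists_expPrim_eq {u : Completion k H} (hu : IsGroupLikeHat u) :
    ∃ x : primitives k H, expPrim x = u := by
  have hn : ∀ n, IsNilpotent (proj k H n u - 1) := fun n => by
    have := isNilpotent_proj hu.sub_one_mem n
    rwa [map_sub, map_one] at this
  have h : ∀ n, ∃ y, IsNilpotent y ∧ IsNilpotent.exp y = proj k H n u := fun n => by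
    obtain ⟨p, hp⟩ := exists_log (hn n)
    exact ⟨_, isNilpotent_aeval_mul (hn n) p, by rw [hp, add_sub_cancel]⟩
  choose y hy₁ hy₂ using h
  obtain ⟨x, hx⟩ := exists_completion (a := y) fun m n h => by
    refine exp_injective ((hy₁ n).map _) (hy₁ m) ?_
    rw [← IsNilpotent.map_exp (hy₁ n), hy₂, hy₂, transMap_proj]
  have hxp : x ∈ primitives k H := by
    refine mem_primitives_iff.2 fun n => ?_
    rw [hx, hx]
    refine exp_injective ((hy₁ _).map _) (Commute.isNilpotent_add (by simp [commute_iff_eq])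
      ((hy₁ n).map (Algebra.TensorProduct.includeLeft (R := k) (S := k)))
      ((hy₁ n).map (Algebra.TensorProduct.includeRight (R := k)))) ?_
    rw [← IsNilpotent.map_exp (hy₁ _), exp_tmul_add (hy₁ n), hy₂, hy₂, hu.comul]
  exact ⟨⟨x, hxp⟩, completion_ext fun n => by rw [proj_expPrim, ← hy₂, ← hx]⟩

end Completion

/-! ### Filtered Lie endomorphisms and products of exponentials -/

section PowSpanClosure

open Polynomial

variable {k Q : Type*} [Field k] [CharZero k] [Ring Q] [Algebra k Q] [Algebra ℚ Q]

theorem rat_smul_mem (S : Submodule k Q) (c : ℚ) {a : Q} (ha : a ∈ S) : c • a ∈ S := by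
  rw [← Rat.cast_smul_eq_qsmul k]
  exact S.smul_mem _ ha

theorem exp_mem_iSup_powSpan {M : Submodule k Q} {a : Q} (ha : a ∈ M) (hn : IsNilpotent a) :
    IsNilpotent.exp a ∈ ⨆ m, powSpan M m := by
  obtain ⟨n, hn⟩ := hn
  rw [IsNilpotent.exp_eq_sum hn]
  exact Submodule.sum_mem _ fun i _ => rat_smul_mem _ _
    (Submodule.mem_iSup_of_mem i (pow_mem_powSpan ha i))

theorem aeval_mem_of_mul_mem {S : Submodule k Q} (h₁ : 1 ∈ S)
    (hS : ∀ {u v : Q}, u ∈ S → v ∈ S → u * v ∈ S) {a : Q} (ha : a ∈ S) (p : ℚ[X]) :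
    aeval a p ∈ S := by
  have hp : ∀ n, a ^ n ∈ S := fun n => by
    induction n with
    | zero => simpa using h₁
    | succ n ih => rw [pow_succ]; exact hS ih ha
  induction p using Polynomial.induction_on' with
  | add p q hp hq => rw [map_add]; exact S.add_mem hp hq
  | monomial n c => rw [aeval_monomial, ← Algebra.smul_def]; exact rat_smul_mem S c (hp n)

end PowSpanClosure

/-! ### Separation of eigenspaces for distinct powers of two -/

section Eigen

variable {k V : Type*} [Field k] [CharZero k] [AddCommGroup V] [Module k V]

theorem two_pow_injective : Function.Injective fun n : ℕ => (2 : k) ^ n := fun m n h => by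
  have h' : ((2 ^ m : ℕ) : k) = ((2 ^ n : ℕ) : k) := by
    push_cast
    exact h
  exact Nat.pow_right_injective le_rfl (Nat.cast_injective h')

/-- An eigenvector in the sum of subspaces of eigenspaces for different eigenvalues belongs to the
relevant subspace. -/
theorem mem_of_mem_iSup_of_eigen (T : Module.End k V) {S : ℕ → Submodule k V}
    (hS : ∀ n, S n ≤ T.eigenspace (2 ^ n)) {n : ℕ} {v : V} (hv : v ∈ ⨆ n, S n)
    (hT : v ∈ T.eigenspace (2 ^ n)) : v ∈ S n := by
  have hind := (T.eigenspaces_iSupIndep.comp (two_pow_injective (k := k))) n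
  have hle : ⨆ m, S m ≤ S n ⊔ ⨆ (m) (_ : m ≠ n), S m := iSup_le fun m => by
    by_cases h : m = n
    · exact h ▸ le_sup_left
    · exact le_sup_of_le_right (le_iSup₂_of_le m h le_rfl)
  obtain ⟨s, hs, r, hr, rfl⟩ := Submodule.mem_sup.1 (hle hv)
  -- The remainder $r=v-s$ is an eigenvector for $2^n$ and also a sum of eigenvectors for other
  -- eigenvalues, so independence of eigenspaces makes it zero.
  have hr₁ : r ∈ T.eigenspace (2 ^ n) := by
    have := Submodule.sub_mem _ hT (hS n hs)
    rwa [add_sub_cancel_left] at this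
  have hr₂ : r ∈ ⨆ (m) (_ : m ≠ n), T.eigenspace ((2 : k) ^ m) := iSup₂_mono (fun m _ => hS m) hr
  rw [Submodule.disjoint_def.1 hind r hr₁ hr₂, add_zero]
  exact hs

end Eigen

/-! ### The graph of a Lie endomorphism modulo powers of the augmentation ideal -/

section LieEndo

variable {k H : Type*} [Field k] [Ring H] [HopfAlgebra k H]
  (φ : primitives k H →ₗ⁅k⁆ primitives k H)

/-- The graph of the endomorphism `φ` modulo `J^n`. -/
def graphMod (n : ℕ) : primitives k H →ₗ[k] (H ⧸ augIdeal k H ^ n) × (H ⧸ augIdeal k H ^ n) :=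
  ((proj k H n).toLinearMap ∘ₗ (primitives k H).toSubmodule.subtype).prod
    ((proj k H n).toLinearMap ∘ₗ (primitives k H).toSubmodule.subtype ∘ₗ φ.toLinearMap)

theorem graphMod_apply (n : ℕ) (x : primitives k H) :
    graphMod φ n x = (proj k H n x, proj k H n (φ x)) := rfl

/-- The graph of a Lie homomorphism is closed under commutators in the product algebra, which is the
hypothesis of `mul_mem_iSup_powSpan`. -/
theorem graphMod_lie (n : ℕ) (x y : primitives k H) :
    graphMod φ n ⁅x, y⁆ = graphMod φ n x * graphMod φ n y - graphMod φ n y * graphMod φ n x := by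
  have h : ∀ x y : primitives k H, proj k H n (⁅x, y⁆ : primitives k H) =
      proj k H n x * proj k H n y - proj k H n y * proj k H n x := fun x y => by
    rw [← map_mul, ← map_mul, ← map_sub]; rfl
  rw [graphMod_apply, LieHom.map_lie, h, h]
  rfl

theorem powSpan_le_eigenspace (n m : ℕ) : powSpan (LinearMap.range (graphMod φ n)) m ≤
    Module.End.eigenspace ((adams k H n).prodMap (adams k H n)) (2 ^ m) := by
  refine Submodule.span_le.2 ?_
  rintro _ ⟨_, ⟨x, rfl⟩, rfl⟩
  rw [SetLike.mem_coe, Module.End.mem_eigenspace_iff]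
  exact Prod.ext (adams_primitive_pow n x.2 m) (adams_primitive_pow n (φ x).2 m)

variable {φ} [CharZero k] (hφ : ∀ n x, x ∈ (primitiveFilt k H).F n → φ x ∈ (primitiveFilt k H).F n)
include hφ

/-- A pair of primitive elements has Adams eigenvalue $2$, so if it lies in the span of the powers
of the graph, it lies in the span of the first powers, which is the graph itself. -/
theorem proj_eq_of_mem_powSpan {n : ℕ} {x y : primitives k H}
    (h : ((proj k H n x, proj k H n y) : (H ⧸ augIdeal k H ^ n) × (H ⧸ augIdeal k H ^ n)) ∈
      ⨆ m, powSpan (LinearMap.range (graphMod φ n)) m) :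
    proj k H n y = proj k H n (φ x) := by
  have h₁ := mem_of_mem_iSup_of_eigen (n := 1) _ (powSpan_le_eigenspace φ n) h (by
    rw [Module.End.mem_eigenspace_iff]
    have hx := adams_primitive_pow n x.2 1
    have hy := adams_primitive_pow n y.2 1
    rw [pow_one (proj k H n _)] at hx hy
    exact Prod.ext hx hy)
  rw [powSpan_one] at h₁
  obtain ⟨z, hz⟩ := h₁
  rw [graphMod_apply, Prod.mk.injEq] at hz
  -- The point of the graph comes from some $z$ known only to agree with $x$ modulo $J^n$; that
  -- $\varphi$ preserves $F^n$ gives $\varphi(z)\equiv\varphi(x)$.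
  have hzx : φ (z - x) ∈ (primitiveFilt k H).F n := hφ n _ (by
    change proj k H n ((z : Completion k H) - x) = 0
    rw [map_sub, hz.1, sub_self])
  rw [← hz.2, ← sub_eq_zero, ← map_sub]
  rw [map_sub] at hzx
  exact hzx

/-- A filtered endomorphism of the Lie algebra of primitive elements is compatible with the product
of exponentials. -/
theorem expPrim_map_mul [Algebra ℚ H] {x y z : primitives k H}
    (h : expPrim z = expPrim x * expPrim y) :
    expPrim (φ z) = expPrim (φ x) * expPrim (φ y) := by
  -- The product on the right is group-like and has a logarithm $z'$. It remains to identify $z'$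
  -- with $\varphi(z)$ modulo each $J^n$, by showing that $(z,z')$ lies in the span of the powers of
  -- the graph.
  obtain ⟨z', hz'⟩ := exists_expPrim_eq
    ((isGroupLikeHat_expPrim (φ x)).mul (isGroupLikeHat_expPrim (φ y)))
  rw [← hz']
  refine congrArg expPrim (Subtype.ext (completion_ext fun n => ?_))
  refine (proj_eq_of_mem_powSpan hφ ?_).symm
  set M := LinearMap.range (graphMod φ n)
  have hM : ∀ a ∈ M, ∀ b ∈ M, a * b - b * a ∈ M := by
    rintro _ ⟨a, rfl⟩ _ ⟨b, rfl⟩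
    exact ⟨⁅a, b⁆, graphMod_lie φ n a b⟩
  have hnil : ∀ x y : primitives k H, IsNilpotent
      ((proj k H n x, proj k H n y) : (H ⧸ augIdeal k H ^ n) × (H ⧸ augIdeal k H ^ n)) :=
    fun x y => ⟨n, Prod.ext (proj_pow_eq_zero (primitive_mem_completionFilt_one x.2) n)
      (proj_pow_eq_zero (primitive_mem_completionFilt_one y.2) n)⟩
  have hexp : ∀ x y : primitives k H, IsNilpotent.exp
      ((proj k H n x, proj k H n y) : (H ⧸ augIdeal k H ^ n) × (H ⧸ augIdeal k H ^ n)) =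
      (proj k H n (expPrim x), proj k H n (expPrim y)) := fun x y => by
    rw [proj_expPrim, proj_expPrim]
    exact Prod.ext (IsNilpotent.map_exp (hnil x y) (RingHom.fst _ _))
      (IsNilpotent.map_exp (hnil x y) (RingHom.snd _ _))
  have hmem : ∀ x, IsNilpotent.exp (graphMod φ n x) ∈ ⨆ m, powSpan M m := fun x =>
    exp_mem_iSup_powSpan ⟨x, rfl⟩ (hnil x (φ x))
  have h₁ : (1 : (H ⧸ augIdeal k H ^ n) × (H ⧸ augIdeal k H ^ n)) ∈ ⨆ m, powSpan M m :=
    Submodule.mem_iSup_of_mem 0 (by simpa using pow_mem_powSpan M.zero_mem 0)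
  -- In the product algebra, $\exp(z,z')=\exp(x,\varphi x)\exp(y,\varphi y)$, and both factors lie
  -- in the multiplicatively closed span.
  have hz : IsNilpotent.exp
      ((proj k H n z, proj k H n z') : (H ⧸ augIdeal k H ^ n) × (H ⧸ augIdeal k H ^ n)) ∈
      ⨆ m, powSpan M m := by
    have := mul_mem_iSup_powSpan hM (hmem x) (hmem y)
    rw [graphMod_apply, graphMod_apply, hexp, hexp, Prod.mk_mul_mk, ← map_mul, ← map_mul, ← h,
      ← hz'] at this
    rwa [hexp]
  -- The logarithm is a polynomial in its exponential minus one, so $(z,z')$ itself stays in the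
  -- span.
  obtain ⟨p, hp⟩ := exists_eq_aeval_exp (IsNilpotent.isNilpotent_exp_sub_one (hnil z z'))
  rw [hp _ (hnil z z') rfl]
  exact aeval_mem_of_mul_mem h₁ (mul_mem_iSup_powSpan hM) (Submodule.sub_mem _ hz h₁) _

end LieEndo

/-! ### The endomorphism of `H'` induced by a filtered endomorphism of the Malcev Lie algebra -/

section OfHopf

variable (k H : Type*) [Field k] [Ring H] [HopfAlgebra k H]

/-- The canonical map from `H` to its completion. -/
def ofHopf : H →ₐ[k] Completion k H :=
  AlgHom.codRestrict (AlgHom.pi fun n => Ideal.Quotient.mkₐ k (augIdeal k H ^ n))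
    (completion k H) fun _ _ _ _ => rfl

variable {k H}

theorem proj_ofHopf (n : ℕ) (x : H) : proj k H n (ofHopf k H x) = Ideal.Quotient.mk _ x := rfl

theorem ofHopf_mem {n : ℕ} {x : H} : ofHopf k H x ∈ completionFilt k H n ↔ x ∈ augFilt k H n :=
  Ideal.Quotient.eq_zero_iff_mem

/-- The linear form on `H / J^n` induced by a linear form on `H`. -/
def quotForm {n : ℕ} (α : H →ₗ[k] k) (hα : ∀ x ∈ augFilt k H n, α x = 0) :
    (H ⧸ augIdeal k H ^ n) →ₗ[k] k :=
  (augFilt k H n).liftQ α hα ∘ₗ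
    (Submodule.Quotient.restrictScalarsEquiv k (augIdeal k H ^ n)).symm.toLinearMap

theorem quotForm_mk {n : ℕ} (α : H →ₗ[k] k) (hα : ∀ x ∈ augFilt k H n, α x = 0) (x : H) :
    quotForm α hα (Ideal.Quotient.mk _ x) = α x := rfl

/-- The continuous extension of a linear form in `H'` to the completion of `H`. -/
def evHat (α : HopfDual k H) : Completion k H →ₗ[k] k :=
  quotForm α.1.ofConv α.2.choose_spec ∘ₗ (proj k H (α.2.choose + 1)).toLinearMap

/-- Frees `evHat` from the level chosen in its definition: a form vanishing on $J^{n+1}$ can be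
evaluated on a representative at any level $N>n$. Two levels are compared at their maximum. -/
theorem evHat_eq {α : HopfDual k H} {n N : ℕ} (hα : α.1 ∈ dualFilt k H n) (hN : n < N)
    {a : Completion k H} {x : H} (h : proj k H N a = Ideal.Quotient.mk _ x) :
    evHat α a = ev k H α x := by
  set m := α.2.choose
  obtain ⟨y, hy⟩ := Ideal.Quotient.mk_surjective (proj k H (max (m + 1) N) a)
  have h₁ : evHat α a = ev k H α y := by
    change quotForm α.1.ofConv α.2.choose_spec (proj k H (m + 1) a) = _
    rw [← transMap_proj (le_max_left (m + 1) N), ← hy]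
    rfl
  have h₂ : y - x ∈ augFilt k H N := by
    refine Ideal.Quotient.eq.1 ?_
    rw [← h, ← transMap_proj (le_max_right (m + 1) N), ← hy]
    rfl
  rw [h₁, ← sub_eq_zero]
  exact (map_sub α.1.ofConv y x).symm.trans (hα _ (augFilt_anti hN h₂))

/-- The product of $H'$ is dual to the coproduct, so evaluation at a group-like element is a
character. -/
theorem evHat_mul {u : Completion k H} (hu : IsGroupLikeHat u) (α β : HopfDual k H) :
    evHat (α * β) u = evHat α u * evHat β u := by
  obtain ⟨m, hm⟩ := α.2
  obtain ⟨n, hn⟩ := β.2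
  -- This level exceeds the orders $m$, $n$ of the factors and the order $m+n$ of their product.
  set N := m + n + 1
  have hαβ : (α * β).1 ∈ dualFilt k H (m + n) := mul_mem_dualFilt hm hn
  obtain ⟨x, hx⟩ := Ideal.Quotient.mk_surjective (proj k H (N + N) u)
  have hxN : proj k H N u = Ideal.Quotient.mk _ x := by
    rw [← transMap_proj (show N ≤ N + N by omega), ← hx]; rfl
  rw [evHat_eq hαβ (show m + n < N + N by omega) hx.symm,
    evHat_eq hm (show m < N by omega) hxN, evHat_eq hn (show n < N by omega) hxN]
  have hα : ∀ x ∈ augFilt k H N, α.1.ofConv x = 0 := fun x hx =>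
    hm x (augFilt_anti (by omega) hx)
  have hβ : ∀ x ∈ augFilt k H N, β.1.ofConv x = 0 := fun x hx =>
    hn x (augFilt_anti (by omega) hx)
  have h₁ := congrArg (fun v => LinearMap.mul' k k (TensorProduct.map (quotForm _ hα)
    (quotForm _ hβ) v)) (hu.comul N)
  rw [← hx, comulQuot_mk] at h₁
  simp only [hxN, TensorProduct.map_tmul, LinearMap.mul'_apply, quotForm_mk] at h₁
  refine Eq.trans ?_ h₁
  change LinearMap.mul' k k (TensorProduct.map α.1.ofConv β.1.ofConv (CoalgebraStruct.comul x)) =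
    LinearMap.mul' k k (TensorProduct.map (quotForm _ hα) (quotForm _ hβ)
      (Algebra.TensorProduct.map (Ideal.Quotient.mkₐ k (augIdeal k H ^ N))
        (Ideal.Quotient.mkₐ k (augIdeal k H ^ N)) (CoalgebraStruct.comul x)))
  generalize (CoalgebraStruct.comul x : H ⊗[k] H) = w
  induction w with
  | zero => simp only [map_zero]
  | add a b ha hb => simp only [map_add, ha, hb]
  | tmul a b => rfl

end OfHopf

/-! ### Transposes of filtered algebra maps into the completion -/

section Transpose

variable {k H : Type*} [Field k] [Ring H] [HopfAlgebra k H] (θ : H →ₐ[k] Completion k H)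
  (hθ : ∀ n, ∀ x ∈ augFilt k H n, θ x ∈ completionFilt k H n)

/-- The transpose `H' → H'` of a filtered map from `H` to its completion. -/
def transposeHat : HopfDual k H →ₗ[k] HopfDual k H where
  toFun α := ⟨WithConv.toConv (evHat α ∘ₗ θ.toLinearMap), by
    obtain ⟨n, hn⟩ := α.2
    refine ⟨n, fun x hx => ?_⟩
    refine (evHat_eq hn n.lt_succ_self (x := 0) ?_).trans (map_zero α.1.ofConv)
    rw [map_zero]
    exact hθ _ x hx⟩
  map_add' α β := ev_injective (by
    obtain ⟨m, hm⟩ := α.2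
    obtain ⟨n, hn⟩ := β.2
    ext x
    obtain ⟨y, hy⟩ := Ideal.Quotient.mk_surjective (proj k H (max m n + 1) (θ x))
    have h : (α + β).1 ∈ dualFilt k H (max m n) := Submodule.add_mem _
      (dualFilt_mono (le_max_left _ _) hm) (dualFilt_mono (le_max_right _ _) hn)
    change evHat (α + β) (θ x) = evHat α (θ x) + evHat β (θ x)
    rw [evHat_eq h (by omega) hy.symm, evHat_eq hm (by omega) hy.symm,
      evHat_eq hn (by omega) hy.symm, map_add]
    rfl)
  map_smul' c α := ev_injective (by
    obtain ⟨m, hm⟩ := α.2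
    ext x
    obtain ⟨y, hy⟩ := Ideal.Quotient.mk_surjective (proj k H (m + 1) (θ x))
    have h : (c • α).1 ∈ dualFilt k H m := Submodule.smul_mem _ c hm
    change evHat (c • α) (θ x) = c * evHat α (θ x)
    rw [evHat_eq h (by omega) hy.symm, evHat_eq hm (by omega) hy.symm, map_smul]
    rfl)

theorem ev_transposeHat (α : HopfDual k H) (x : H) :
    ev k H (transposeHat θ hθ α) x = evHat α (θ x) := rfl

/-- A tensor involves finitely many forms, each of finite order, so one level $N$ depending on $u$
alone suffices for evaluating it on representatives. -/
theorem ev₂_map_transposeHat (u : HopfDual k H ⊗[k] HopfDual k H) :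
    ∃ N, ∀ N' ≥ N, ∀ x y x' y', proj k H N' (θ x) = Ideal.Quotient.mk _ x' →
      proj k H N' (θ y) = Ideal.Quotient.mk _ y' →
      ev₂ k H (TensorProduct.map (transposeHat θ hθ) (transposeHat θ hθ) u) (x, y) =
        ev₂ k H u (x', y') := by
  induction u with
  | zero => exact ⟨0, fun _ _ _ _ _ _ _ _ => by simp only [map_zero]; rfl⟩
  | add a b ha hb =>
    obtain ⟨m, hm⟩ := ha
    obtain ⟨n, hn⟩ := hb
    refine ⟨max m n, fun N hN x y x' y' hx hy => ?_⟩
    rw [map_add, map_add, map_add, Pi.add_apply, Pi.add_apply,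
      hm N (by omega) x y x' y' hx hy, hn N (by omega) x y x' y' hx hy]
  | tmul α β =>
    obtain ⟨m, hm⟩ := α.2
    obtain ⟨n, hn⟩ := β.2
    refine ⟨max m n + 1, fun N hN x y x' y' hx hy => ?_⟩
    rw [TensorProduct.map_tmul, ev₂_tmul, ev₂_tmul, ev_transposeHat, ev_transposeHat,
      evHat_eq hm (by omega) hx, evHat_eq hn (by omega) hy]

variable [FiniteCotangent k H]

/-- Dual to multiplicativity of $\theta$: on $(x,y)$ both sides evaluate $\alpha$ at
$\theta(x)\theta(y)$. -/
theorem comul_transposeHat (α : HopfDual k H) :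
    (CoalgebraStruct.comul (transposeHat θ hθ α) : HopfDual k H ⊗[k] HopfDual k H) =
      TensorProduct.map (transposeHat θ hθ) (transposeHat θ hθ) (CoalgebraStruct.comul α) := by
  obtain ⟨N, hN⟩ := ev₂_map_transposeHat θ hθ (CoalgebraStruct.comul α)
  obtain ⟨n, hn⟩ := α.2
  refine ev₂_injective (funext fun ⟨x, y⟩ => ?_)
  -- The level has to be large enough both for the tensor $\Delta\alpha$ (bound $N$) and for
  -- $\alpha$ itself (bound $n+1$).
  obtain ⟨x', hx⟩ := Ideal.Quotient.mk_surjective (proj k H (max N (n + 1)) (θ x))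
  obtain ⟨y', hy⟩ := Ideal.Quotient.mk_surjective (proj k H (max N (n + 1)) (θ y))
  rw [hN _ (le_max_left _ _) x y x' y' hx.symm hy.symm]
  refine (ev₂_dualComul _ x y).trans (Eq.trans ?_ (ev₂_dualComul α x' y').symm)
  rw [ev_transposeHat, map_mul]
  exact evHat_eq hn (show n < max N (n + 1) by omega) (by rw [map_mul, ← hx, ← hy, map_mul])

theorem counit_transposeHat (α : HopfDual k H) :
    CoalgebraStruct.counit (R := k) (transposeHat θ hθ α) = CoalgebraStruct.counit (R := k) α := by
  obtain ⟨n, hn⟩ := α.2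
  change evHat α (θ 1) = ev k H α 1
  exact evHat_eq hn n.lt_succ_self (by rw [map_one, map_one, map_one])

end Transpose

/-! ### Exponentiating a filtered endomorphism of the Malcev Lie algebra -/

section Exponentiate

theorem expPrim_zero {k H : Type*} [Field k] [Ring H] [HopfAlgebra k H] [Algebra ℚ H] :
    expPrim (0 : primitives k H) = 1 := completion_ext fun n => by
  rw [proj_expPrim, map_one]
  exact (congrArg IsNilpotent.exp (map_zero (proj k H n))).trans IsNilpotent.exp_zero

variable {k Γ : Type*} [Field k] [Group Γ]

theorem isGroupLikeHat_single (g : Γ) :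
    IsGroupLikeHat (ofHopf k (MonoidAlgebra k Γ) (MonoidAlgebra.single g 1)) where
  proj_one := by
    rw [proj_ofHopf, ← map_one (Ideal.Quotient.mk _), Ideal.Quotient.eq]
    exact single_sub_one_mem k Γ g
  comul n := by
    rw [proj_ofHopf, comulQuot_mk]
    change Algebra.TensorProduct.map (Ideal.Quotient.mkₐ k _) (Ideal.Quotient.mkₐ k _)
      (CoalgebraStruct.comul (MonoidAlgebra.single g 1 : MonoidAlgebra k Γ)) = _
    rw [MonoidAlgebra.comul_single, CommSemiring.comul_apply, TensorProduct.map_tmul]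
    rw [Algebra.TensorProduct.map_tmul]
    rfl

variable [CharZero k]

variable (k) in
/-- The logarithm of an element of `Γ`, in the Malcev Lie algebra of `Γ`. -/
def logSingle (g : Γ) : MalcevLie k Γ := (exists_expPrim_eq (isGroupLikeHat_single g)).choose

theorem expPrim_logSingle (g : Γ) :
    expPrim (logSingle k g) = ofHopf k (MonoidAlgebra k Γ) (MonoidAlgebra.single g 1) :=
  (exists_expPrim_eq (isGroupLikeHat_single g)).choose_spec

variable {φ : MalcevLie k Γ →ₗ⁅k⁆ MalcevLie k Γ}
  (hφ : ∀ n x, x ∈ (malcevFilt k Γ).F n → φ x ∈ (malcevFilt k Γ).F n)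

/-- The map `k Γ → (k Γ)^` extending a filtered endomorphism of the Malcev Lie algebra. -/
def expEndo : MonoidAlgebra k Γ →ₐ[k] Completion k (MonoidAlgebra k Γ) :=
  MonoidAlgebra.lift k _ Γ
    { toFun := fun g => expPrim (φ (logSingle k g))
      map_one' := by
        have h : logSingle k (1 : Γ) = 0 := expPrim_injective (by
          rw [expPrim_logSingle, expPrim_zero, ← MonoidAlgebra.one_def, map_one])
        rw [h, map_zero, expPrim_zero]
      map_mul' := fun g h => expPrim_map_mul hφ (by
        rw [expPrim_logSingle, expPrim_logSingle, expPrim_logSingle, ← map_mul,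
          MonoidAlgebra.single_mul_single, mul_one]) }

theorem expEndo_single (g : Γ) :
    expEndo hφ (MonoidAlgebra.single g 1) = expPrim (φ (logSingle k g)) := by
  rw [expEndo, MonoidAlgebra.lift_single, one_smul]; rfl

theorem proj_two_expPrim (x : MalcevLie k Γ) :
    proj k (MonoidAlgebra k Γ) 2 (expPrim x) = 1 + proj k (MonoidAlgebra k Γ) 2 x := by
  rw [proj_expPrim, IsNilpotent.exp_eq_sum
    (proj_pow_eq_zero (primitive_mem_completionFilt_one x.2) 2)]
  simp [Finset.sum_range_succ]

variable (hφ₂ : ∀ x, φ x - (2 : k) • x ∈ (malcevFilt k Γ).F 2)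
include hφ₂

/-- The map acts by $2^n$ on $J^n/J^{n+1}$. Degree one is checked on the spanning elements $g-1$ of
$J$; higher degrees follow from multiplicativity, since $J^{n+1}=J\cdot J^n$. -/
theorem expEndo_sub_mem {n : ℕ} {x : MonoidAlgebra k Γ}
    (hx : x ∈ augFilt k (MonoidAlgebra k Γ) n) :
    expEndo hφ x - (2 : k) ^ n • ofHopf k _ x ∈ completionFilt k (MonoidAlgebra k Γ) (n + 1) := by
  -- Modulo $F^2$, $\exp(x)-1$ is $x$, so the claim about $g-1$ is the hypothesis on $\varphi$ at
  -- $\log g$.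
  have hg : ∀ g : Γ, (expEndo hφ (MonoidAlgebra.single g 1) - 1) - (2 : k) •
      (ofHopf k _ (MonoidAlgebra.single g 1) - 1) ∈ completionFilt k (MonoidAlgebra k Γ) 2 := by
    intro g
    have h : proj k (MonoidAlgebra k Γ) 2 (φ (logSingle k g)) -
        (2 : k) • proj k (MonoidAlgebra k Γ) 2 (logSingle k g) = 0 := by
      rw [← map_smul, ← map_sub]
      exact hφ₂ (logSingle k g)
    rw [expEndo_single, ← expPrim_logSingle, mem_completionFilt_iff, map_sub, map_smul, map_sub,
      map_sub, map_one, proj_two_expPrim, proj_two_expPrim, add_sub_cancel_left,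
      add_sub_cancel_left, h]
  have h₁ : ∀ x ∈ augFilt k (MonoidAlgebra k Γ) 1,
      expEndo hφ x - (2 : k) • ofHopf k _ x ∈ completionFilt k (MonoidAlgebra k Γ) 2 := by
    -- Replacing $x$ by $x-\varepsilon(x)$ gives a statement linear in all of $k\Gamma$, which can
    -- be checked on group elements.
    have : ∀ x : MonoidAlgebra k Γ, (expEndo hφ x - CoalgebraStruct.counit (R := k) x • 1) -
        (2 : k) • (ofHopf k _ x - CoalgebraStruct.counit (R := k) x • 1) ∈
          completionFilt k (MonoidAlgebra k Γ) 2 := by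
      intro x
      induction x using MonoidAlgebra.induction_linear with
      | zero => simp
      | add x y hx hy =>
        convert Submodule.add_mem _ hx hy using 1
        simp only [map_add, add_smul, smul_add, smul_sub]
        abel
      | single g c =>
        have hc : (MonoidAlgebra.single g c : MonoidAlgebra k Γ) = c • MonoidAlgebra.single g 1 := by
          rw [MonoidAlgebra.smul_single, smul_eq_mul, mul_one]
        rw [hc, map_smul, map_smul, map_smul, MonoidAlgebra.counit_single]
        convert Submodule.smul_mem _ c (hg g) using 1
        simp only [smul_sub, smul_comm c (2 : k)]
        simp
    intro x hx
    have h := this x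
    rwa [mem_augFilt_one.1 hx, zero_smul, sub_zero, sub_zero] at h
  induction n generalizing x with
  | zero =>
    -- For $y=x-\varepsilon(x)$, adding $\theta(y)-2y$ and $y$, both in $F^1$, gives $\theta(x)-x$.
    have h := completionFilt_anti (show 1 ≤ 2 by omega) (h₁ _ (sub_counit_mem x))
    have h' := ofHopf_mem.2 (sub_counit_mem (k := k) x)
    have h'' := Submodule.add_mem _ h h'
    rw [map_sub, map_sub, map_smul, map_smul, map_one, map_one, two_smul] at h''
    convert h'' using 1
    simp only [pow_zero, one_smul]
    abel
  | succ n ih =>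
    refine augFilt_succ_induction (S := (completionFilt k (MonoidAlgebra k Γ) (n + 1 + 1)).comap
      ((expEndo hφ).toLinearMap - (2 : k) ^ (n + 1) • (ofHopf k _).toLinearMap))
      (fun x hx y hy => ?_) hx
    have hy' := ih hy
    have hθy : expEndo hφ y ∈ completionFilt k (MonoidAlgebra k Γ) n := by
      have := Submodule.add_mem _ (completionFilt_anti n.le_succ hy')
        (Submodule.smul_mem _ ((2 : k) ^ n) (ofHopf_mem.2 hy))
      rwa [sub_add_cancel] at this
    -- The decomposition used is $\theta(xy)-2^{n+1}xy=(\theta x-2x)\,\theta y+2x\,(\theta y-2^ny)$.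
    have e₁ := mul_mem_completionFilt (h₁ x hx) hθy
    have e₂ := mul_mem_completionFilt (Submodule.smul_mem _ (2 : k) (ofHopf_mem.2 hx)) hy'
    rw [show 2 + n = n + 1 + 1 by omega] at e₁
    rw [show 1 + (n + 1) = n + 1 + 1 by omega] at e₂
    change expEndo hφ (x * y) - (2 : k) ^ (n + 1) • ofHopf k _ (x * y) ∈
      completionFilt k (MonoidAlgebra k Γ) (n + 1 + 1)
    convert Submodule.add_mem _ e₁ e₂ using 1
    rw [map_mul, map_mul, sub_mul, mul_sub, smul_mul_smul_comm, ← pow_succ']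
    abel

theorem expEndo_mem (n : ℕ) (x : MonoidAlgebra k Γ) (hx : x ∈ augFilt k (MonoidAlgebra k Γ) n) :
    expEndo hφ x ∈ completionFilt k (MonoidAlgebra k Γ) n := by
  have := Submodule.add_mem _ (completionFilt_anti n.le_succ (expEndo_sub_mem hφ hφ₂ hx))
    (Submodule.smul_mem _ ((2 : k) ^ n) (ofHopf_mem.2 hx))
  rwa [sub_add_cancel] at this

/-- The degree zero case: $\theta$ preserves the augmentation, so its transpose fixes the unit of
$(k\Gamma)'$. -/
theorem proj_one_expEndo (x : MonoidAlgebra k Γ) :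
    proj k _ 1 (expEndo hφ x) = Ideal.Quotient.mk _ x := by
  have := expEndo_sub_mem hφ hφ₂ (mem_augFilt_zero x)
  rwa [pow_zero, one_smul, mem_completionFilt_iff, map_sub, sub_eq_zero] at this

variable [Group.FG Γ]

/-- The bialgebra endomorphism of `(k Γ)'` induced by a filtered endomorphism of the Malcev Lie
algebra which acts by `2` on `F^1 / F^2`. -/
def dualEndo : HopfDual k (MonoidAlgebra k Γ) →ₐc[k] HopfDual k (MonoidAlgebra k Γ) :=
  BialgHom.ofAlgHom
    (AlgHom.ofLinearMap (transposeHat (expEndo hφ) (expEndo_mem hφ hφ₂))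
      (ev_injective (funext fun x =>
        evHat_eq one_mem_dualFilt Nat.zero_lt_one (proj_one_expEndo hφ hφ₂ x)))
      fun α β => Subtype.ext (WithConv.ext (by
        -- Multiplicativity of the transpose need only be tested on group elements; there
        -- $\theta(g)$ is an exponential of a primitive element, hence group-like, and evaluation at
        -- it is a character.
        refine MonoidAlgebra.lhom_ext' fun g => LinearMap.ext_ring ?_
        have hg : IsGroupLikeHat (expEndo hφ (MonoidAlgebra.single g 1)) := by
          rw [expEndo_single]; exact isGroupLikeHat_expPrim _
        let r : Coalgebra.Repr k (MonoidAlgebra.single g 1 : MonoidAlgebra k Γ) Unit :=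
          ⟨{()}, fun _ => .single g 1, fun _ => .single g 1, by simp⟩
        refine (evHat_mul hg α β).trans (Eq.trans ?_ (ev_mul _ _ r).symm)
        exact (Finset.sum_singleton _ _).symm)))
    (AlgHom.ext fun α => counit_transposeHat _ (expEndo_mem hφ hφ₂) α)
    (AlgHom.ext fun α => (comul_transposeHat _ (expEndo_mem hφ hφ₂) α).symm)

/-- A form vanishing on $J^{n+1}$ kills $\theta(x)-2^nx\in F^{n+1}$. Thus $\psi\alpha-2^n\alpha$
lies in $(J^n)^\perp$, one step down the filtration. -/
theorem dualEndo_sub_eq_zero {n : ℕ} {α : HopfDual k (MonoidAlgebra k Γ)}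
    (hα : α.1 ∈ dualFilt k (MonoidAlgebra k Γ) n) {x : MonoidAlgebra k Γ}
    (hx : x ∈ augFilt k (MonoidAlgebra k Γ) n) :
    ev k _ (dualEndo hφ hφ₂ α - (2 : k) ^ n • α) x = 0 := by
  have h := expEndo_sub_mem hφ hφ₂ hx
  rw [mem_completionFilt_iff, map_sub, sub_eq_zero, ← map_smul, proj_ofHopf] at h
  rw [map_sub, Pi.sub_apply, sub_eq_zero, map_smul, Pi.smul_apply, smul_eq_mul, ← ev_map_smul]
  exact evHat_eq hα n.lt_succ_self h

end Exponentiate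

/-! ### The filtration by iterated reduced coproducts of `H'` -/

section HeartDual

variable {k H : Type*} [Field k] [Ring H] [HopfAlgebra k H]

/-- The restriction of the elements of `H'` to a subset of `H`. -/
def restrictEv (X : Set H) : HopfDual k H →ₗ[k] (X → k) :=
  LinearMap.funLeft k k ((↑) : X → H) ∘ₗ ev k H

theorem mem_ker_restrictEv {X : Set H} {α : HopfDual k H} :
    α ∈ LinearMap.ker (restrictEv X) ↔ ∀ x ∈ X, ev k H α x = 0 :=
  ⟨fun h x hx => congrFun (LinearMap.mem_ker.1 h) ⟨x, hx⟩,
    fun h => LinearMap.mem_ker.2 (funext fun x => h x x.2)⟩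

variable [FiniteCotangent k H]

/-- The wedge of $X^\perp$ and $Y^\perp$ is $(XY)^\perp$: since $k^X\otimes k^Y$ embeds in
$k^{X\times Y}$, the restricted coproduct vanishes exactly when all the values $\alpha(xy)$ do. -/
theorem mem_wedge_ker_restrictEv {X Y : Set H} {α : HopfDual k H} :
    α ∈ wedge (LinearMap.ker (restrictEv (k := k) X)) (LinearMap.ker (restrictEv Y)) ↔
      ∀ x ∈ X, ∀ y ∈ Y, ev k H α (x * y) = 0 := by
  have hinj : Function.Injective (evTensor (LinearMap.id : (X → k) →ₗ[k] (X → k))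
      (LinearMap.id : (Y → k) →ₗ[k] (Y → k))) :=
    evTensor_injective Function.injective_id Function.injective_id
  have h : ∀ (u : HopfDual k H ⊗[k] HopfDual k H) (x : X) (y : Y),
      evTensor LinearMap.id LinearMap.id (TensorProduct.map (restrictEv X) (restrictEv Y) u) (x, y) =
        ev₂ k H u (x, y) := by
    intro u x y
    induction u with
    | zero => simp
    | add a b ha hb => simp only [map_add, Pi.add_apply, ha, hb]
    | tmul a b => rfl
  rw [← ker_map_comul, LinearMap.mem_ker, LinearMap.comp_apply, ← map_eq_zero_iff _ hinj]
  constructor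
  · intro h₀ x hx y hy
    rw [← ev₂_dualComul]
    exact (h _ ⟨x, hx⟩ ⟨y, hy⟩).symm.trans (congrFun h₀ _)
  · intro h₀
    ext ⟨x, y⟩
    rw [h]
    exact (ev₂_dualComul α x y).trans (h₀ x x.2 y y.2)

theorem heartF_zero_eq_ker :
    heartF k (HopfDual k H) 0 = LinearMap.ker (restrictEv (augFilt k H 1 : Set H)) := by
  ext α
  rw [mem_heartF_zero, mem_ker_restrictEv]
  constructor
  · rintro ⟨c, rfl⟩ x hx
    rw [map_smul, Pi.smul_apply, ev_one, mem_augFilt_one.1 hx, smul_zero]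
  · intro h
    -- A form vanishing on $J$ is determined by $\alpha(1)$, because $x-\varepsilon(x)1\in J$.
    refine ⟨ev k H α 1, ev_injective (funext fun x => ?_)⟩
    have := h _ (sub_counit_mem x)
    rw [sub_eq_add_neg, ev_map_add, ← neg_smul, ev_map_smul, neg_mul, add_neg_eq_zero] at this
    rw [this, map_smul, Pi.smul_apply, ev_one, smul_eq_mul, mul_comm]

/-- $F_n^\heartsuit H'=(J^{n+1})^\perp$: the recursion $F_{n+1}^\heartsuit=F_0^\heartsuit\wedge
F_n^\heartsuit$ is dual to $J^{n+2}=J\cdot J^{n+1}$. -/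
theorem heartF_eq_ker (n : ℕ) :
    heartF k (HopfDual k H) n = LinearMap.ker (restrictEv (augFilt k H (n + 1) : Set H)) := by
  induction n with
  | zero => exact heartF_zero_eq_ker
  | succ n ih =>
    ext α
    have h := heartF_wedge (k := k) (O := HopfDual k H) 0 n
    rw [zero_add] at h
    rw [h, ih, heartF_zero_eq_ker, mem_wedge_ker_restrictEv, mem_ker_restrictEv]
    constructor
    · intro h x hx
      exact augFilt_succ_induction (S := LinearMap.ker α.1.ofConv) h hx
    · intro h x hx y hy
      refine h _ ?_
      have := mul_mem_augFilt hx hy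
      rwa [add_comm 1] at this

theorem mem_heartF_iff {n : ℕ} {α : HopfDual k H} :
    α ∈ heartF k (HopfDual k H) n ↔ α.1 ∈ dualFilt k H n := by
  rw [heartF_eq_ker, mem_ker_restrictEv]; rfl

end HeartDual

/-! ### Operators acting by powers of `2` on the graded pieces of a filtration -/

section FilteredOperator

variable {k V : Type*} [Field k] [AddCommGroup V] [Module k V]

/-- The filtration `F` shifted by one, `F_{-1} = 0`. -/
def filtPred (F : ℕ → Submodule k V) : ℕ → Submodule k V
  | 0 => ⊥
  | n + 1 => F n

theorem le_filtPred {F : ℕ → Submodule k V} (hF : Monotone F) {m n : ℕ} (h : m < n) :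
    F m ≤ filtPred F n := by
  cases n with
  | zero => omega
  | succ n => exact hF (Nat.lt_succ_iff.1 h)

theorem filtPred_le {F : ℕ → Submodule k V} (hF : Monotone F) (n : ℕ) : filtPred F n ≤ F n := by
  cases n with
  | zero => exact bot_le
  | succ n => exact hF n.le_succ

open Polynomial in
/-- The product of the operators `T - 2^i`, for `i < n`. -/
def opProd (T : Module.End k V) (n : ℕ) : Module.End k V :=
  aeval T (∏ i ∈ Finset.range n, (X - C ((2 : k) ^ i)))

variable (T : Module.End k V)

theorem opProd_zero (v : V) : opProd T 0 v = v := by simp [opProd]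

/-- The factors commute, so the new one may act first, as here, or last, as in `opProd_succ'`; both
forms are needed. -/
theorem opProd_succ (n : ℕ) (v : V) : opProd T (n + 1) v = opProd T n (T v - (2 : k) ^ n • v) := by
  rw [opProd, Finset.prod_range_succ, map_mul]
  simp only [opProd, Module.End.mul_apply, map_sub, Polynomial.aeval_X, Polynomial.aeval_C,
    LinearMap.sub_apply, Module.algebraMap_end_apply]

theorem opProd_succ' (n : ℕ) (v : V) :
    opProd T (n + 1) v = T (opProd T n v) - (2 : k) ^ n • opProd T n v := by
  rw [opProd, Finset.prod_range_succ_comm, map_mul]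
  simp only [opProd, Module.End.mul_apply, map_sub, Polynomial.aeval_X, Polynomial.aeval_C,
    LinearMap.sub_apply, Module.algebraMap_end_apply]

/-- The scalar by which `opProd T n` acts on the eigenspace for `2^m`. -/
def opScalar (k : Type*) [Field k] (m n : ℕ) : k := ∏ i ∈ Finset.range n, ((2 : k) ^ m - 2 ^ i)

theorem opScalar_ne_zero [CharZero k] (n : ℕ) : opScalar k n n ≠ 0 :=
  Finset.prod_ne_zero_iff.2 fun _ hi => sub_ne_zero.2 fun h =>
    (Finset.mem_range.1 hi).ne' (two_pow_injective (k := k) h)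

theorem opProd_of_eigen {m : ℕ} {v : V} (hv : T v = (2 : k) ^ m • v) (n : ℕ) :
    opProd T n v = opScalar k m n • v := by
  induction n with
  | zero => simp [opProd_zero, opScalar]
  | succ n ih =>
    rw [opProd_succ, hv, ← sub_smul, map_smul, ih, smul_smul, opScalar, opScalar,
      Finset.prod_range_succ, mul_comm]

variable {T} {F : ℕ → Submodule k V} (hF : Monotone F)
  (hT : ∀ n, ∀ v ∈ F n, T v - (2 : k) ^ n • v ∈ filtPred F n)
include hT

/-- Each factor $T-2^i$ sends $F_i$ into $F_{i-1}$, so applying them for $i=n-1,\dots,0$ carries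
$F_{n-1}$ down to $F_{-1}=0$. -/
theorem opProd_eq_zero {n : ℕ} {v : V} (hv : v ∈ filtPred F n) : opProd T n v = 0 := by
  induction n generalizing v with
  | zero => rw [(Submodule.mem_bot k).1 hv, map_zero]
  | succ n ih => rw [opProd_succ, ih (hT n v hv)]

/-- On such a $v$ the operator $\prod_{i<n}(T-2^i)$ is both zero and multiplication by
$\prod_{i<n}(2^n-2^i)\ne0$. This is the uniqueness behind all compatibilities of the splitting. -/
theorem eq_zero_of_mem_filtPred [CharZero k] {n : ℕ} {v : V} (hv : v ∈ filtPred F n)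
    (hTv : T v = (2 : k) ^ n • v) : v = 0 := by
  have h := opProd_eq_zero hT hv
  rw [opProd_of_eigen T hTv] at h
  exact (smul_eq_zero.1 h).resolve_left (opScalar_ne_zero n)

theorem eq_of_sub_mem_filtPred [CharZero k] {n : ℕ} {v w : V} (h : v - w ∈ filtPred F n)
    (hv : T v = (2 : k) ^ n • v) (hw : T w = (2 : k) ^ n • w) : v = w :=
  sub_eq_zero.1 (eq_zero_of_mem_filtPred hT h (by rw [map_sub, hv, hw, smul_sub]))

/-- Applying $T-2^n$ once more gives the product with $n+1$ factors, which kills $F_n$. Hence the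
product with $n$ factors projects $F_n$, up to a scalar, onto eigenvectors. -/
theorem apply_opProd {n : ℕ} {v : V} (hv : v ∈ F n) :
    T (opProd T n v) = (2 : k) ^ n • opProd T n v := by
  rw [← sub_eq_zero, ← opProd_succ']
  exact opProd_eq_zero hT hv

include hF

/-- Modulo $F_{n-1}$ the operator $T$ is the scalar $2^n$, so the product acts on $F_n/F_{n-1}$ by
the corresponding scalar. -/
theorem opProd_sub_mem {n : ℕ} {v : V} (hv : v ∈ F n) (j : ℕ) :
    opProd T j v - opScalar k n j • v ∈ filtPred F n := by
  have hstable : ∀ w ∈ filtPred F n, T w ∈ filtPred F n := by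
    cases n with
    | zero => intro w hw; rw [(Submodule.mem_bot k).1 hw, map_zero]; exact zero_mem _
    | succ n =>
      intro w hw
      have := Submodule.add_mem _ (filtPred_le hF n (hT n w hw)) ((F n).smul_mem ((2 : k) ^ n) hw)
      rwa [sub_add_cancel] at this
  induction j with
  | zero => simp [opProd_zero, opScalar]
  | succ j ih =>
    have h₁ := Submodule.sub_mem _ (hstable _ ih) (Submodule.smul_mem _ ((2 : k) ^ j) ih)
    have h₂ := Submodule.smul_mem _ (opScalar k n j) (hT n v hv)
    convert Submodule.add_mem _ h₁ h₂ using 1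
    rw [opProd_succ', opScalar, Finset.prod_range_succ, ← opScalar, map_sub, map_smul]
    module

end FilteredOperator

/-! ### Splitting a Hopf algebra filtration by a bialgebra endomorphism -/

theorem tensorFilt_mono {k V : Type*} [Field k] [AddCommGroup V] [Module k V]
    {F : ℕ → Submodule k V} (hF : Monotone F) : Monotone (tensorFilt F) := fun m n h =>
  tensorFilt_le fun p q hpq _ hx _ hy =>
    tmul_mem_tensorFilt (show p + (q + (n - m)) = n by omega) hx (hF (by omega) hy)

namespace HopfFiltration

variable {k O : Type*} [Field k] [Ring O] [HopfAlgebra k O] (E : HopfFiltration k O)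

theorem pred_eq (n : ℕ) : E.pred n = filtPred E.F n := by cases n <;> rfl

theorem pred_le (n : ℕ) : E.pred n ≤ E.F n := E.pred_eq n ▸ filtPred_le E.mono n

theorem tmul_mem_filtPred_left {p q : ℕ} {x y : O} (hx : x ∈ E.pred p) (hy : y ∈ E.F q) :
    x ⊗ₜ[k] y ∈ filtPred (tensorFilt E.F) (p + q) := by
  rcases E.mem_pred hx with rfl | ⟨m, hm, hx⟩
  · rw [TensorProduct.zero_tmul]; exact zero_mem _
  · exact le_filtPred (tensorFilt_mono E.mono) (by omega) (tmul_mem_tensorFilt rfl hx hy)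

theorem tmul_mem_filtPred_right {p q : ℕ} {x y : O} (hx : x ∈ E.F p) (hy : y ∈ E.pred q) :
    x ⊗ₜ[k] y ∈ filtPred (tensorFilt E.F) (p + q) := by
  rcases E.mem_pred hy with rfl | ⟨m, hm, hy⟩
  · rw [TensorProduct.tmul_zero]; exact zero_mem _
  · exact le_filtPred (tensorFilt_mono E.mono) (by omega) (tmul_mem_tensorFilt rfl hx hy)

theorem comul_mem_filtPred {n : ℕ} {x : O} (hx : x ∈ E.pred n) :
    (CoalgebraStruct.comul x : O ⊗[k] O) ∈ filtPred (tensorFilt E.F) n := by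
  rcases E.mem_pred hx with rfl | ⟨m, hm, hx⟩
  · rw [map_zero]; exact zero_mem _
  · exact le_filtPred (tensorFilt_mono E.mono) hm (E.comul_mem hx)

theorem component_cls (n : ℕ) (x : E.F n) : E.component n (E.cls n x) = E.toPiece n x :=
  DirectSum.component.lof_self k n _

theorem component_cls_ne {m n : ℕ} (h : m ≠ n) (x : E.F m) : E.component n (E.cls m x) = 0 :=
  (DirectSum.component.of k n m _).trans (dif_neg h)

theorem mem_grLE {n : ℕ} {u : E.Gr} : u ∈ E.grLE n ↔ ∀ m, n < m → E.component m u = 0 := by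
  simp [grLE, Submodule.mem_iInf]

theorem exists_mem_grLE (u : E.Gr) : ∃ n, u ∈ E.grLE n := by
  classical
  refine ⟨(DFinsupp.support u).sup id, E.mem_grLE.2 fun m hm => ?_⟩
  by_contra h
  exact absurd (Finset.le_sup (f := id) (DFinsupp.mem_support_iff.2 h)) (by simpa using hm)

/-- A linear map takes `u` into `W` if it takes the homogeneous components of `u` into `W`. -/
theorem apply_mem_of_component {V : Type*} [AddCommGroup V] [Module k V] (s : E.Gr →ₗ[k] V)
    (W : Submodule k V) {u : E.Gr}
    (h : ∀ n (x : E.F n), E.component n u ≠ 0 → s (E.cls n x) ∈ W) : s u ∈ W := by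
  classical
  rw [← DirectSum.sum_support_of u, map_sum]
  refine Submodule.sum_mem _ fun n hn => ?_
  obtain ⟨x, hx⟩ := E.toPiece_surjective n (u n)
  rw [← hx]
  exact h n x (DFinsupp.mem_support_iff.1 hn)

variable {E} {ψ : O →ₐc[k] O} (hψ : ∀ n, ∀ x ∈ E.F n, ψ x - (2 : k) ^ n • x ∈ E.pred n)

include hψ in
theorem sub_mem_filtPred : ∀ n, ∀ x ∈ E.F n, (ψ : O →ₗ[k] O) x - (2 : k) ^ n • x ∈
    filtPred E.F n := fun n x hx => E.pred_eq n ▸ hψ n x hx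

-- Transfers the hypothesis to $\psi\otimes\psi$ on $O\otimes O$, so that eigenvector uniqueness is
-- also available for comparing coproducts.
include hψ in
theorem map_sub_mem_filtPred : ∀ n, ∀ u ∈ tensorFilt E.F n,
    TensorProduct.map (ψ : O →ₗ[k] O) (ψ : O →ₗ[k] O) u - (2 : k) ^ n • u ∈
      filtPred (tensorFilt E.F) n := by
  intro n
  refine tensorFilt_le (S := (filtPred (tensorFilt E.F) n).comap
    (TensorProduct.map (ψ : O →ₗ[k] O) (ψ : O →ₗ[k] O) - (2 : k) ^ n • LinearMap.id)) ?_
  rintro p q rfl x hx y hy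
  have hψy : ψ y ∈ E.F q := by
    have h := Submodule.add_mem _ (E.pred_le q (hψ q y hy))
      ((E.F q).smul_mem ((2 : k) ^ q) hy)
    rwa [sub_add_cancel] at h
  -- The decomposition is $\psi x\otimes\psi y-2^{p+q}x\otimes y=(\psi x-2^px)\otimes\psi
  -- y+2^px\otimes(\psi y-2^qy)$.
  have h := Submodule.add_mem _ (E.tmul_mem_filtPred_left (hψ p x hx) hψy)
    (E.tmul_mem_filtPred_right ((E.F p).smul_mem ((2 : k) ^ p) hx) (hψ q y hy))
  change ψ x ⊗ₜ[k] ψ y - (2 : k) ^ (p + q) • (x ⊗ₜ[k] y) ∈ filtPred (tensorFilt E.F) (p + q)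
  convert h using 1
  rw [TensorProduct.sub_tmul, TensorProduct.tmul_sub, TensorProduct.tmul_smul,
    ← TensorProduct.smul_tmul', ← TensorProduct.smul_tmul', smul_smul, pow_add, mul_comm]
  abel

/-- The map `gr O → O` which takes the class of `x ∈ F_n` to the eigenvector of `ψ` for the
eigenvalue `2^n` which is congruent to `x` modulo `F_{n-1}`. -/
def splitting : E.Gr →ₗ[k] O :=
  E.grLift (fun n => ((opScalar k n n)⁻¹ • opProd (ψ : O →ₗ[k] O) n) ∘ₗ (E.F n).subtype)
    fun n x hx => by
      rw [LinearMap.comp_apply, LinearMap.smul_apply, Submodule.subtype_apply,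
        opProd_eq_zero (sub_mem_filtPred hψ) (E.pred_eq n ▸ hx), smul_zero]

theorem splitting_cls (n : ℕ) (x : E.F n) : splitting hψ (E.cls n x) =
    (opScalar k n n)⁻¹ • opProd (ψ : O →ₗ[k] O) n x := E.grLift_cls _ _ n x

theorem apply_splitting (n : ℕ) (x : E.F n) :
    ψ (splitting hψ (E.cls n x)) = (2 : k) ^ n • splitting hψ (E.cls n x) := by
  rw [splitting_cls, map_smul, smul_comm]
  exact congrArg _ (apply_opProd (sub_mem_filtPred hψ) x.2)

variable [CharZero k]

theorem splitting_sub_mem (n : ℕ) (x : E.F n) : splitting hψ (E.cls n x) - x ∈ E.pred n := by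
  have h := Submodule.smul_mem _ (opScalar k n n)⁻¹
    (opProd_sub_mem E.mono (sub_mem_filtPred hψ) x.2 n)
  rwa [smul_sub, smul_smul, inv_mul_cancel₀ (opScalar_ne_zero n), one_smul, ← splitting_cls,
    ← E.pred_eq] at h

theorem splitting_mem (n : ℕ) (x : E.F n) : splitting hψ (E.cls n x) ∈ E.F n := by
  have h := Submodule.add_mem _ (E.pred_le n (splitting_sub_mem hψ n x)) x.2
  rwa [sub_add_cancel] at h

include hψ in
theorem eq_of_sub_mem_pred {n : ℕ} {x y : O} (h : x - y ∈ E.pred n)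
    (hx : ψ x = (2 : k) ^ n • x) (hy : ψ y = (2 : k) ^ n • y) : x = y :=
  eq_of_sub_mem_filtPred (T := (ψ : O →ₗ[k] O)) (sub_mem_filtPred hψ) (E.pred_eq n ▸ h) hx hy

theorem splitting_one : splitting hψ 1 = 1 := by
  have h := splitting_sub_mem hψ 0 ⟨1, E.one_mem⟩
  exact sub_eq_zero.1 ((Submodule.mem_bot k).1 h)

/-- On classes of degrees $m$ and $n$, both sides are eigenvectors for $2^{m+n}$, as $\psi$ is
multiplicative, and both represent $xy$ modulo $F_{m+n-1}$; they agree by uniqueness. -/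
theorem splitting_mul (u v : E.Gr) :
    splitting hψ (u * v) = splitting hψ u * splitting hψ v := by
  have : (LinearMap.mul k E.Gr).compr₂ (splitting hψ) =
      (LinearMap.mul k O).compl₁₂ (splitting hψ) (splitting hψ) := by
    refine gr_ext fun m x => gr_ext fun n y => ?_
    change splitting hψ (E.cls m x * E.cls n y) =
      splitting hψ (E.cls m x) * splitting hψ (E.cls n y)
    rw [cls_mul]
    refine eq_of_sub_mem_pred hψ (n := m + n) ?_ (apply_splitting hψ _ _) ?_
    · have h₁ := splitting_sub_mem hψ (m + n) ⟨x * y, E.mul_mem x.2 y.2⟩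
      have h₂ := E.mul_mem_pred_left (splitting_sub_mem hψ m x) (splitting_mem hψ n y)
      have h₃ := E.mul_mem_pred_right x.2 (splitting_sub_mem hψ n y)
      convert Submodule.sub_mem _ h₁ (Submodule.add_mem _ h₂ h₃) using 1
      noncomm_ring
    · rw [map_mul, apply_splitting, apply_splitting, smul_mul_smul_comm, pow_add]
  exact LinearMap.congr_fun (LinearMap.congr_fun this u) v

/-- In degree $n>0$, invariance of the counit under $\psi$ gives $2^n\varepsilon=\varepsilon$ on the
eigenvector, so the counit vanishes there as it does on the graded side. -/
theorem splitting_counit (u : E.Gr) :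
    CoalgebraStruct.counit (R := k) (splitting hψ u) = CoalgebraStruct.counit (R := k) u := by
  have : CoalgebraStruct.counit (R := k) ∘ₗ splitting hψ = E.grCounit := by
    refine gr_ext fun n x => ?_
    rw [LinearMap.comp_apply]
    rcases Nat.eq_zero_or_pos n with rfl | hn
    · rw [grCounit_cls_zero, sub_eq_zero.1 ((Submodule.mem_bot k).1 (splitting_sub_mem hψ 0 x))]
    · rw [grCounit_cls_pos hn.ne']
      have h := congrArg (CoalgebraStruct.counit (R := k)) (apply_splitting hψ n x)
      rw [CoalgHomClass.counit_comp_apply, map_smul, eq_comm, ← sub_eq_zero, smul_eq_mul,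
        ← sub_one_mul] at h
      refine (mul_eq_zero.1 h).resolve_left (sub_ne_zero.2 fun h' => ?_)
      exact hn.ne (two_pow_injective (k := k) (by simpa using h'.symm))
  exact LinearMap.congr_fun this u

/-- The argument for products, carried out in $O\otimes O$: both sides are $2^n$-eigenvectors of
$\psi\otimes\psi$ and are congruent to $\Delta x$ one step down the tensor filtration. -/
theorem splitting_comul (u : E.Gr) :
    TensorProduct.map (splitting hψ) (splitting hψ) (CoalgebraStruct.comul u) =
      (CoalgebraStruct.comul (splitting hψ u) : O ⊗[k] O) := by
  set s := splitting hψ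
  set T := TensorProduct.map (ψ : O →ₗ[k] O) (ψ : O →ₗ[k] O)
  have : TensorProduct.map s s ∘ₗ E.grComul = CoalgebraStruct.comul ∘ₗ s := by
    refine gr_ext fun n x => ?_
    rw [LinearMap.comp_apply, LinearMap.comp_apply, grComul_cls]
    have hx := E.comul_mem x.2
    refine eq_of_sub_mem_filtPred (T := T) (n := n) (map_sub_mem_filtPred hψ) ?_ ?_ ?_
    · have h₁ : ∀ u ∈ tensorFilt E.F n, TensorProduct.map s s (E.symb n u) - u ∈
          filtPred (tensorFilt E.F) n := by
        refine tensorFilt_le (S := (filtPred (tensorFilt E.F) n).comap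
          (TensorProduct.map s s ∘ₗ E.symb n - LinearMap.id)) ?_
        rintro p q rfl x hx y hy
        have h₂ := E.tmul_mem_filtPred_left (splitting_sub_mem hψ p ⟨x, hx⟩)
          (splitting_mem hψ q ⟨y, hy⟩)
        have h₃ := E.tmul_mem_filtPred_right hx (splitting_sub_mem hψ q ⟨y, hy⟩)
        rw [Submodule.mem_comap, LinearMap.sub_apply, LinearMap.comp_apply,
          E.symb_tmul rfl hx hy, TensorProduct.map_tmul, LinearMap.id_apply]
        convert Submodule.add_mem _ h₂ h₃ using 1
        rw [TensorProduct.sub_tmul, TensorProduct.tmul_sub]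
        abel
      have h₂ := E.comul_mem_filtPred (splitting_sub_mem hψ n x)
      convert Submodule.sub_mem _ (h₁ _ hx) h₂ using 1
      rw [map_sub]
      abel
    · refine eqOn_tensorFilt (f := T ∘ₗ TensorProduct.map s s ∘ₗ E.symb n)
        (g := (2 : k) ^ n • (TensorProduct.map s s ∘ₗ E.symb n)) ?_ hx
      rintro p q rfl x hx y hy
      rw [LinearMap.comp_apply, LinearMap.smul_apply, LinearMap.comp_apply, E.symb_tmul rfl hx hy,
        TensorProduct.map_tmul]
      change ψ _ ⊗ₜ[k] ψ _ = _
      rw [apply_splitting, apply_splitting, TensorProduct.smul_tmul_smul, pow_add]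
    · rw [← map_smul, ← apply_splitting]
      exact CoalgHomClass.map_comp_comul_apply ψ (s (E.cls n x))
  exact LinearMap.congr_fun this u

theorem splitting_mem_pred {n : ℕ} {u : E.Gr} (h : ∀ m, n ≤ m → E.component m u = 0) :
    splitting hψ u ∈ E.pred n :=
  E.apply_mem_of_component _ _ fun m x hm =>
    E.le_pred (not_le.1 fun h' => hm (h m h')) (splitting_mem hψ m x)

/-- Strictness of the splitting: passing to $O$ creates no cancellation between leading terms. It
gives injectivity and the filtered and graded properties of the inverse. -/
theorem component_eq_zero_of_splitting_mem {n : ℕ} {u : E.Gr} (h : splitting hψ u ∈ E.pred n) :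
    ∀ m, n ≤ m → E.component m u = 0 := by
  obtain ⟨N, hN⟩ := E.exists_mem_grLE u
  rw [E.mem_grLE] at hN
  -- Descent on the top degree $n+d$ of $u$. If $x$ represents the top component, then $s(u)$ and
  -- $s(u)-s([x])$ lie in $F_{n+d-1}$, and $s([x])\equiv x$ modulo it, so the class of $x$ is zero.
  have key : ∀ d, (∀ m, n + d ≤ m → E.component m u = 0) → ∀ m, n ≤ m → E.component m u = 0 := by
    intro d
    induction d with
    | zero => exact id
    | succ d ih =>
      intro hd
      refine ih fun m hm => ?_
      rcases Nat.lt_or_ge (n + d) m with hlt | hge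
      · exact hd m hlt
      obtain rfl : m = n + d := le_antisymm hge hm
      obtain ⟨x, hx⟩ := E.toPiece_surjective (n + d) (E.component (n + d) u)
      have h₁ : splitting hψ (u - E.cls (n + d) x) ∈ E.pred (n + d) := by
        refine splitting_mem_pred hψ fun m hm => ?_
        rw [map_sub]
        rcases Nat.lt_or_ge (n + d) m with hlt | hge
        · rw [hd m hlt, E.component_cls_ne hlt.ne, sub_zero]
        · obtain rfl : m = n + d := le_antisymm hge hm
          rw [E.component_cls, hx, sub_self]
      have h₂ : splitting hψ u ∈ E.pred (n + d) := by
        rcases Nat.eq_zero_or_pos d with rfl | hd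
        · exact h
        · exact E.le_pred (by omega) (E.pred_le n h)
      have h₃ := Submodule.sub_mem _ (Submodule.sub_mem _ h₂ h₁) (splitting_sub_mem hψ (n + d) x)
      rw [map_sub, sub_sub_cancel, sub_sub_cancel] at h₃
      rw [← hx, E.toPiece_eq_zero]
      exact h₃
  exact key (N + 1) fun m hm => hN m (by omega)

theorem splitting_injective : Function.Injective (splitting hψ) := by
  rw [injective_iff_map_eq_zero]
  intro u hu
  have h := component_eq_zero_of_splitting_mem hψ (n := 0) (u := u) (by rw [hu]; exact zero_mem _)
  exact DFinsupp.ext fun m => h m m.zero_le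

/-- An element of $F_n$ differs from the splitting of its class by an element of $F_{n-1}$, to which
induction applies. -/
theorem le_range_splitting (n : ℕ) : E.F n ≤ LinearMap.range (splitting hψ) := by
  induction n using Nat.strong_induction_on with
  | _ n ih =>
    intro x hx
    have h : splitting hψ (E.cls n ⟨x, hx⟩) - x ∈ LinearMap.range (splitting hψ) := by
      rcases E.mem_pred (splitting_sub_mem hψ n ⟨x, hx⟩) with h | ⟨m, hm, h⟩
      · rw [h]; exact zero_mem _
      · exact ih m hm h
    have := Submodule.sub_mem _ (LinearMap.mem_range_self (splitting hψ) (E.cls n ⟨x, hx⟩)) h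
    rwa [sub_sub_cancel] at this

/-- A bialgebra endomorphism which acts by `2^n` on `F_n / F_{n-1}` splits an exhaustive Hopf algebra
filtration. -/
theorem exists_bialgEquiv_gr (hE : ∀ x, ∃ n, x ∈ E.F n)
    (hψ : ∀ n, ∀ x ∈ E.F n, ψ x - (2 : k) ^ n • x ∈ E.pred n) :
    ∃ Φ : O ≃ₐc[k] E.Gr, (∀ (n : ℕ) (x : O), x ∈ E.F n ↔ Φ x ∈ E.grLE n) ∧
      ∀ (n : ℕ) (x : E.F n), E.component n (Φ x) = E.toPiece n x := by
  let S : E.Gr →ₐc[k] O := BialgHom.ofAlgHom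
    (AlgHom.ofLinearMap (splitting hψ) (splitting_one hψ) (splitting_mul hψ))
    (AlgHom.ext fun u => splitting_counit hψ u) (AlgHom.ext fun u => splitting_comul hψ u)
  have hS : Function.Bijective S := ⟨splitting_injective hψ, fun x => by
    obtain ⟨n, hn⟩ := hE x
    exact le_range_splitting hψ n hn⟩
  let Φ := (BialgEquiv.ofBijective S hS).symm
  have hΦ : ∀ x, splitting hψ (Φ x) = x := fun x =>
    (BialgEquiv.ofBijective S hS).apply_symm_apply x
  refine ⟨Φ, fun n x => ?_, fun n x => ?_⟩
  · rw [E.mem_grLE]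
    constructor
    · exact fun hx => component_eq_zero_of_splitting_mem hψ (n := n + 1) (by rwa [hΦ])
    · intro h
      rw [← hΦ x]
      exact splitting_mem_pred hψ (n := n + 1) h
  -- The splitting sends $\Phi x-[x]$ to $x-s([x])\in F_{n-1}$, so by strictness its degree $n$
  -- component vanishes.
  · have h := component_eq_zero_of_splitting_mem hψ (n := n) (u := Φ x - E.cls n x) (by
      rw [map_sub, hΦ, ← neg_sub]
      exact Submodule.neg_mem _ (splitting_sub_mem hψ n x)) n le_rfl
    rwa [map_sub, component_cls, sub_eq_zero] at h

end HopfFiltration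

/-! ### The scaling endomorphism of a filtered formal Lie algebra -/

namespace LieFiltration

variable {k L : Type*} [Field k] [LieRing L] [LieAlgebra k L] (E : LieFiltration k L)

/-- The linear endomorphism of the completed associated graded Lie algebra which multiplies the
component of degree `n` by `c^n`. -/
def grScaleLinear (c : k) : E.GrHat →ₗ[k] E.GrHat :=
  LinearMap.pi (φ := E.Piece) fun n => c ^ n • E.component n

theorem component_grScaleLinear (c : k) (n : ℕ) (x : E.GrHat) :
    E.component n (E.grScaleLinear c x) = c ^ n • E.component n x := rfl

/-- The Lie algebra endomorphism of the completed associated graded Lie algebra which multiplies the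
component of degree `n` by `c^n`. -/
def grScale (c : k) : E.GrHat →ₗ⁅k⁆ E.GrHat where
  toLinearMap := E.grScaleLinear c
  map_lie' {x y} := grHat_ext fun n => by
    refine (E.component_grScaleLinear c n ⁅x, y⁆).trans ?_
    change _ = E.component n ⁅E.grScaleLinear c x, E.grScaleLinear c y⁆
    rw [component_lie, component_lie, Finset.smul_sum]
    -- The bracket adds degrees, and $c^ic^j=c^{i+j}$.
    refine Finset.sum_congr rfl fun p _ => ?_
    rw [component_grScaleLinear, component_grScaleLinear, map_smul, map_smul, LinearMap.smul_apply,
      smul_smul, mul_comm, ← pow_add]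
    exact congrArg (fun m => c ^ m • _) (Finset.HasAntidiagonal.mem_antidiagonal.1 p.2).symm

theorem component_grScale (c : k) (n : ℕ) (x : E.GrHat) :
    E.component n (E.grScale c x) = c ^ n • E.component n x := rfl

theorem mem_grHatFilt {n : ℕ} {x : E.GrHat} :
    x ∈ E.grHatFilt n ↔ ∀ i < n, E.component i x = 0 := by
  simp [grHatFilt, Submodule.mem_iInf]

/-- A filtered Lie algebra isomorphism to the completed associated graded transports the scaling
endomorphism. -/
theorem exists_scaling (Φ : L ≃ₗ⁅k⁆ E.GrHat) (hΦ : ∀ n x, x ∈ E.F n ↔ Φ x ∈ E.grHatFilt n)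
    (c : k) : ∃ φ : L →ₗ⁅k⁆ L, (∀ n x, x ∈ E.F n → φ x ∈ E.F n) ∧
      ∀ x, φ x - c • x ∈ E.F 2 := by
  let φ : L →ₗ⁅k⁆ L := Φ.symm.toLieHom.comp ((E.grScale c).comp Φ.toLieHom)
  have hφ : ∀ x, Φ (φ x) = E.grScale c (Φ x) := fun x => Φ.apply_symm_apply _
  refine ⟨φ, fun n x hx => ?_, fun x => ?_⟩
  · rw [hΦ, mem_grHatFilt] at hx ⊢
    intro i hi
    rw [hφ, component_grScale, hx i hi, smul_zero]
  · rw [hΦ, mem_grHatFilt]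
    intro i hi
    rw [map_sub, map_smul, hφ, map_sub, component_grScale, map_smul]
    -- Modulo $F^2$ only degrees $0$ and $1$ remain: $\mathrm{gr}^0=0$, and in degree $1$ the
    -- scaling is by $c$ itself.
    interval_cases i
    · exact E.piece_zero _
    · rw [pow_one, sub_self]

end LieFiltration

/-- If a finitely generated group `Γ` is filtered formal, then so is the Hopf algebra `(k Γ)'`. -/
theorem isFilteredFormalHopf_of_isFilteredFormalGroup {k Γ : Type*} [Field k] [CharZero k]
    [Group Γ] [Group.FG Γ] (h : IsFilteredFormalGroup k Γ) :
    IsFilteredFormalHopf k (HopfDual k (MonoidAlgebra k Γ)) := by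
  obtain ⟨Φ, hΦ, -⟩ := h
  -- The scalar $2$ is chosen because its powers are pairwise distinct in characteristic zero, as
  -- separating the degrees requires.
  obtain ⟨φ, hφ, hφ₂⟩ := (malcevFilt k Γ).exists_scaling Φ hΦ 2
  refine HopfFiltration.exists_bialgEquiv_gr (E := heart k _) (ψ := dualEndo hφ hφ₂) ?_ ?_
  · intro α
    obtain ⟨n, hn⟩ := α.2
    exact ⟨n, mem_heartF_iff.2 hn⟩
  · intro n α hα
    have hα' := mem_heartF_iff.1 hα
    cases n with
    | zero =>
      -- In degree $0$ the difference must be exactly zero, as $F_{-1}=0$; it vanishes on $J^0$,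
      -- which is all of $k\Gamma$.
      refine (Submodule.mem_bot k).2 (ev_injective (funext fun x => ?_))
      rw [dualEndo_sub_eq_zero hφ hφ₂ hα' (mem_augFilt_zero x), map_zero, Pi.zero_apply]
    | succ n =>
      exact mem_heartF_iff.2 fun x hx => dualEndo_sub_eq_zero hφ hφ₂ hα' hx

end FilteredFormality

end

theorem mainTheorem8 (Γ : Type*) [Group Γ] [Group.FG Γ]
    (h : FilteredFormality.IsFilteredFormalGroup ℂ Γ) :
    FilteredFormality.IsFilteredFormalHopf ℂ
      (FilteredFormality.HopfDual ℂ (MonoidAlgebra ℂ Γ)) :=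
  FilteredFormality.isFilteredFormalHopf_of_isFilteredFormalGroup h
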